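/- **Setting.** For $n\in\mathbb Z_{\ge0}$ let $\Lambda_n:=[-n,n]^2\cap\mathbb Z^2$ with its nearest-neighbour edges $\mathbb E(\Lambda_n)$ and their directed versions $\vec{\mathbb E}(\Lambda_n)$, and let $\beta\in[0,\infty)$. *XY model.* With $d\sigma$ the Haar probability measure on $(\mathbb S^1)^{\Lambda_n}$, $\mathbb S^1\subset\mathbb C$, let $$\langle f\rangle_{n,\beta}:=\frac1{Z_{n,\beta}}\int d\sigma\, f(\sigma)\exp\sum_{\{x,y\}\in\mathbb E(\Lambda_n)}\frac\beta2(\sigma_x\bar\sigma_y+\bar\sigma_x\sigma_y),\qquad \langle 1\rangle_{n,\beta}=1,$$ let $\langle\sigma_x\bar\sigma_y\rangle_{\mathbb Z^2,\beta}:=\lim_{n\to\infty}\langle\sigma_x\bar\sigma_y\rangle_{n,\beta}$, and let the mass of the XY model be $$m_{XY}(\beta):=\lim_{k\to\infty}-\frac1k\log\langle\sigma_{(0,0)}\bar\sigma_{(k,0)}\rangle_{\mathbb Z^2,\beta}\in[0,\infty].$$ *Height function.* A current is a function $\mathbf n:\vec{\mathbb E}(\Lambda_n)\to\mathbb Z_{\ge0}$;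 it is sourceless, $\partial\mathbf n=0$, if $\sum_{y\sim x}(\mathbf n_{xy}-\mathbf n_{yx})=0$ for all $x\in\Lambda_n$. Sourceless currents are sampled with probability proportional to $\prod_{xy\in\vec{\mathbb E}(\Lambda_n)}(\beta/2)^{\mathbf n_{xy}}/\mathbf n_{xy}!$. Index the bounded faces of $\mathbb Z^2$ by their lower-left vertex. The height function $h$ of a sourceless current is the integer-valued function on faces with $h(F_a)=0$ for $a\notin[-n,n)^2$ and $h(F_a)-h(F_b)=\mathbf n_{xy}-\mathbf n_{yx}$ whenever the directed edge $xy$ has $F_a$ on its right and $F_b$ on its left. Let $\mathrm{Cov}_{n,\beta}[a;b]$ be the expectation of $h(F_a)h(F_b)$, let $\mathrm{Cov}_{\infty,\beta}[a;b]:=\lim_{n\to\infty}\mathrm{Cov}_{n,\beta}[a;b]\in[0,\infty]$, and let the mass of the height function be $$m_{\mathrm{Height}}(\beta):=\liminf_{k\to\infty}-\frac1k\log\big(\mathrm{Cov}_{\infty,\beta}[(0,0);(0,k)]\wedge1\big)\in[0,\infty].$$ (The limits above are known to exist. Conventions: $\log0=-\infty$, $e^{-\infty}=0$.) **Corollary.**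 For every $\beta\in[0,\infty)$, as $n\to\infty$, $$\mathrm{Cov}_{\infty,\beta}[(0,0);(0,n)]\ \ge\ e^{-2m_{XY}(\beta)n+o(n)},$$ where the $o(n)$ term may depend on $\beta$. In particular, $m_{\mathrm{Height}}(\beta)\le 2m_{XY}(\beta)$. -/

import Mathlib

open MeasureTheory Filter Topology Asymptotics

namespace XYHeight

/-! ### The boxes and their edges -/

/-- The box `Λ_n = [-n, n]² ∩ ℤ²`. -/
noncomputable def box (n : ℕ) : Finset (ℤ × ℤ) :=
  Finset.Icc (-(n : ℤ)) n ×ˢ Finset.Icc (-(n : ℤ)) n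

/-- Nearest neighbours in `ℤ²`: the Euclidean distance is one. -/
def Adj (x y : ℤ × ℤ) : Prop := (x.1 - y.1) ^ 2 + (x.2 - y.2) ^ 2 = 1

instance (x y : ℤ × ℤ) : Decidable (Adj x y) :=
  inferInstanceAs (Decidable ((x.1 - y.1) ^ 2 + (x.2 - y.2) ^ 2 = 1))

/-- The directed edges of `Λ_n`. Every undirected edge `{x, y}` gives the two directed edges
`(x, y)` and `(y, x)`. -/
noncomputable def dirEdges (n : ℕ) : Finset ((ℤ × ℤ) × (ℤ × ℤ)) :=
  (box n ×ˢ box n).filter fun e => Adj e.1 e.2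

/-! ### The XY model -/

noncomputable instance : MeasurableSpace Circle := borel Circle

instance : BorelSpace Circle := ⟨rfl⟩

/-- The Haar probability measure on `(𝕊¹)^{Λ_n}`. -/
noncomputable def spinMeasure (n : ℕ) : Measure (box n → Circle) :=
  Measure.pi fun _ => Measure.haarMeasure ⊤

/-- The spin `σ_x ∈ 𝕊¹ ⊆ ℂ` for `x ∈ Λ_n` (and zero outside the box). -/
noncomputable def spin {n : ℕ} (σ : box n → Circle) (x : ℤ × ℤ) : ℂ :=
  if h : x ∈ box n then (σ ⟨x, h⟩ : ℂ) else 0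

/-- The Boltzmann weight `exp ∑_{{x,y}} (β/2) (σ_x σ̄_y + σ̄_x σ_y)`. The sum runs over
directed edges; the two directions of `{x, y}` contribute
`2 * (β/2) * Re (σ_x σ̄_y) = (β/2) (σ_x σ̄_y + σ̄_x σ_y)` together. -/
noncomputable def xyWeight {n : ℕ} (β : ℝ) (σ : box n → Circle) : ℝ :=
  Real.exp (∑ e ∈ dirEdges n, β / 2 * (spin σ e.1 * (starRingEnd ℂ) (spin σ e.2)).re)

/-- The partition function `Z_{n,β}` of the XY model. -/
noncomputable def xyPartition (n : ℕ) (β : ℝ) : ℝ :=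
  ∫ σ, xyWeight β σ ∂(spinMeasure n)

/-- The expectation `⟨f⟩_{n,β}`. -/
noncomputable def xyExpect (n : ℕ) (β : ℝ) (f : (box n → Circle) → ℂ) : ℂ :=
  (∫ σ, f σ * (xyWeight β σ : ℂ) ∂(spinMeasure n)) / (xyPartition n β : ℂ)

/-- The finite-volume two-point function `⟨σ_x σ̄_y⟩_{n,β}`. It is a real number since the model
is invariant under complex conjugation of the spins; hence the real part. -/
noncomputable def xyTwoPointBox (n : ℕ) (β : ℝ) (x y : ℤ × ℤ) : ℝ :=
  (xyExpect n β fun σ => spin σ x * (starRingEnd ℂ) (spin σ y)).re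

/-- The two-point function `⟨σ_x σ̄_y⟩_{ℤ²,β}` of the infinite-volume limit. The limit over the
boxes exists, so the upper limit is the limit. -/
noncomputable def xyTwoPoint (β : ℝ) (x y : ℤ × ℤ) : ℝ :=
  limsup (fun n : ℕ => xyTwoPointBox n β x y) atTop

/-- The mass of the XY model in `[0, ∞]`: the limit of
`-(1/k) log ⟨σ_{(0,0)} σ̄_{(k,0)}⟩_{ℤ²,β}`, where `log 0 = -∞`. The limit exists, so the lower
limit is the limit. -/
noncomputable def massXY (β : ℝ) : EReal :=
  liminf (fun k : ℕ => ((-(1 / (k : ℝ)) : ℝ) : EReal) *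
    ENNReal.log (ENNReal.ofReal (xyTwoPoint β (0, 0) ((k : ℤ), 0)))) atTop

/-! ### Currents and the dual height function -/

/-- Currents: functions from the directed edges of `Λ_n` to `ℤ_{≥ 0}`. -/
abbrev Current (n : ℕ) : Type := dirEdges n → ℕ

/-- The value `𝐧_{xy}`, extended by zero to pairs that are not directed edges of `Λ_n`. -/
noncomputable def Current.val {n : ℕ} (c : Current n) (x y : ℤ × ℤ) : ℕ :=
  if h : (x, y) ∈ dirEdges n then c ⟨(x, y), h⟩ else 0

/-- The net flow `𝐧_{xy} - 𝐧_{yx}`. -/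
noncomputable def Current.flow {n : ℕ} (c : Current n) (x y : ℤ × ℤ) : ℤ :=
  (c.val x y : ℤ) - (c.val y x : ℤ)

/-- The source function `∂𝐧(x) = ∑_{y ∼ x} (𝐧_{xy} - 𝐧_{yx})`. -/
noncomputable def Current.source {n : ℕ} (c : Current n) (x : ℤ × ℤ) : ℤ :=
  ∑ y ∈ (box n).filter (Adj x), c.flow x y

/-- Sourceless currents: `∂𝐧 = 0` on `Λ_n`. -/
noncomputable def Current.Sourceless {n : ℕ} (c : Current n) : Prop := ∀ x ∈ box n, c.source x = 0

/-- The weight `M_{n,β/2}[𝐧] = ∏_{xy} (β/2)^{𝐧_{xy}} / 𝐧_{xy}!`. -/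
noncomputable def Current.weight {n : ℕ} (β : ℝ) (c : Current n) : ℝ :=
  ∏ e, (β / 2) ^ c e / (Nat.factorial (c e) : ℝ)

/-- The expectation `M_{n,β/2}[f | ∂𝐧 = 0]`. -/
noncomputable def currentExpect (n : ℕ) (β : ℝ) (f : Current n → ℝ) : ℝ :=
  (∑' c : {c : Current n // c.Sourceless}, f c.1 * c.1.weight β) /
    ∑' c : {c : Current n // c.Sourceless}, c.1.weight β

/-- `h` is the height function of `c`. A bounded face of `ℤ²` is indexed by its lower-left
vertex; the faces with index outside `[-n, n)²` are part of the outer face of `Λ_n`, where the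
height is zero. If the directed edge `xy` has the face `F_a` on its right and `F_b` on its left,
then `h(F_a) - h(F_b) = 𝐧_{xy} - 𝐧_{yx}`; this is written out for upward and for rightward edges,
and is equivalent to the same condition for the reversed edges. -/
structure IsHeight {n : ℕ} (c : Current n) (h : ℤ × ℤ → ℤ) : Prop where
  outer : ∀ a : ℤ × ℤ, a ∉ Finset.Ico (-(n : ℤ)) n ×ˢ Finset.Ico (-(n : ℤ)) n → h a = 0
  upward : ∀ i j : ℤ, h (i, j) - h (i - 1, j) = c.flow (i, j) (i, j + 1)
  rightward : ∀ i j : ℤ, h (i, j - 1) - h (i, j) = c.flow (i, j) (i + 1, j)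

/-- The height function of a sourceless current: the height at a face is the total net upward
flow through the horizontal path from the outer face to it. By `isHeight_iff` below it is the only
function that satisfies the defining relations `IsHeight`. -/
noncomputable def height {n : ℕ} (c : Current n) (a : ℤ × ℤ) : ℤ :=
  ∑ i ∈ Finset.Icc (-(n : ℤ)) a.1, c.flow (i, a.2) (i, a.2 + 1)

lemma flow_eq_zero {n : ℕ} (c : Current n) {x y : ℤ × ℤ}
    (h : ¬ (x ∈ box n ∧ y ∈ box n ∧ Adj x y)) : c.flow x y = 0 := by
  have hs : Adj y x ↔ Adj x y := by
    unfold Adj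
    rw [← neg_sub x.1, ← neg_sub x.2, neg_sq, neg_sq]
  have h1 : (x, y) ∉ dirEdges n := by
    simp only [dirEdges, Finset.mem_filter, Finset.mem_product]
    tauto
  have h2 : (y, x) ∉ dirEdges n := by
    simp only [dirEdges, Finset.mem_filter, Finset.mem_product]
    tauto
  simp [Current.flow, Current.val, h1, h2]

lemma flow_swap {n : ℕ} (c : Current n) (x y : ℤ × ℤ) : c.flow y x = -c.flow x y := by
  simp [Current.flow]

lemma adj_iff (x y : ℤ × ℤ) : Adj x y ↔
    y = (x.1 + 1, x.2) ∨ y = (x.1 - 1, x.2) ∨ y = (x.1, x.2 + 1) ∨ y = (x.1, x.2 - 1) := by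
  obtain ⟨a, b⟩ := x
  obtain ⟨p, q⟩ := y
  simp only [Adj, Prod.mk.injEq]
  constructor
  · intro h
    have h1 : a - p ≤ 1 := by nlinarith [sq_nonneg (b - q)]
    have h2 : -1 ≤ a - p := by nlinarith [sq_nonneg (b - q)]
    have h3 : b - q ≤ 1 := by nlinarith [sq_nonneg (a - p)]
    have h4 : -1 ≤ b - q := by nlinarith [sq_nonneg (a - p)]
    obtain ⟨s, hs⟩ : ∃ s, s = a - p := ⟨_, rfl⟩
    obtain ⟨t, ht⟩ : ∃ t, t = b - q := ⟨_, rfl⟩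
    rw [← hs, ← ht] at h
    rw [← hs] at h1 h2
    rw [← ht] at h3 h4
    interval_cases s <;> interval_cases t <;> simp at h <;> omega
  · rintro (⟨rfl, rfl⟩ | ⟨rfl, rfl⟩ | ⟨rfl, rfl⟩ | ⟨rfl, rfl⟩) <;> ring

lemma source_eq {n : ℕ} (c : Current n) (i j : ℤ) :
    c.source (i, j) = c.flow (i, j) (i + 1, j) + c.flow (i, j) (i - 1, j)
      + c.flow (i, j) (i, j + 1) + c.flow (i, j) (i, j - 1) := by
  have h1 : c.source (i, j) =
      ∑ y ∈ ({(i + 1, j), (i - 1, j), (i, j + 1), (i, j - 1)} : Finset (ℤ × ℤ)),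
        c.flow (i, j) y := by
    apply Finset.sum_subset_zero_on_sdiff
    · intro y hy
      have := (adj_iff _ _).1 (Finset.mem_filter.1 hy).2
      simpa using this
    · intro y hy
      apply flow_eq_zero
      rintro ⟨-, hb, ha⟩
      exact (Finset.mem_sdiff.1 hy).2 (Finset.mem_filter.2 ⟨hb, ha⟩)
    · intros
      rfl
  rw [h1, Finset.sum_insert, Finset.sum_insert, Finset.sum_insert, Finset.sum_singleton]
  · ring
  all_goals
    simp only [Finset.mem_insert, Finset.mem_singleton, Prod.mk.injEq]
    omega

lemma isHeight_height {n : ℕ} (c : Current n) (hc : c.Sourceless) : IsHeight c (height c) := by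
  have hbox : ∀ i j : ℤ, (i, j) ∈ box n ↔ (-(n : ℤ) ≤ i ∧ i ≤ n) ∧ -(n : ℤ) ≤ j ∧ j ≤ n := by
    intro i j
    simp [box]
  have hup : ∀ i j : ℤ, height c (i, j) - height c (i - 1, j) = c.flow (i, j) (i, j + 1) := by
    intro i j
    by_cases hi : -(n : ℤ) ≤ i
    · have he : Finset.Icc (-(n : ℤ)) i = insert i (Finset.Icc (-(n : ℤ)) (i - 1)) := by
        ext k
        simp only [Finset.mem_Icc, Finset.mem_insert]
        omega
      simp only [height]
      rw [he, Finset.sum_insert (by simp)]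
      ring
    · rw [flow_eq_zero]
      · simp only [height]
        rw [Finset.Icc_eq_empty (by omega), Finset.Icc_eq_empty (by omega)]
        simp
      · rw [hbox]
        omega
  have hleft : ∀ i j : ℤ, i < -(n : ℤ) → height c (i, j) = 0 := by
    intro i j hi
    simp only [height]
    rw [Finset.Icc_eq_empty (by omega)]
    simp
  have hsrc : ∀ i j : ℤ, c.source (i, j) = 0 := by
    intro i j
    by_cases h : (i, j) ∈ box n
    · exact hc _ h
    · exact Finset.sum_eq_zero fun y _ => flow_eq_zero c fun h' => h h'.1
  have hright : ∀ i j : ℤ, height c (i, j - 1) - height c (i, j) = c.flow (i, j) (i + 1, j) := by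
    intro i j
    by_cases hi : i < -(n : ℤ)
    · rw [hleft _ _ hi, hleft _ _ hi, flow_eq_zero]
      · simp
      · rw [hbox]
        omega
    · have hi' : -(n : ℤ) - 1 ≤ i := by omega
      clear hi
      induction i, hi' using Int.leInduction with
      | base =>
        rw [hleft _ _ (by omega), hleft _ _ (by omega), flow_eq_zero]
        · simp
        · rw [hbox]
          omega
      | succ i _ ih =>
        have h1 := hup (i + 1) j
        have h2 := hup (i + 1) (j - 1)
        have h3 := hsrc (i + 1) j
        rw [source_eq] at h3
        rw [add_sub_cancel_right] at h1 h2 h3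
        rw [sub_add_cancel] at h2
        rw [flow_swap c (i, j) (i + 1, j), flow_swap c (i + 1, j - 1) (i + 1, j)] at h3
        linarith
  refine ⟨?_, hup, hright⟩
  rintro ⟨i, j⟩ ha
  simp only [Finset.mem_product, Finset.mem_Ico] at ha
  by_cases hj : -(n : ℤ) ≤ j ∧ j < n
  · by_cases hi : i < -(n : ℤ)
    · exact hleft _ _ hi
    · have hi : (n : ℤ) ≤ i := by omega
      have key : ∀ j : ℤ, -(n : ℤ) - 1 ≤ j → height c (i, j) = 0 := by
        intro j hj
        induction j, hj using Int.leInduction with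
        | base =>
          refine Finset.sum_eq_zero fun k _ => flow_eq_zero c ?_
          rw [hbox]
          omega
        | succ j _ ih =>
          have h1 := hright i (j + 1)
          rw [add_sub_cancel_right, ih, flow_eq_zero] at h1
          · linarith
          · rw [hbox, hbox]
            omega
      exact key j (by omega)
  · refine Finset.sum_eq_zero fun k _ => flow_eq_zero c ?_
    rw [hbox, hbox]
    dsimp only
    omega

/-- For a sourceless current, `height c` is the one and only height function. -/
theorem isHeight_iff {n : ℕ} (c : Current n) (hc : c.Sourceless) (h : ℤ × ℤ → ℤ) :
    IsHeight c h ↔ h = height c := by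
  refine ⟨fun hh => ?_, fun hh => hh ▸ isHeight_height c hc⟩
  have h0 := isHeight_height c hc
  funext ⟨i, j⟩
  have hl : ∀ i : ℤ, i ≤ -(n : ℤ) - 1 → h (i, j) = height c (i, j) := by
    intro i hi
    rw [hh.outer, h0.outer] <;> simp only [Finset.mem_product, Finset.mem_Ico] <;> omega
  by_cases hi : i ≤ -(n : ℤ) - 1
  · exact hl i hi
  · have hi' : -(n : ℤ) - 1 ≤ i := by omega
    clear hi
    induction i, hi' using Int.leInduction with
    | base => exact hl _ le_rfl
    | succ i _ ih =>
      have h1 := hh.upward (i + 1) j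
      have h2 := h0.upward (i + 1) j
      rw [add_sub_cancel_right] at h1 h2
      linarith

/-- The covariance `Cov_{n,β}[a;b] = M_{n,β/2}[h(F_a) h(F_b) | ∂𝐧 = 0]` (the heights have mean
zero by symmetry). -/
noncomputable def heightCov (n : ℕ) (β : ℝ) (a b : ℤ × ℤ) : ℝ :=
  currentExpect n β fun c => (height c a : ℝ) * (height c b : ℝ)

/-- The infinite-volume covariance `Cov_{∞,β}[a;b] = lim_n Cov_{n,β}[a;b] ∈ [0, ∞]`. The limit
exists, so the lower limit is the limit. -/
noncomputable def heightCovInf (β : ℝ) (a b : ℤ × ℤ) : EReal :=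
  liminf (fun n : ℕ => ((heightCov n β a b : ℝ) : EReal)) atTop

/-- The mass of the height function in `[0, ∞]`:
`liminf_k -(1/k) log (Cov_{∞,β}[(0,0);(0,k)] ∧ 1)`, where `log 0 = -∞`. -/
noncomputable def massHeight (β : ℝ) : EReal :=
  liminf (fun k : ℕ => ((-(1 / (k : ℝ)) : ℝ) : EReal) *
    ENNReal.log (min (heightCovInf β (0, 0) (0, (k : ℤ))).toENNReal 1)) atTop

end XYHeight

/-! Suppose the height covariance is below $e^{-Mk}$ for infinitely many distances $k$, with
$M\ge0$. The core claim, `xyTwoPoint_sq_le`, is that the squared two-point function at distance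
$k+2$ is then at most $2e^{-Mk}$ for every $k$, so that the XY mass is at least $M/2$. For finite
mass $m$ and $M>2m$ this is absurd; letting $M$ decrease to $2m$ gives the corollary. Infinite mass
is trivial because covariances are nonnegative.

Duality. Expanding the Boltzmann weight in Fourier modes and integrating out the spins leaves
divergence-free integer flows, that is, gradients of heights, with weight $\prod_e I_{d_e}(\beta)$.
Summing the weight of a sourceless current over the minima of its edge pairs gives the same weight.
Hence a product over finitely many edges of (trigonometric polynomial in the spin difference)/(edge
weight) has the same expectation as a bounded local function of the height gradient
(`gibbs_edgeObs`).

Domination. Log-concavity of $d\mapsto I_d(\beta)$ gives the FKG inequality for heights. Resampling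
heights inside a connected set $P$ of faces turns the height of a face $a\in P$ into increasing
local observables; a sum $X$ of these is strictly increasing in every height near $P$, while its
conditional expectation given the outside of $P$ is that of a multiple of the height of $a$. If
$\Psi$ is bounded, local and vanishes at steep gradients, then $CX\pm\Psi$ is increasing for large
$C$. Two applications of FKG bound $\mathrm{Cov}(\Psi,\Psi')$ by a constant times a covariance of
two heights (`IsCluster.cov_le`). The constant is uniform in volume and distance but depends on the
observables.

Reflection positivity. The observable of interest is the bridge $\sigma_{(l,1)}\bar\sigma_{(-l,1)}$,
a product of spin differences along a horizontal segment; truncating Fourier series turns it into an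
observable of the above kind, supported in a slab. Its truncated correlations at vertical distances
$2r+2$ are log-convex in $r$, so a bound with an arbitrary constant along a subsequence becomes
$e^{-Mk}$ times the correlation at distance $2$ (`norm_corr_slabObs_le`). This prefactor stays
bounded when the truncation is removed.

Conclusion. Cauchy–Schwarz for the reflection in the vertical axis bounds the square of a vertical
two-point function by the four-point function at the corners of a rectangle of width $2l$, which is
also the correlation of two bridges. The latter is at most $2e^{-Mk}$ plus the modulus of the mean
of a bridge, and that mean vanishes as $l\to\infty$ by the McBryan–Spencer bound. Ginibre's
inequality supplies the infinite-volume limit and its translation invariance. -/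

namespace XYHeight

/-! ### Sums over finite products of index sets -/

/-- Families indexed by `ι` of absolutely convergent series can be multiplied out. -/
def PiProdHasSum (𝕜 κ : Type*) [NormedField 𝕜] (ι : Type*) [Fintype ι] : Prop :=
  ∀ f : ι → κ → 𝕜, (∀ i, Summable fun k => ‖f i k‖) →
    (Summable fun d : ι → κ => ‖∏ i, f i (d i)‖) ∧
      HasSum (fun d : ι → κ => ∏ i, f i (d i)) (∏ i, ∑' k, f i k)

/-- Induction on the index type, one point at a time; each step is the product theorem for two
absolutely convergent series. -/
theorem piProdHasSum (𝕜 κ : Type*) [NormedField 𝕜] [CompleteSpace 𝕜] (ι : Type*) [Fintype ι] :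
    PiProdHasSum 𝕜 κ ι := by
  apply Fintype.induction_empty_option (P := fun ι _ => PiProdHasSum 𝕜 κ ι)
  · intro α β _ e ih f hf
    let _ : Fintype α := Fintype.ofEquiv β e.symm
    obtain ⟨h1, h2⟩ := ih (fun a => f (e a)) (fun a => hf (e a))
    have key : ∀ d : β → κ, ∏ a, f (e a) ((Equiv.arrowCongr e.symm (Equiv.refl κ) d) a)
        = ∏ b, f b (d b) := by
      intro d
      rw [← e.prod_comp]
      rfl
    have hp : ∏ a, ∑' k, f (e a) k = ∏ b, ∑' k, f b k := e.prod_comp (fun b => ∑' k, f b k)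
    constructor
    · rw [← (Equiv.arrowCongr e.symm (Equiv.refl κ)).summable_iff] at h1
      refine h1.congr fun d => ?_
      exact congrArg norm (key d)
    · rw [← (Equiv.arrowCongr e.symm (Equiv.refl κ)).hasSum_iff, hp] at h2
      refine HasSum.congr_fun h2 fun d => ?_
      exact (key d).symm
  · intro f _
    simp only [Finset.univ_eq_empty, Finset.prod_empty]
    exact ⟨Summable.of_finite, by simp⟩
  · intro α _ ih f hf
    obtain ⟨h1, h2⟩ := ih (fun a => f (some a)) (fun a => hf (some a))
    obtain ⟨e, he⟩ : ∃ e : κ × (α → κ) ≃ (Option α → κ),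
        ∀ p, e p none = p.1 ∧ ∀ a, e p (some a) = p.2 a :=
      ⟨(Equiv.piOptionEquivProd (β := fun _ => κ)).symm, fun p => ⟨rfl, fun a => rfl⟩⟩
    have hs := (summable_mul_of_summable_norm (hf none) h1)
    have hs' := (hf none).mul_norm h1
    have hh := hs.hasSum
    rw [← tsum_mul_tsum_of_summable_norm (hf none) h1, h2.tsum_eq] at hh
    constructor
    · rw [← e.summable_iff]
      refine hs'.congr fun p => ?_
      simp only [Function.comp_apply, Fintype.prod_option, (he p).1, (he p).2]
    · rw [← e.hasSum_iff, Fintype.prod_option]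
      refine hh.congr_fun fun p => ?_
      simp only [Function.comp_apply, Fintype.prod_option, (he p).1, (he p).2]

section pi
variable {𝕜 κ ι : Type*} [NormedField 𝕜] [CompleteSpace 𝕜] [Fintype ι] {f : ι → κ → 𝕜}

theorem summable_norm_pi_prod (hf : ∀ i, Summable fun k => ‖f i k‖) :
    Summable fun d : ι → κ => ‖∏ i, f i (d i)‖ := (piProdHasSum 𝕜 κ ι f hf).1

theorem hasSum_pi_prod (hf : ∀ i, Summable fun k => ‖f i k‖) :
    HasSum (fun d : ι → κ => ∏ i, f i (d i)) (∏ i, ∑' k, f i k) := (piProdHasSum 𝕜 κ ι f hf).2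

end pi

/-! ### Modified Bessel functions of integer order -/

/-- The modified Bessel function `I_d(β)` of integer order. -/
noncomputable def besselI (β : ℝ) (d : ℤ) : ℝ :=
  ∑' j : ℕ, (β / 2) ^ (2 * j + d.natAbs) / ((j.factorial : ℝ) * ((j + d.natAbs).factorial : ℝ))

/-- A pair of numbers is determined by its difference and its minimum. -/
def diffMinEquiv : ℤ × ℕ ≃ ℕ × ℕ where
  toFun p := (p.2 + p.1.toNat, p.2 + (-p.1).toNat)
  invFun q := ((q.1 : ℤ) - q.2, min q.1 q.2)
  left_inv p := by
    obtain ⟨d, j⟩ := p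
    ext <;> simp
    omega
  right_inv q := by
    obtain ⟨a, b⟩ := q
    ext <;> (simp; omega)

/-- The exponents are $j$ and $j+|d|$ in one order or the other. This is where a pair of opposite
current values becomes a net flow $d$ and a summand of $I_d$. -/
theorem diffMin_weight (x : ℝ) (d : ℤ) (j : ℕ) :
    x ^ (diffMinEquiv (d, j)).1 / ((diffMinEquiv (d, j)).1.factorial : ℝ) *
      (x ^ (diffMinEquiv (d, j)).2 / ((diffMinEquiv (d, j)).2.factorial : ℝ)) =
    x ^ (2 * j + d.natAbs) / ((j.factorial : ℝ) * ((j + d.natAbs).factorial : ℝ)) := by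
  rw [div_mul_div_comm, ← pow_add]
  rcases le_total 0 d with h | h
  · have h1 : d.toNat = d.natAbs := by omega
    have h2 : (-d).toNat = 0 := by omega
    simp only [diffMinEquiv, Equiv.coe_fn_mk, h1, h2, add_zero]
    congr 1
    · congr 1; omega
    · ring
  · have h1 : d.toNat = 0 := by omega
    have h2 : (-d).toNat = d.natAbs := by omega
    simp only [diffMinEquiv, Equiv.coe_fn_mk, h1, h2, add_zero]
    congr 2
    omega

theorem diffMin_summable (x : ℝ) : Summable fun p : ℤ × ℕ =>
    x ^ (2 * p.2 + p.1.natAbs) / ((p.2.factorial : ℝ) * ((p.2 + p.1.natAbs).factorial : ℝ)) := by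
  have h := (Real.summable_pow_div_factorial x)
  have h' := summable_mul_of_summable_norm h.norm h.norm
  rw [← diffMinEquiv.summable_iff] at h'
  exact h'.congr fun p => diffMin_weight x p.1 p.2

theorem besselI_summable (β : ℝ) (d : ℤ) : Summable fun j : ℕ =>
    (β / 2) ^ (2 * j + d.natAbs) / ((j.factorial : ℝ) * ((j + d.natAbs).factorial : ℝ)) :=
  (diffMin_summable (β / 2)).prod_factor d

/-- The generating function of the Bessel functions. -/
theorem besselI_hasSum (β : ℝ) {z : ℂ} (hz : z ≠ 0) :
    HasSum (fun d : ℤ => (besselI β d : ℂ) * z ^ d) (Complex.exp ((β / 2 : ℝ) * (z + z⁻¹))) := by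
  set x : ℝ := β / 2 with hx
  have h1 : HasSum (fun p : ℕ => (x * z) ^ p / (p.factorial : ℂ)) (Complex.exp (x * z)) := by
    rw [Complex.exp_eq_exp_ℂ]
    exact NormedSpace.expSeries_div_hasSum_exp (x * z : ℂ)
  have h2 : HasSum (fun p : ℕ => (x * z⁻¹) ^ p / (p.factorial : ℂ)) (Complex.exp (x * z⁻¹)) := by
    rw [Complex.exp_eq_exp_ℂ]
    exact NormedSpace.expSeries_div_hasSum_exp (x * z⁻¹ : ℂ)
  have s1 : Summable fun p : ℕ => ‖(x * z) ^ p / (p.factorial : ℂ)‖ :=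
    NormedSpace.norm_expSeries_div_summable (x * z : ℂ)
  have s2 : Summable fun p : ℕ => ‖(x * z⁻¹) ^ p / (p.factorial : ℂ)‖ :=
    NormedSpace.norm_expSeries_div_summable (x * z⁻¹ : ℂ)
  have h3 := (summable_mul_of_summable_norm s1 s2).hasSum
  rw [← tsum_mul_tsum_of_summable_norm s1 s2, h1.tsum_eq, h2.tsum_eq] at h3
  -- The double series of $e^{xz}e^{x/z}$ is indexed by difference and minimum of the two exponents;
  -- the fibre over $d$ sums to $I_d z^d$.
  rw [← Complex.exp_add, ← mul_add, ← diffMinEquiv.hasSum_iff] at h3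
  refine HasSum.prod_fiberwise h3 fun d => ?_
  have h4 := ((besselI_summable β d).hasSum.mapL Complex.ofRealCLM).mul_right (z ^ d)
  refine HasSum.congr_fun h4 fun j => ?_
  have h5 := diffMin_weight x d j
  have h6 := congrArg (fun r : ℝ => (r : ℂ)) h5
  simp only [Complex.ofReal_mul, Complex.ofReal_div, Complex.ofReal_pow,
    Complex.ofReal_natCast] at h6
  simp only [Function.comp_apply, Complex.ofRealCLM_apply, Complex.ofReal_mul, Complex.ofReal_div,
    Complex.ofReal_pow, Complex.ofReal_natCast, ← hx]
  rw [← h6, mul_pow, mul_pow]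
  have h7 : z ^ (diffMinEquiv (d, j)).1 * z⁻¹ ^ (diffMinEquiv (d, j)).2 = z ^ d := by
    rw [inv_pow, ← zpow_natCast, ← zpow_natCast, ← zpow_neg, ← zpow_add₀ hz]
    congr 1
    simp only [diffMinEquiv, Equiv.coe_fn_mk]
    push_cast
    omega
  rw [← h7]
  ring

theorem besselI_neg (β : ℝ) (d : ℤ) : besselI β (-d) = besselI β d := by
  simp [besselI]

theorem besselI_pos {β : ℝ} (hβ : 0 < β) (d : ℤ) : 0 < besselI β d := by
  refine (besselI_summable β d).tsum_pos (fun j => by positivity) 0 (by positivity)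

theorem besselI_nonneg {β : ℝ} (hβ : 0 ≤ β) (d : ℤ) : 0 ≤ besselI β d :=
  tsum_nonneg fun j => by positivity

theorem besselI_zpow_summable {β : ℝ} (hβ : 0 ≤ β) {r : ℝ} (hr : 0 < r) :
    Summable fun d : ℤ => besselI β d * r ^ d := by
  have h := (besselI_hasSum β (z := (r : ℂ)) (by exact_mod_cast hr.ne')).summable
  have h2 := h.norm
  refine h2.congr fun d => ?_
  rw [norm_mul, norm_zpow, Complex.norm_real, Complex.norm_real, Real.norm_of_nonneg hr.le,
    Real.norm_of_nonneg (besselI_nonneg hβ d)]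

theorem besselI_summable_int {β : ℝ} (hβ : 0 ≤ β) : Summable fun d : ℤ => besselI β d := by
  simpa using besselI_zpow_summable hβ one_pos

/-- The generating function converges at $z=4$ and $z=1/4$, and $(1+m)^2\le4^m$. Quadratic moments
are needed because covariances of heights are quadratic. -/
theorem besselI_sq_summable {β : ℝ} (hβ : 0 ≤ β) :
    Summable fun d : ℤ => besselI β d * (1 + |(d : ℝ)|) ^ 2 := by
  have h1 := besselI_zpow_summable hβ (r := 4) (by norm_num)
  have h2 := besselI_zpow_summable hβ (r := 4⁻¹) (by norm_num)
  refine Summable.of_nonneg_of_le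
    (fun d => mul_nonneg (besselI_nonneg hβ d) (by positivity)) (fun d => ?_) (h1.add h2)
  rw [← mul_add]
  refine mul_le_mul_of_nonneg_left ?_ (besselI_nonneg hβ d)
  have key : ∀ m : ℕ, (1 + (m : ℝ)) ^ 2 ≤ (4 : ℝ) ^ m := by
    intro m
    have := one_add_mul_le_pow (a := (1 : ℝ)) (by norm_num) m
    calc (1 + (m : ℝ)) ^ 2 ≤ ((1 + 1 : ℝ) ^ m) ^ 2 := by
          gcongr
          linarith
      _ = (4 : ℝ) ^ m := by rw [← pow_mul, mul_comm, pow_mul]; norm_num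
  rcases Int.eq_nat_or_neg d with ⟨m, rfl | rfl⟩
  · have h4 : (0 : ℝ) < (4⁻¹ : ℝ) ^ (m : ℤ) := by positivity
    have := key m
    simp only [Int.cast_natCast, Nat.abs_cast, zpow_natCast] at *
    linarith
  · have h4 : (0 : ℝ) < (4 : ℝ) ^ (-(m : ℤ)) := by positivity
    have := key m
    simp only [Int.cast_neg, Int.cast_natCast, abs_neg, Nat.abs_cast, inv_zpow', neg_neg,
      zpow_natCast] at *
    linarith

/-! ### Logarithmic concavity -/

/-- The Cauchy product of the two power series, with the inner sum evaluated by Vandermonde's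
identity. It reduces log-concavity to a comparison of coefficients. -/
theorem besselI_mul_hasSum (β : ℝ) (k l : ℕ) :
    HasSum (fun m : ℕ => (β / 2) ^ (2 * m + k + l) * ((2 * m + k + l).choose m : ℝ) /
      (((m + k).factorial : ℝ) * ((m + l).factorial : ℝ)))
      (besselI β k * besselI β l) := by
  have hk := (besselI_summable β (k : ℤ))
  have hl := (besselI_summable β (l : ℤ))
  have h1 := tsum_mul_tsum_eq_tsum_sum_antidiagonal_of_summable_norm hk.norm hl.norm
  have h2 := (summable_norm_sum_mul_antidiagonal_of_summable_norm hk.norm hl.norm).of_norm.hasSum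
  rw [← h1] at h2
  refine HasSum.congr_fun h2 fun m => ?_
  have hV := Nat.add_choose_eq (m + l) (m + k) m
  have e1 : m + l + (m + k) = 2 * m + k + l := by ring
  rw [e1] at hV
  rw [hV, Nat.cast_sum, Finset.mul_sum, Finset.sum_div]
  refine Finset.sum_congr rfl fun p hp => ?_
  rw [Finset.HasAntidiagonal.mem_antidiagonal] at hp
  obtain ⟨i, j⟩ := p
  simp only at hp ⊢
  subst hp
  have c1 : ((i + j + l).choose i : ℝ) = ((i + j + l).factorial : ℝ) /
      ((i.factorial : ℝ) * ((j + l).factorial : ℝ)) := by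
    rw [Nat.cast_choose ℝ (by omega)]
    congr 4
    omega
  have c2 : ((i + j + k).choose j : ℝ) = ((i + j + k).factorial : ℝ) /
      ((j.factorial : ℝ) * ((i + k).factorial : ℝ)) := by
    rw [Nat.cast_choose ℝ (by omega)]
    congr 4
    omega
  rw [Nat.cast_mul, c1, c2]
  simp only [Int.natAbs_natCast]
  have f1 := Nat.cast_ne_zero (R := ℝ).2 (i + j + l).factorial_ne_zero
  have f2 := Nat.cast_ne_zero (R := ℝ).2 (i + j + k).factorial_ne_zero
  have f3 := Nat.cast_ne_zero (R := ℝ).2 i.factorial_ne_zero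
  have f4 := Nat.cast_ne_zero (R := ℝ).2 j.factorial_ne_zero
  have f5 := Nat.cast_ne_zero (R := ℝ).2 (i + k).factorial_ne_zero
  have f6 := Nat.cast_ne_zero (R := ℝ).2 (j + l).factorial_ne_zero
  have e2 : 2 * (i + j) + k + l = (2 * i + k) + (2 * j + l) := by ring
  rw [e2, pow_add]
  field_simp

theorem besselI_one_le_zero {β : ℝ} (hβ : 0 ≤ β) :
    besselI β 1 * besselI β 1 ≤ besselI β 0 * besselI β 0 := by
  have h0 := besselI_mul_hasSum β 0 0
  have h1 := besselI_mul_hasSum β 1 1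
  simp only [Nat.cast_zero, Nat.cast_one, add_zero] at h0 h1
  -- Dropping the constant term of $I_0^2$ aligns the powers of $\beta$; the central binomial
  -- coefficient then dominates termwise.
  have h0' := (hasSum_nat_add_iff' 1).2 h0
  refine (hasSum_le (fun m => ?_) h1 h0').trans ?_
  · rw [show 2 * (m + 1) = 2 * m + 1 + 1 by ring]
    have hc : (2 * m + 1 + 1).choose m ≤ (2 * m + 1 + 1).choose (m + 1) := by
      have := Nat.choose_le_centralBinom m (m + 1)
      rw [Nat.centralBinom] at this
      exact this
    have hc' : ((2 * m + 1 + 1).choose m : ℝ) ≤ ((2 * m + 1 + 1).choose (m + 1) : ℝ) := by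
      exact_mod_cast hc
    gcongr
  · simp

/-- Powers and binomial coefficients of the two product series agree, so only
$((m+k+1)!)^2\le(m+k)!\,(m+k+2)!$ is needed. -/
theorem besselI_nat_logConcave {β : ℝ} (hβ : 0 ≤ β) (k : ℕ) :
    besselI β k * besselI β ((k + 2 : ℕ) : ℤ) ≤
      besselI β ((k + 1 : ℕ) : ℤ) * besselI β ((k + 1 : ℕ) : ℤ) := by
  refine hasSum_le (fun m => ?_) (besselI_mul_hasSum β k (k + 2))
    (besselI_mul_hasSum β (k + 1) (k + 1))
  have e : 2 * m + (k + 1) + (k + 1) = 2 * m + k + (k + 2) := by ring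
  rw [e]
  have hf : (m + (k + 1)).factorial * (m + (k + 1)).factorial ≤
      (m + k).factorial * (m + (k + 2)).factorial := by
    rw [show m + (k + 1) = (m + k) + 1 by ring, show m + (k + 2) = (m + k) + 1 + 1 by ring,
      Nat.factorial_succ (m + k + 1), Nat.factorial_succ (m + k)]
    have : (m + k + 1) ≤ (m + k + 1 + 1) := by omega
    calc (m + k + 1) * (m + k).factorial * ((m + k + 1) * (m + k).factorial)
        = (m + k).factorial * ((m + k + 1) * ((m + k + 1) * (m + k).factorial)) := by ring
      _ ≤ (m + k).factorial * ((m + k + 1 + 1) * ((m + k + 1) * (m + k).factorial)) := by gcongr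
  have hf' : ((m + (k + 1)).factorial : ℝ) * ((m + (k + 1)).factorial : ℝ) ≤
      ((m + k).factorial : ℝ) * ((m + (k + 2)).factorial : ℝ) := by exact_mod_cast hf
  gcongr

theorem besselI_logConcave {β : ℝ} (hβ : 0 ≤ β) (d : ℤ) :
    besselI β (d - 1) * besselI β (d + 1) ≤ besselI β d * besselI β d := by
  have pos : ∀ k : ℕ, besselI β ((k + 1 : ℕ) - 1 : ℤ) * besselI β ((k + 1 : ℕ) + 1 : ℤ) ≤
      besselI β ((k + 1 : ℕ) : ℤ) * besselI β ((k + 1 : ℕ) : ℤ) := by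
    intro k
    have := besselI_nat_logConcave hβ k
    have e1 : (((k + 1 : ℕ) : ℤ) - 1) = (k : ℤ) := by push_cast; ring
    have e2 : (((k + 1 : ℕ) : ℤ) + 1) = ((k + 2 : ℕ) : ℤ) := by push_cast; ring
    rw [e1, e2]
    exact this
  rcases Int.eq_nat_or_neg d with ⟨m, rfl | rfl⟩
  · cases m with
    | zero =>
      have := besselI_one_le_zero hβ
      simpa [besselI_neg β 1] using this
    | succ k => exact pos k
  · cases m with
    | zero =>
      have := besselI_one_le_zero hβ
      simpa [besselI_neg β 1] using this
    | succ k =>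
      have := pos k
      rw [besselI_neg, show -((k + 1 : ℕ) : ℤ) - 1 = -(((k + 1 : ℕ) : ℤ) + 1) by ring,
        show -((k + 1 : ℕ) : ℤ) + 1 = -(((k + 1 : ℕ) : ℤ) - 1) by ring, besselI_neg, besselI_neg,
        mul_comm]
      exact this

theorem besselI_ratio_antitone {β : ℝ} (hβ : 0 < β) :
    Antitone fun d : ℤ => besselI β (d + 1) / besselI β d := by
  refine antitone_int_of_succ_le fun d => ?_
  rw [div_le_div_iff₀ (besselI_pos hβ _) (besselI_pos hβ _)]
  have := besselI_logConcave hβ.le (d + 1)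
  rw [add_sub_cancel_right] at this
  linarith

/-- Among pairs of integers with a fixed sum, the product is larger for the more central pair; the
antitone ratios are multiplied up over $s$ steps. -/
theorem besselI_spread {β : ℝ} (hβ : 0 < β) {u v : ℤ} (h : u ≤ v) (s : ℕ) :
    besselI β u * besselI β (v + s) ≤ besselI β (u + s) * besselI β v := by
  induction s with
  | zero => simp
  | succ s ih =>
    have h1 := besselI_ratio_antitone hβ (show u + s ≤ v + s by omega)
    simp only at h1
    have pu := besselI_pos hβ (u + s)
    have pv := besselI_pos hβ (v + s)
    rw [div_le_div_iff₀ pv pu] at h1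
    push_cast
    rw [← add_assoc, ← add_assoc]
    have h2 := mul_le_mul_of_nonneg_left h1 (besselI_pos hβ u).le
    have h3 := mul_le_mul_of_nonneg_left ih (besselI_pos hβ (u + s + 1)).le
    refine le_of_mul_le_mul_right ?_ pu
    linarith

/-- The pair interaction of the heights satisfies the lattice condition. -/
theorem besselI_lattice {β : ℝ} (hβ : 0 < β) (a b a' b' : ℤ) :
    besselI β (a - b) * besselI β (a' - b') ≤
      besselI β (min a a' - min b b') * besselI β (max a a' - max b b') := by
  rcases le_total a a' with h1 | h1 <;> rcases le_total b b' with h2 | h2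
  · simp [h1, h2]
  · simp only [min_eq_left h1, max_eq_right h1, min_eq_right h2, max_eq_left h2]
    have := besselI_spread hβ (show a - b ≤ a' - b by omega) (b - b').toNat
    rw [show a - b + ((b - b').toNat : ℤ) = a - b' by omega,
      show a' - b + ((b - b').toNat : ℤ) = a' - b' by omega] at this
    exact this
  · simp only [min_eq_right h1, max_eq_left h1, min_eq_left h2, max_eq_right h2]
    have := besselI_spread hβ (show a' - b' ≤ a - b' by omega) (b' - b).toNat
    rw [show a' - b' + ((b' - b).toNat : ℤ) = a' - b by omega,
      show a - b' + ((b' - b).toNat : ℤ) = a - b by omega] at this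
    linarith
  · simp only [min_eq_right h1, max_eq_left h1, min_eq_right h2, max_eq_left h2]
    exact (mul_comm _ _).le

/-- Otherwise the ratios would all be equal, and by $I_{-d}=I_d$ equal to one, so the sequence would
be constant and not summable. This one strict instance makes resampling strictly sensitive to the
neighbouring heights. -/
theorem besselI_ratio_not_constant {β : ℝ} (hβ : 0 < β) :
    ∃ d : ℤ, besselI β (d + 2) * besselI β d < besselI β (d + 1) * besselI β (d + 1) := by
  by_contra! hcon
  have heq : ∀ d : ℤ, besselI β (d + 2) / besselI β (d + 1) = besselI β (d + 1) / besselI β d := by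
    intro d
    rw [div_eq_div_iff (besselI_pos hβ _).ne' (besselI_pos hβ _).ne']
    refine le_antisymm ?_ (hcon d)
    have := besselI_logConcave hβ.le (d + 1)
    rw [add_sub_cancel_right, show d + 1 + 1 = d + 2 by ring] at this
    linarith
  -- Equality of ratios at $d=-1$ reads $I_1/I_0=I_0/I_{-1}=I_0/I_1$.
  have h1 : besselI β 1 / besselI β 0 = 1 := by
    have := heq (-1)
    norm_num [besselI_neg β 1] at this
    have p0 := besselI_pos hβ 0
    have p1 := besselI_pos hβ 1
    rw [div_eq_div_iff p0.ne' p1.ne'] at this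
    rw [div_eq_one_iff_eq p0.ne']
    nlinarith
  have h2 : ∀ n : ℕ, besselI β ((n : ℤ) + 1) / besselI β n = 1 := by
    intro n
    induction n with
    | zero => simpa using h1
    | succ n ih =>
      rw [← ih, ← heq n]
      push_cast
      ring_nf
  have h3 : ∀ n : ℕ, besselI β n = besselI β 0 := by
    intro n
    induction n with
    | zero => simp
    | succ n ih =>
      have := h2 n
      rw [div_eq_one_iff_eq (besselI_pos hβ _).ne', ih] at this
      push_cast
      exact this
  have h4 := ((besselI_summable_int hβ.le).comp_injective Nat.cast_injective).tendsto_atTop_zero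
  have h5 : (fun d : ℤ => besselI β d) ∘ (Nat.cast : ℕ → ℤ) = fun _ => besselI β 0 :=
    funext h3
  rw [h5, tendsto_const_nhds_iff] at h4
  exact (besselI_pos hβ 0).ne' h4

end XYHeight

/-! ### Correlation inequalities for sums and the measure on height configurations -/

namespace XYHeight

open scoped FinsetFamily

/-! ### Correlation inequalities for sums -/

/-- The four functions theorem with the functions $\mu f,\ \mu g,\ \mu,\ \mu fg$, after making $f$
and $g$ nonnegative. The covariance inequality is unaffected by adding constants to them. -/
theorem fkg_finset {α : Type*} [DistribLattice α] [DecidableEq α] {μ f g : α → ℝ} (hμ : 0 ≤ μ)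
    (hlat : ∀ a b, μ a * μ b ≤ μ (a ⊓ b) * μ (a ⊔ b)) (hf : Monotone f) (hg : Monotone g)
    (s : Finset α) {o : α} (ho : ∀ a ∈ s, o ≤ a) (hinf : s ⊼ s ⊆ s) (hsup : s ⊻ s ⊆ s) :
    (∑ a ∈ s, μ a * f a) * ∑ a ∈ s, μ a * g a ≤ (∑ a ∈ s, μ a) * ∑ a ∈ s, μ a * (f a * g a) := by
  -- The positive part is nonnegative on the whole lattice, as required for four functions, and
  -- inactive on `s` because `o` is a lower bound there.
  set f' : α → ℝ := fun a => max 0 (f a - f o) with hf'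
  set g' : α → ℝ := fun a => max 0 (g a - g o) with hg'
  have f0 : ∀ a, 0 ≤ f' a := fun a => le_max_left _ _
  have g0 : ∀ a, 0 ≤ g' a := fun a => le_max_left _ _
  have fm : Monotone f' := fun a b h => max_le_max le_rfl (sub_le_sub_right (hf h) _)
  have gm : Monotone g' := fun a b h => max_le_max le_rfl (sub_le_sub_right (hg h) _)
  have key := four_functions_theorem (fun a => μ a * f' a) (fun a => μ a * g' a) μ
    (fun a => μ a * (f' a * g' a)) (fun a => mul_nonneg (hμ a) (f0 a))
    (fun a => mul_nonneg (hμ a) (g0 a)) hμ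
    (fun a => mul_nonneg (hμ a) (mul_nonneg (f0 a) (g0 a)))
    (fun a b => by
      calc μ a * f' a * (μ b * g' b) = (μ a * μ b) * (f' a * g' b) := by ring
        _ ≤ (μ (a ⊓ b) * μ (a ⊔ b)) * (f' (a ⊔ b) * g' (a ⊔ b)) :=
          mul_le_mul (hlat a b) (mul_le_mul (fm le_sup_left) (gm le_sup_right) (g0 _) (f0 _))
            (mul_nonneg (f0 _) (g0 _)) (mul_nonneg (hμ _) (hμ _))
        _ = μ (a ⊓ b) * (μ (a ⊔ b) * (f' (a ⊔ b) * g' (a ⊔ b))) := by ring) s s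
  have key2 : (∑ a ∈ s, μ a * f' a) * ∑ a ∈ s, μ a * g' a ≤
      (∑ a ∈ s, μ a) * ∑ a ∈ s, μ a * (f' a * g' a) := by
    refine key.trans (mul_le_mul ?_ ?_ ?_ ?_)
    · exact Finset.sum_le_sum_of_subset_of_nonneg hinf fun a _ _ => hμ a
    · exact Finset.sum_le_sum_of_subset_of_nonneg hsup
        fun a _ _ => mul_nonneg (hμ a) (mul_nonneg (f0 a) (g0 a))
    · exact Finset.sum_nonneg fun a _ => mul_nonneg (hμ a) (mul_nonneg (f0 a) (g0 a))
    · exact Finset.sum_nonneg fun a _ => hμ a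
  have ef : ∀ a ∈ s, f' a = f a - f o := fun a ha => max_eq_right (sub_nonneg.2 (hf (ho a ha)))
  have eg : ∀ a ∈ s, g' a = g a - g o := fun a ha => max_eq_right (sub_nonneg.2 (hg (ho a ha)))
  have e1 : ∑ a ∈ s, μ a * f' a = ∑ a ∈ s, μ a * f a - f o * ∑ a ∈ s, μ a := by
    rw [Finset.mul_sum, ← Finset.sum_sub_distrib]
    exact Finset.sum_congr rfl fun a ha => by rw [ef a ha]; ring
  have e2 : ∑ a ∈ s, μ a * g' a = ∑ a ∈ s, μ a * g a - g o * ∑ a ∈ s, μ a := by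
    rw [Finset.mul_sum, ← Finset.sum_sub_distrib]
    exact Finset.sum_congr rfl fun a ha => by rw [eg a ha]; ring
  have e3 : ∑ a ∈ s, μ a * (f' a * g' a) = ∑ a ∈ s, μ a * (f a * g a)
      - g o * ∑ a ∈ s, μ a * f a - f o * ∑ a ∈ s, μ a * g a + f o * g o * ∑ a ∈ s, μ a := by
    simp only [Finset.mul_sum]
    rw [← Finset.sum_sub_distrib, ← Finset.sum_sub_distrib, ← Finset.sum_add_distrib]
    exact Finset.sum_congr rfl fun a ha => by rw [ef a ha, eg a ha]; ring
  rw [e1, e2, e3] at key2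
  nlinarith [key2]

/-- The FKG inequality for summable weights on `ι → ℤ`. -/
theorem fkg_tsum {ι : Type*} [Finite ι] {μ f g : (ι → ℤ) → ℝ} (hμ : 0 ≤ μ)
    (hlat : ∀ a b, μ a * μ b ≤ μ (a ⊓ b) * μ (a ⊔ b)) (hf : Monotone f) (hg : Monotone g)
    (s0 : Summable μ) (sf : Summable fun a => μ a * f a) (sg : Summable fun a => μ a * g a)
    (sfg : Summable fun a => μ a * (f a * g a)) :
    (∑' a, μ a * f a) * ∑' a, μ a * g a ≤ (∑' a, μ a) * ∑' a, μ a * (f a * g a) := by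
  classical
  have := Fintype.ofFinite ι
  -- Cubes are sublattices with a least element and exhaust $\mathbb Z^\iota$, so the finite
  -- inequality passes to the limit.
  let S : ℕ → Finset (ι → ℤ) := fun R => Finset.Icc (fun _ => -(R : ℤ)) (fun _ => (R : ℤ))
  have hS : Tendsto S atTop atTop := by
    refine tendsto_atTop_finset_of_monotone (fun R R' h => ?_) fun x => ?_
    · refine Finset.Icc_subset_Icc (fun _ => ?_) (fun _ => ?_)
      · simpa using h
      · simpa using h
    · refine ⟨∑ i, (x i).natAbs, Finset.mem_Icc.2 ⟨fun i => ?_, fun i => ?_⟩⟩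
      all_goals
        have h1 : (x i).natAbs ≤ ∑ i, (x i).natAbs :=
          Finset.single_le_sum (f := fun i => (x i).natAbs) (fun _ _ => Nat.zero_le _)
            (Finset.mem_univ i)
        dsimp only
        omega
  refine le_of_tendsto_of_tendsto' ((sf.hasSum.comp hS).mul (sg.hasSum.comp hS))
    ((s0.hasSum.comp hS).mul (sfg.hasSum.comp hS)) fun R => ?_
  refine fkg_finset hμ hlat hf hg (S R) (o := fun _ => -(R : ℤ))
    (fun a ha => (Finset.mem_Icc.1 ha).1) ?_ ?_
  · refine Finset.infs_subset_iff.2 ?_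
    intro a ha b hb
    rw [Finset.mem_Icc] at *
    exact ⟨le_inf ha.1 hb.1, inf_le_left.trans ha.2⟩
  · refine Finset.sups_subset_iff.2 ?_
    intro a ha b hb
    rw [Finset.mem_Icc] at *
    exact ⟨ha.1.trans le_sup_left, sup_le ha.2 hb.2⟩

section MonotoneLikelihoodRatio

variable {p q φ : ℤ → ℝ}

/-- The difference of products, written as a double sum and symmetrised under exchange of the two
indices. Every summand is nonnegative when $\varphi$ is increasing and $q/p$ has a monotone
likelihood ratio. -/
theorem mlr_hasSum (sp : Summable p) (sq : Summable q)
    (spφ : Summable fun m => p m * φ m) (sqφ : Summable fun m => q m * φ m) :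
    HasSum (fun x : ℤ × ℤ => (φ x.2 - φ x.1) * (p x.1 * q x.2 - p x.2 * q x.1))
      (2 * ((∑' m, p m) * (∑' m, q m * φ m) - (∑' m, p m * φ m) * ∑' m, q m)) := by
  have h1 := (summable_mul_of_summable_norm sp.norm sqφ.norm).hasSum
  rw [← tsum_mul_tsum_of_summable_norm sp.norm sqφ.norm] at h1
  have h2 := (summable_mul_of_summable_norm spφ.norm sq.norm).hasSum
  rw [← tsum_mul_tsum_of_summable_norm spφ.norm sq.norm] at h2
  have h3 := h1.sub h2
  have h4 := h3
  rw [← (Equiv.prodComm ℤ ℤ).hasSum_iff] at h4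
  have h5 := h3.add h4
  rw [← two_mul] at h5
  refine h5.congr_fun fun x => ?_
  simp only [Function.comp_apply, Equiv.prodComm_apply, Prod.fst_swap, Prod.snd_swap]
  ring

theorem mlr_nonneg (hφ : Monotone φ)
    (hpq : ∀ m m', m ≤ m' → p m' * q m ≤ p m * q m') (x : ℤ × ℤ) :
    0 ≤ (φ x.2 - φ x.1) * (p x.1 * q x.2 - p x.2 * q x.1) := by
  rcases le_total x.1 x.2 with h | h
  · exact mul_nonneg (sub_nonneg.2 (hφ h)) (sub_nonneg.2 (hpq _ _ h))
  · refine mul_nonneg_of_nonpos_of_nonpos (sub_nonpos.2 (hφ h)) (sub_nonpos.2 ?_)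
    linarith [hpq _ _ h]

theorem mlr_le (sp : Summable p) (sq : Summable q) (spφ : Summable fun m => p m * φ m)
    (sqφ : Summable fun m => q m * φ m) (hφ : Monotone φ)
    (hpq : ∀ m m', m ≤ m' → p m' * q m ≤ p m * q m') :
    (∑' m, p m * φ m) * ∑' m, q m ≤ (∑' m, p m) * (∑' m, q m * φ m) := by
  have := (mlr_hasSum sp sq spφ sqφ).nonneg (mlr_nonneg hφ hpq)
  linarith

/-- A single strict inequality between consecutive likelihood ratios makes one summand of the
symmetrised double sum positive. -/
theorem mlr_lt (sp : Summable p) (sq : Summable q) (spφ : Summable fun m => p m * φ m)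
    (sqφ : Summable fun m => q m * φ m) (hφ : StrictMono φ)
    (hpq : ∀ m m', m ≤ m' → p m' * q m ≤ p m * q m')
    (hs : ∃ m, p (m + 1) * q m < p m * q (m + 1)) :
    (∑' m, p m * φ m) * ∑' m, q m < (∑' m, p m) * (∑' m, q m * φ m) := by
  obtain ⟨m, hm⟩ := hs
  have h := mlr_hasSum sp sq spφ sqφ
  have h2 := h.summable.tsum_pos (mlr_nonneg hφ.monotone hpq) (m, m + 1)
    (mul_pos (sub_pos.2 (hφ (by simp))) (sub_pos.2 hm))
  rw [h.tsum_eq] at h2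
  linarith

end MonotoneLikelihoodRatio

/-! ### Height configurations -/

/-- The faces inside the box. -/
noncomputable def faceBox (n : ℕ) : Finset (ℤ × ℤ) :=
  Finset.Ico (-(n : ℤ)) n ×ˢ Finset.Ico (-(n : ℤ)) n

/-- Edges of `ℤ²` pointing right (`false`) or up (`true`) are indexed by their lower-left end.
This is the upper or right end of the edge. -/
def tgt (e : (ℤ × ℤ) × Bool) : ℤ × ℤ := if e.2 then (e.1.1, e.1.2 + 1) else (e.1.1 + 1, e.1.2)

/-- The face on the other side of the edge `e` than the face `e.1`. -/
def otherFace (e : (ℤ × ℤ) × Bool) : ℤ × ℤ :=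
  if e.2 then (e.1.1 - 1, e.1.2) else (e.1.1, e.1.2 - 1)

/-- The rightward and upward edges of the box. -/
noncomputable def posEdges (n : ℕ) : Finset ((ℤ × ℤ) × Bool) :=
  (box n ×ˢ Finset.univ).filter fun e => tgt e ∈ box n

/-- The flow through the edge `e` of the current with height function `h`. -/
def gradH (h : ℤ × ℤ → ℤ) (e : (ℤ × ℤ) × Bool) : ℤ :=
  if e.2 then h e.1 - h (otherFace e) else h (otherFace e) - h e.1

/-- The neighbours of a face. -/
def nbrs (f : ℤ × ℤ) : Finset (ℤ × ℤ) :=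
  {(f.1 + 1, f.2), (f.1 - 1, f.2), (f.1, f.2 + 1), (f.1, f.2 - 1)}

/-- Extension of heights by zero. -/
noncomputable def extH {n : ℕ} (k : faceBox n → ℤ) : ℤ × ℤ → ℤ :=
  fun a => if h : a ∈ faceBox n then k ⟨a, h⟩ else 0

/-- The weight of a height configuration. -/
noncomputable def hWeight (β : ℝ) (n : ℕ) (h : ℤ × ℤ → ℤ) : ℝ :=
  ∏ e ∈ posEdges n, besselI β (gradH h e)

/-- The unnormalised expectation over the height configurations in the box. -/
noncomputable def hSum (β : ℝ) (n : ℕ) (f : (ℤ × ℤ → ℤ) → ℝ) : ℝ :=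
  ∑' k : faceBox n → ℤ, hWeight β n (extH k) * f (extH k)

/-- At most linear growth in finitely many heights. -/
def LinBdd (X : (ℤ × ℤ → ℤ) → ℝ) : Prop :=
  ∃ (A B : ℝ) (Q : Finset (ℤ × ℤ)), 0 ≤ A ∧ 0 ≤ B ∧ ∀ h, |X h| ≤ A + B * ∑ q ∈ Q, |(h q : ℝ)|

theorem mem_faceBox {n : ℕ} {f : ℤ × ℤ} :
    f ∈ faceBox n ↔ (-(n : ℤ) ≤ f.1 ∧ f.1 < n) ∧ -(n : ℤ) ≤ f.2 ∧ f.2 < n := by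
  simp [faceBox]

theorem mem_box {n : ℕ} {f : ℤ × ℤ} :
    f ∈ box n ↔ (-(n : ℤ) ≤ f.1 ∧ f.1 ≤ n) ∧ -(n : ℤ) ≤ f.2 ∧ f.2 ≤ n := by
  simp [box]

theorem mem_posEdges {n : ℕ} {e : (ℤ × ℤ) × Bool} :
    e ∈ posEdges n ↔ e.1 ∈ box n ∧ tgt e ∈ box n := by
  simp [posEdges]

theorem extH_apply_of_notMem {n : ℕ} (k : faceBox n → ℤ) {f : ℤ × ℤ} (hf : f ∉ faceBox n) :
    extH k f = 0 := by
  simp [extH, hf]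

theorem extH_mono {n : ℕ} : Monotone (extH (n := n)) := by
  intro k k' h f
  unfold extH
  split
  · exact h _
  · exact le_rfl

theorem extH_inf {n : ℕ} (k k' : faceBox n → ℤ) : extH (k ⊓ k') = extH k ⊓ extH k' := by
  funext f
  simp only [Pi.inf_apply, extH]
  split <;> simp

theorem extH_sup {n : ℕ} (k k' : faceBox n → ℤ) : extH (k ⊔ k') = extH k ⊔ extH k' := by
  funext f
  simp only [Pi.sup_apply, extH]
  split <;> simp

theorem extH_injective {n : ℕ} : Function.Injective (extH (n := n)) := by
  intro k k' h
  funext ⟨f, hf⟩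
  have := congrFun h f
  simpa [extH, hf] using this

theorem extH_update {n : ℕ} (k : faceBox n → ℤ) (f : faceBox n) (m : ℤ) :
    extH (Function.update k f m) = Function.update (extH k) f m := by
  funext g
  by_cases hg : g ∈ faceBox n
  · by_cases hgf : g = f
    · subst hgf
      simp [extH]
    · have : (⟨g, hg⟩ : faceBox n) ≠ f := fun h => hgf (by rw [← h])
      simp [extH, hg, hgf, this]
  · have hgf : g ≠ f := fun h => hg (h ▸ f.2)
    simp [extH, hg, hgf]

theorem besselI_gradH (β : ℝ) (h : ℤ × ℤ → ℤ) (e : (ℤ × ℤ) × Bool) :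
    besselI β (gradH h e) = besselI β (h e.1 - h (otherFace e)) := by
  unfold gradH
  split
  · rfl
  · rw [← besselI_neg, neg_sub]

theorem hWeight_eq (β : ℝ) (n : ℕ) (h : ℤ × ℤ → ℤ) :
    hWeight β n h = ∏ e ∈ posEdges n, besselI β (h e.1 - h (otherFace e)) :=
  Finset.prod_congr rfl fun e _ => besselI_gradH β h e

theorem hWeight_pos {β : ℝ} (hβ : 0 < β) (n : ℕ) (h : ℤ × ℤ → ℤ) : 0 < hWeight β n h :=
  Finset.prod_pos fun _ _ => besselI_pos hβ _

theorem hWeight_lattice {β : ℝ} (hβ : 0 < β) (n : ℕ) (h h' : ℤ × ℤ → ℤ) :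
    hWeight β n h * hWeight β n h' ≤ hWeight β n (h ⊓ h') * hWeight β n (h ⊔ h') := by
  simp only [hWeight_eq, ← Finset.prod_mul_distrib]
  exact Finset.prod_le_prod
    (fun e _ => (mul_pos (besselI_pos hβ _) (besselI_pos hβ _)).le)
    fun e _ => besselI_lattice hβ _ _ _ _

theorem hWeight_neg (β : ℝ) (n : ℕ) (h : ℤ × ℤ → ℤ) : hWeight β n (-h) = hWeight β n h := by
  simp only [hWeight_eq, Pi.neg_apply]
  exact Finset.prod_congr rfl fun e _ => by rw [← besselI_neg]; ring_nf

/-- A height is the sum of the flows through the edges on its left. -/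
theorem height_eq_sum {n : ℕ} (k : faceBox n → ℤ) (i j : ℤ) :
    extH k (i, j) = ∑ i' ∈ Finset.Icc (-(n : ℤ)) i, gradH (extH k) ((i', j), true) := by
  by_cases hi : -(n : ℤ) - 1 ≤ i
  · induction i, hi using Int.leInduction with
    | base =>
      rw [extH_apply_of_notMem, Finset.Icc_eq_empty (by omega), Finset.sum_empty]
      rw [mem_faceBox]
      simp
    | succ i hi ih =>
      have he : Finset.Icc (-(n : ℤ)) (i + 1) = insert (i + 1) (Finset.Icc (-(n : ℤ)) i) := by
        ext k
        simp only [Finset.mem_Icc, Finset.mem_insert]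
        omega
      rw [he, Finset.sum_insert (by simp), ← ih]
      simp [gradH, otherFace]
  · rw [extH_apply_of_notMem, Finset.Icc_eq_empty (by omega), Finset.sum_empty]
    rw [mem_faceBox]
    simp only
    omega

theorem abs_extH_le {n : ℕ} (k : faceBox n → ℤ) (f : ℤ × ℤ) :
    |(extH k f : ℝ)| ≤ ∑ e ∈ posEdges n, |(gradH (extH k) e : ℝ)| := by
  by_cases hf : f ∈ faceBox n
  · obtain ⟨i, j⟩ := f
    rw [height_eq_sum, Int.cast_sum]
    refine (Finset.abs_sum_le_sum_abs _ _).trans ?_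
    have hinj : Set.InjOn (fun i' : ℤ => (((i', j), true) : (ℤ × ℤ) × Bool))
        (Finset.Icc (-(n : ℤ)) i) := fun a _ b _ h => by simpa using h
    rw [← Finset.sum_image (f := fun e => |(gradH (extH k) e : ℝ)|) hinj]
    refine Finset.sum_le_sum_of_subset_of_nonneg ?_ fun _ _ _ => abs_nonneg _
    intro e he
    obtain ⟨i', hi', rfl⟩ := Finset.mem_image.1 he
    rw [mem_faceBox] at hf
    rw [Finset.mem_Icc] at hi'
    rw [mem_posEdges, mem_box, mem_box]
    simp only [tgt, if_true] at *
    omega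
  · rw [extH_apply_of_notMem k hf]
    simpa using Finset.sum_nonneg fun e _ => abs_nonneg _

theorem one_add_sum_le_prod_one_add {ι : Type*} (s : Finset ι) {f : ι → ℝ} (hf : ∀ i, 0 ≤ f i) :
    1 + ∑ i ∈ s, f i ≤ ∏ i ∈ s, (1 + f i) := by
  classical
  induction s using Finset.induction_on with
  | empty => simp
  | insert a s ha ih =>
    rw [Finset.sum_insert ha, Finset.prod_insert ha]
    have h1 := hf a
    have h2 : 0 ≤ ∑ i ∈ s, f i := Finset.sum_nonneg fun i _ => hf i
    nlinarith

/-- Heights embed injectively into arbitrary edge functions through their gradient, and over all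
edge functions the sum factorises into convergent single-edge series. -/
theorem summable_hWeight_sq {β : ℝ} (hβ : 0 ≤ β) (n : ℕ) :
    Summable fun k : faceBox n → ℤ => hWeight β n (extH k) *
      (1 + ∑ e ∈ posEdges n, |(gradH (extH k) e : ℝ)|) ^ 2 := by
  have h1 : Summable fun d : posEdges n → ℤ =>
      ‖∏ e, besselI β (d e) * (1 + |(d e : ℝ)|) ^ 2‖ :=
    summable_norm_pi_prod (f := fun _ d => besselI β d * (1 + |(d : ℝ)|) ^ 2)
      fun _ => (besselI_sq_summable hβ).norm
  have hinj : Function.Injective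
      (fun (k : faceBox n → ℤ) (e : posEdges n) => gradH (extH k) e) := by
    intro k k' h
    apply extH_injective
    funext f
    by_cases hf : f ∈ faceBox n
    · obtain ⟨i, j⟩ := f
      rw [height_eq_sum, height_eq_sum]
      refine Finset.sum_congr rfl fun i' hi' => ?_
      refine congrFun h ⟨((i', j), true), ?_⟩
      rw [mem_faceBox] at hf
      rw [Finset.mem_Icc] at hi'
      rw [mem_posEdges, mem_box, mem_box]
      simp only [tgt, if_true] at *
      omega
    · rw [extH_apply_of_notMem k hf, extH_apply_of_notMem k' hf]
  refine Summable.of_nonneg_of_le (fun k => mul_nonneg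
    (Finset.prod_nonneg fun e _ => besselI_nonneg hβ _) (sq_nonneg _)) (fun k => ?_)
    (h1.comp_injective hinj)
  simp only [Function.comp_apply, Finset.prod_mul_distrib]
  rw [Finset.prod_coe_sort (posEdges n) (fun e => besselI β (gradH (extH k) e)),
    Finset.prod_coe_sort (posEdges n) (fun e => (1 + |(gradH (extH k) e : ℝ)|) ^ 2),
    Finset.prod_pow]
  refine le_trans ?_ (le_abs_self _)
  refine mul_le_mul_of_nonneg_left ?_ (Finset.prod_nonneg fun e _ => besselI_nonneg hβ _)
  exact pow_le_pow_left₀ (by positivity) (one_add_sum_le_prod_one_add _ fun e => abs_nonneg _) 2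

theorem LinBdd.bound {X : (ℤ × ℤ → ℤ) → ℝ} (hX : LinBdd X) (n : ℕ) :
    ∃ C : ℝ, 0 ≤ C ∧ ∀ k : faceBox n → ℤ,
      |X (extH k)| ≤ C * (1 + ∑ e ∈ posEdges n, |(gradH (extH k) e : ℝ)|) := by
  obtain ⟨A, B, Q, hA, hB, hX⟩ := hX
  refine ⟨A + B * Q.card, by positivity, fun k => (hX _).trans ?_⟩
  have h1 : ∑ q ∈ Q, |(extH k q : ℝ)| ≤
      Q.card * ∑ e ∈ posEdges n, |(gradH (extH k) e : ℝ)| := by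
    rw [← nsmul_eq_mul]
    exact Finset.sum_le_card_nsmul _ _ _ fun q _ => abs_extH_le k q
  have h2 : 0 ≤ ∑ e ∈ posEdges n, |(gradH (extH k) e : ℝ)| :=
    Finset.sum_nonneg fun _ _ => abs_nonneg _
  have h3 : 0 ≤ B * (Q.card : ℝ) := by positivity
  have h4 := mul_le_mul_of_nonneg_left h1 hB
  nlinarith

/-- A height is controlled by the sum of absolute gradients, so the product of two functions of
linear growth is controlled by the square in `summable_hWeight_sq`. -/
theorem LinBdd.summable {β : ℝ} (hβ : 0 ≤ β) {X Y : (ℤ × ℤ → ℤ) → ℝ} (hX : LinBdd X)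
    (hY : LinBdd Y) (n : ℕ) :
    Summable fun k : faceBox n → ℤ => hWeight β n (extH k) * (X (extH k) * Y (extH k)) := by
  obtain ⟨C, hC, hC'⟩ := hX.bound n
  obtain ⟨D, hD, hD'⟩ := hY.bound n
  refine Summable.of_norm_bounded ((summable_hWeight_sq hβ n).mul_left (C * D)) fun k => ?_
  have hw : 0 ≤ hWeight β n (extH k) := Finset.prod_nonneg fun e _ => besselI_nonneg hβ _
  rw [norm_mul, Real.norm_of_nonneg hw, norm_mul, Real.norm_eq_abs, Real.norm_eq_abs]
  have := mul_le_mul (hC' k) (hD' k) (abs_nonneg _) (mul_nonneg hC (by positivity))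
  calc _ ≤ hWeight β n (extH k) * _ := mul_le_mul_of_nonneg_left this hw
    _ = _ := by ring

theorem LinBdd.const (c : ℝ) : LinBdd fun _ => c :=
  ⟨|c|, 0, ∅, abs_nonneg _, le_rfl, fun _ => by simp⟩

theorem LinBdd.of_bounded {X : (ℤ × ℤ → ℤ) → ℝ} {B : ℝ} (h : ∀ k, |X k| ≤ B) : LinBdd X :=
  ⟨B, 0, ∅, (abs_nonneg _).trans (h 0), le_rfl, fun k => by simpa using h k⟩

theorem LinBdd.eval (a : ℤ × ℤ) : LinBdd fun h => (h a : ℝ) :=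
  ⟨0, 1, {a}, le_rfl, zero_le_one, fun _ => by simp⟩

theorem LinBdd.add {X Y : (ℤ × ℤ → ℤ) → ℝ} (hX : LinBdd X) (hY : LinBdd Y) :
    LinBdd fun h => X h + Y h := by
  obtain ⟨A, B, Q, hA, hB, hX⟩ := hX
  obtain ⟨A', B', Q', hA', hB', hY⟩ := hY
  refine ⟨A + A', B + B', Q ∪ Q', by positivity, by positivity, fun h => ?_⟩
  have h1 : ∑ q ∈ Q, |(h q : ℝ)| ≤ ∑ q ∈ Q ∪ Q', |(h q : ℝ)| :=
    Finset.sum_le_sum_of_subset_of_nonneg Finset.subset_union_left fun _ _ _ => abs_nonneg _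
  have h2 : ∑ q ∈ Q', |(h q : ℝ)| ≤ ∑ q ∈ Q ∪ Q', |(h q : ℝ)| :=
    Finset.sum_le_sum_of_subset_of_nonneg Finset.subset_union_right fun _ _ _ => abs_nonneg _
  have h3 := mul_le_mul_of_nonneg_left h1 hB
  have h4 := mul_le_mul_of_nonneg_left h2 hB'
  have h5 := abs_add_le (X h) (Y h)
  have h6 := hX h
  have h7 := hY h
  rw [add_mul]
  linarith

theorem LinBdd.const_mul {X : (ℤ × ℤ → ℤ) → ℝ} (hX : LinBdd X) (c : ℝ) :
    LinBdd fun h => c * X h := by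
  obtain ⟨A, B, Q, hA, hB, hX⟩ := hX
  refine ⟨|c| * A, |c| * B, Q, by positivity, by positivity, fun h => ?_⟩
  rw [abs_mul, mul_assoc, ← mul_add]
  exact mul_le_mul_of_nonneg_left (hX h) (abs_nonneg _)

theorem LinBdd.summable_one {β : ℝ} (hβ : 0 ≤ β) {X : (ℤ × ℤ → ℤ) → ℝ} (hX : LinBdd X) (n : ℕ) :
    Summable fun k : faceBox n → ℤ => hWeight β n (extH k) * X (extH k) := by
  simpa using hX.summable hβ (LinBdd.const 1) n

theorem summable_hWeight {β : ℝ} (hβ : 0 ≤ β) (n : ℕ) :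
    Summable fun k : faceBox n → ℤ => hWeight β n (extH k) := by
  simpa using (LinBdd.const 1).summable_one hβ n

/-- The FKG inequality for the heights. -/
theorem hSum_fkg {β : ℝ} (hβ : 0 < β) (n : ℕ) {X Y : (ℤ × ℤ → ℤ) → ℝ} (hX : Monotone X)
    (hY : Monotone Y) (bX : LinBdd X) (bY : LinBdd Y) :
    hSum β n X * hSum β n Y ≤ hSum β n (fun _ => 1) * hSum β n (fun h => X h * Y h) := by
  have := fkg_tsum (μ := fun k : faceBox n → ℤ => hWeight β n (extH k))
    (f := fun k => X (extH k)) (g := fun k => Y (extH k))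
    (fun k => (hWeight_pos hβ n _).le) (fun k k' => by
      rw [extH_inf, extH_sup]
      exact hWeight_lattice hβ n _ _)
    (hX.comp extH_mono) (hY.comp extH_mono) (summable_hWeight hβ.le n) (bX.summable_one hβ.le n)
    (bY.summable_one hβ.le n) (bX.summable hβ.le bY n)
  simpa only [hSum, mul_one] using this

theorem hSum_one_pos {β : ℝ} (hβ : 0 < β) (n : ℕ) : 0 < hSum β n fun _ => 1 := by
  simp only [hSum, mul_one]
  exact (summable_hWeight hβ.le n).tsum_pos (fun k => (hWeight_pos hβ n _).le) 0
    (hWeight_pos hβ n _)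

theorem hSum_odd {β : ℝ} (n : ℕ) {X : (ℤ × ℤ → ℤ) → ℝ} (hX : ∀ h, X (-h) = -X h) :
    hSum β n X = 0 := by
  have h1 : hSum β n X = -hSum β n X := by
    unfold hSum
    rw [← tsum_neg, ← (Equiv.neg (faceBox n → ℤ)).tsum_eq]
    refine tsum_congr fun k => ?_
    have : extH (-k) = -extH k := by
      funext f
      simp only [extH, Pi.neg_apply]
      split <;> simp
    simp only [Equiv.neg_apply, this, hX, hWeight_neg]
    ring
  linarith

end XYHeight

/-! ### Resampling a single height: monotonicity, strictness and invariance of the measure -/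

namespace XYHeight

/-! ### Resampling the height of one face -/

/-- The conditional weight of the height `m` of the face `f`. -/
noncomputable def siteWeight (β : ℝ) (f : ℤ × ℤ) (h : ℤ × ℤ → ℤ) (m : ℤ) : ℝ :=
  ∏ q ∈ nbrs f, besselI β (m - h q)

/-- The conditional expectation of `X` given the heights of all faces but `f`. -/
noncomputable def siteAvg (β : ℝ) (f : ℤ × ℤ) (X : (ℤ × ℤ → ℤ) → ℝ) (h : ℤ × ℤ → ℤ) : ℝ :=
  (∑' m, siteWeight β f h m * X (Function.update h f m)) / ∑' m, siteWeight β f h m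

/-- Increasing functions of finitely many heights that respect constant shifts. -/
structure IsTame (Q : Finset (ℤ × ℤ)) (X : (ℤ × ℤ → ℤ) → ℝ) : Prop where
  mono : Monotone X
  shift : ∀ (h : ℤ × ℤ → ℤ) (c : ℤ), X (fun f => h f + c) = X h + c
  loc : ∀ h h' : ℤ × ℤ → ℤ, (∀ f ∈ Q, h f = h' f) → X h = X h'

/-- Locality allows the heights outside `Q` to be replaced by $c$; the resulting configuration lies
below the constant $c$, where the shift property gives the value. With `IsTame.ge` this yields
linear growth. -/
theorem IsTame.le {Q : Finset (ℤ × ℤ)} {X : (ℤ × ℤ → ℤ) → ℝ} (hX : IsTame Q X)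
    (h : ℤ × ℤ → ℤ) (c : ℤ) (hc : ∀ f ∈ Q, h f ≤ c) : X h ≤ X 0 + c := by
  classical
  have h1 : X h = X (fun f => if f ∈ Q then h f else c) :=
    hX.loc _ _ fun f hf => by simp [hf]
  have h2 : X 0 + c = X fun _ => 0 + c := (hX.shift 0 c).symm
  rw [h1, h2]
  refine hX.mono fun f => ?_
  dsimp only
  split
  · simpa using hc f ‹_›
  · simp

theorem IsTame.ge {Q : Finset (ℤ × ℤ)} {X : (ℤ × ℤ → ℤ) → ℝ} (hX : IsTame Q X)
    (h : ℤ × ℤ → ℤ) (c : ℤ) (hc : ∀ f ∈ Q, c ≤ h f) : X 0 + c ≤ X h := by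
  classical
  have h1 : X h = X (fun f => if f ∈ Q then h f else c) :=
    hX.loc _ _ fun f hf => by simp [hf]
  have h2 : X 0 + c = X fun _ => 0 + c := (hX.shift 0 c).symm
  rw [h1, h2]
  refine hX.mono fun f => ?_
  dsimp only
  split
  · simpa using hc f ‹_›
  · simp

theorem IsTame.abs_le {Q : Finset (ℤ × ℤ)} {X : (ℤ × ℤ → ℤ) → ℝ} (hX : IsTame Q X)
    (h : ℤ × ℤ → ℤ) : |X h| ≤ |X 0| + ∑ q ∈ Q, |(h q : ℝ)| := by
  have hc : ∀ f ∈ Q, |h f| ≤ ∑ q ∈ Q, |h q| := fun f hf =>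
    Finset.single_le_sum (f := fun q => |h q|) (fun _ _ => abs_nonneg _) hf
  have h1 := hX.le h (∑ q ∈ Q, |h q|) fun f hf => (le_abs_self _).trans (hc f hf)
  have h2 := hX.ge h (-∑ q ∈ Q, |h q|) fun f hf => by
    have := hc f hf
    have := neg_abs_le (h f)
    omega
  push_cast at h1 h2
  rw [_root_.abs_le]
  have h3 := le_abs_self (X 0)
  have h4 := neg_abs_le (X 0)
  constructor <;> linarith

theorem isTame_eval {Q : Finset (ℤ × ℤ)} {a : ℤ × ℤ} (ha : a ∈ Q) :
    IsTame Q fun h => (h a : ℝ) where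
  mono h h' hh := Int.cast_le.2 (hh a)
  shift h c := by push_cast; rfl
  loc h h' hh := by simp [hh a ha]

theorem mem_nbrs {f g : ℤ × ℤ} : g ∈ nbrs f ↔ g = (f.1 + 1, f.2) ∨ g = (f.1 - 1, f.2) ∨
    g = (f.1, f.2 + 1) ∨ g = (f.1, f.2 - 1) := by
  simp [nbrs]

theorem self_notMem_nbrs (f : ℤ × ℤ) : f ∉ nbrs f := by
  simp only [mem_nbrs, Prod.ext_iff]
  omega

theorem prod_nbrs {M : Type*} [CommMonoid M] (f : ℤ × ℤ) (F : ℤ × ℤ → M) :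
    ∏ q ∈ nbrs f, F q =
      F (f.1 + 1, f.2) * (F (f.1 - 1, f.2) * (F (f.1, f.2 + 1) * F (f.1, f.2 - 1))) := by
  rw [nbrs, Finset.prod_insert, Finset.prod_insert, Finset.prod_insert, Finset.prod_singleton]
  all_goals
    simp only [Finset.mem_insert, Finset.mem_singleton, Prod.mk.injEq]
    omega

theorem siteWeight_pos {β : ℝ} (hβ : 0 < β) (f : ℤ × ℤ) (h : ℤ × ℤ → ℤ) (m : ℤ) :
    0 < siteWeight β f h m := Finset.prod_pos fun _ _ => besselI_pos hβ _

theorem siteWeight_congr (β : ℝ) {f : ℤ × ℤ} {h h' : ℤ × ℤ → ℤ}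
    (hh : ∀ q ∈ nbrs f, h q = h' q) (m : ℤ) : siteWeight β f h m = siteWeight β f h' m :=
  Finset.prod_congr rfl fun q hq => by rw [hh q hq]

theorem siteWeight_update (β : ℝ) (f : ℤ × ℤ) (h : ℤ × ℤ → ℤ) (l m : ℤ) :
    siteWeight β f (Function.update h f l) m = siteWeight β f h m :=
  siteWeight_congr β (fun _ hq => Function.update_of_ne
    (ne_of_mem_of_not_mem hq (self_notMem_nbrs f)) _ _) m

theorem besselI_le_tsum {β : ℝ} (hβ : 0 ≤ β) (d : ℤ) : besselI β d ≤ ∑' d, besselI β d :=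
  (besselI_summable_int hβ).le_tsum d fun _ _ => besselI_nonneg hβ _

/-- The Bessel factor of one neighbour provides the decay; the other three are bounded by the total
Bessel sum. -/
theorem siteWeight_summable {β : ℝ} (hβ : 0 < β) (f : ℤ × ℤ) (h : ℤ × ℤ → ℤ) :
    Summable fun m => siteWeight β f h m * (1 + |(m : ℝ)|) := by
  set c : ℤ := h (f.1 + 1, f.2)
  set S := ∑' d, besselI β d
  have hS : ∀ d, besselI β d ≤ S := besselI_le_tsum hβ.le
  have hS0 : 0 ≤ S := (besselI_nonneg hβ.le 0).trans (hS 0)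
  have h1 : Summable fun m : ℤ => besselI β (m - c) * (1 + |((m - c : ℤ) : ℝ)|) ^ 2 :=
    (besselI_sq_summable hβ.le).comp_injective (sub_left_injective (b := c))
  refine Summable.of_nonneg_of_le (fun m => mul_nonneg (siteWeight_pos hβ f h m).le
    (by positivity)) (fun m => ?_) (h1.mul_left (S * (S * S) * (1 + |(c : ℝ)|)))
  rw [siteWeight, prod_nbrs]
  have h2 : 1 + |(m : ℝ)| ≤ (1 + |(c : ℝ)|) * (1 + |((m - c : ℤ) : ℝ)|) ^ 2 := by
    push_cast
    have h3 : |(m : ℝ)| ≤ |(m : ℝ) - c| + |(c : ℝ)| := by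
      have := abs_add_le ((m : ℝ) - c) c
      simpa using this
    have h4 := abs_nonneg ((m : ℝ) - c)
    have h5 := abs_nonneg (c : ℝ)
    nlinarith [mul_nonneg h4 h5, mul_nonneg (mul_nonneg h4 h4) h5]
  have p := fun d => besselI_nonneg hβ.le d
  have h6 : besselI β (m - h (f.1 - 1, f.2)) *
      (besselI β (m - h (f.1, f.2 + 1)) * besselI β (m - h (f.1, f.2 - 1))) ≤ S * (S * S) :=
    mul_le_mul (hS _) (mul_le_mul (hS _) (hS _) (p _) hS0) (mul_nonneg (p _) (p _)) hS0
  calc _ ≤ (besselI β (m - c) * (S * (S * S))) *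
        ((1 + |(c : ℝ)|) * (1 + |((m - c : ℤ) : ℝ)|) ^ 2) :=
        mul_le_mul (mul_le_mul_of_nonneg_left h6 (p _)) h2 (by positivity)
          (mul_nonneg (p _) (by positivity))
    _ = _ := by ring

theorem siteWeight_summable_one {β : ℝ} (hβ : 0 < β) (f : ℤ × ℤ) (h : ℤ × ℤ → ℤ) :
    Summable fun m => siteWeight β f h m := by
  refine Summable.of_nonneg_of_le (fun m => (siteWeight_pos hβ f h m).le) (fun m => ?_)
    (siteWeight_summable hβ f h)
  have := (siteWeight_pos hβ f h m).le
  nlinarith [mul_nonneg this (abs_nonneg (m : ℝ))]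

theorem siteNorm_pos {β : ℝ} (hβ : 0 < β) (f : ℤ × ℤ) (h : ℤ × ℤ → ℤ) :
    0 < ∑' m, siteWeight β f h m :=
  (siteWeight_summable_one hβ f h).tsum_pos (fun m => (siteWeight_pos hβ f h m).le) 0
    (siteWeight_pos hβ f h 0)

theorem IsTame.summable_site {β : ℝ} (hβ : 0 < β) {Q : Finset (ℤ × ℤ)} {X : (ℤ × ℤ → ℤ) → ℝ}
    (hX : IsTame Q X) (f : ℤ × ℤ) (h h' : ℤ × ℤ → ℤ) :
    Summable fun m => siteWeight β f h m * X (Function.update h' f m) := by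
  set C := |X 0| + ∑ q ∈ Q, (1 + |(h' q : ℝ)|) with hC
  have hC0 : 0 ≤ C := by positivity
  refine Summable.of_norm_bounded ((siteWeight_summable hβ f h).mul_left C) fun m => ?_
  rw [norm_mul, Real.norm_of_nonneg (siteWeight_pos hβ f h m).le, Real.norm_eq_abs]
  have h1 : |X (Function.update h' f m)| ≤ C * (1 + |(m : ℝ)|) := by
    refine (hX.abs_le _).trans ?_
    have h2 : ∑ q ∈ Q, |((Function.update h' f m) q : ℝ)| ≤
        ∑ q ∈ Q, (1 + |(h' q : ℝ)|) * (1 + |(m : ℝ)|) := by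
      refine Finset.sum_le_sum fun q _ => ?_
      have h3 := abs_nonneg (h' q : ℝ)
      have h4 := abs_nonneg (m : ℝ)
      by_cases hq : q = f
      · subst hq
        rw [Function.update_self]
        nlinarith [mul_nonneg h3 h4]
      · rw [Function.update_of_ne hq]
        nlinarith [mul_nonneg h3 h4]
    rw [← Finset.sum_mul] at h2
    have h5 := mul_nonneg (abs_nonneg (X 0)) (abs_nonneg (m : ℝ))
    rw [hC, add_mul, mul_add, mul_one]
    linarith
  calc _ ≤ siteWeight β f h m * (C * (1 + |(m : ℝ)|)) :=
        mul_le_mul_of_nonneg_left h1 (siteWeight_pos hβ f h m).le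
    _ = _ := by ring

/-- The lattice condition, neighbour by neighbour: raising the surrounding heights raises the
conditional law of the height at `f` in the likelihood ratio order. -/
theorem siteWeight_mlr {β : ℝ} (hβ : 0 < β) (f : ℤ × ℤ) {h h' : ℤ × ℤ → ℤ} (hh : h ≤ h')
    (m m' : ℤ) (hm : m ≤ m') :
    siteWeight β f h m' * siteWeight β f h' m ≤ siteWeight β f h m * siteWeight β f h' m' := by
  simp only [siteWeight, ← Finset.prod_mul_distrib]
  refine Finset.prod_le_prod (fun q _ => (mul_pos (besselI_pos hβ _) (besselI_pos hβ _)).le)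
    fun q _ => ?_
  have h1 := besselI_lattice hβ m' (h q) m (h' q)
  rw [min_eq_right hm, max_eq_left hm, min_eq_left (hh q), max_eq_right (hh q)] at h1
  exact h1

theorem siteAvg_le {β : ℝ} (hβ : 0 < β) {Q : Finset (ℤ × ℤ)} {X : (ℤ × ℤ → ℤ) → ℝ}
    (hX : IsTame Q X) (f : ℤ × ℤ) {h h' : ℤ × ℤ → ℤ} (hh : h ≤ h') :
    siteAvg β f X h ≤ siteAvg β f X h' := by
  unfold siteAvg
  rw [div_le_div_iff₀ (siteNorm_pos hβ f h) (siteNorm_pos hβ f h')]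
  -- First the law of the resampled height is raised while the other heights in the argument of `X`
  -- stay at `h`.
  have h1 := mlr_le (siteWeight_summable_one hβ f h) (siteWeight_summable_one hβ f h')
    (hX.summable_site hβ f h h) (hX.summable_site hβ f h' h)
    (fun m m' hm => hX.mono (update_le_update_iff.2 ⟨hm, fun _ _ => le_rfl⟩))
    (siteWeight_mlr hβ f hh)
  refine h1.trans ?_
  rw [mul_comm]
  refine mul_le_mul_of_nonneg_right ?_ (siteNorm_pos hβ f h).le
  -- Then the other heights are raised under the fixed law, by monotonicity of `X`.
  refine (hX.summable_site hβ f h' h).tsum_le_tsum (fun m => ?_) (hX.summable_site hβ f h' h')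
  refine mul_le_mul_of_nonneg_left (hX.mono ?_) (siteWeight_pos hβ f h' m).le
  exact update_le_update_iff.2 ⟨le_rfl, fun g _ => hh g⟩

theorem siteWeight_shift (β : ℝ) (f : ℤ × ℤ) (h : ℤ × ℤ → ℤ) (c m : ℤ) :
    siteWeight β f (fun g => h g + c) (m + c) = siteWeight β f h m :=
  Finset.prod_congr rfl fun q _ => by rw [add_sub_add_right_eq_sub]

/-- The conditional law depends only on the neighbours of `f` and moves along with constant shifts,
so resampling can be iterated as long as these neighbours lie in `Q`. -/
theorem IsTame.siteAvg {β : ℝ} (hβ : 0 < β) {Q : Finset (ℤ × ℤ)} {X : (ℤ × ℤ → ℤ) → ℝ}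
    (hX : IsTame Q X) {f : ℤ × ℤ} (hf : nbrs f ⊆ Q) : IsTame Q (siteAvg β f X) where
  mono h h' hh := siteAvg_le hβ hX f hh
  shift h c := by
    unfold XYHeight.siteAvg
    rw [← (Equiv.addRight c).tsum_eq fun m => siteWeight β f (fun g => h g + c) m,
      ← (Equiv.addRight c).tsum_eq fun m => siteWeight β f (fun g => h g + c) m * _]
    simp only [Equiv.coe_addRight, siteWeight_shift]
    have h1 : ∀ m, X (Function.update (fun g => h g + c) f (m + c)) =
        X (Function.update h f m) + c := by
      intro m
      rw [← hX.shift]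
      congr 1
      funext g
      by_cases hg : g = f
      · subst hg; simp
      · simp [hg]
    simp only [h1, mul_add]
    rw [(hX.summable_site hβ f h h).tsum_add ((siteWeight_summable_one hβ f h).mul_right _),
      tsum_mul_right, add_div, mul_div_cancel_left₀ _ (siteNorm_pos hβ f h).ne']
  loc h h' hh := by
    have h1 := siteWeight_congr β (f := f) fun q hq => hh q (hf hq)
    have h2 : ∀ m, X (Function.update h f m) = X (Function.update h' f m) := fun m =>
      hX.loc _ _ fun g hg => by
        by_cases hgf : g = f
        · subst hgf; simp
        · simp [hgf, hh g hg]
    simp only [XYHeight.siteAvg, h1, h2]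

/-- `X` depends strictly on the height of the face `g`. -/
def StrictAt (g : ℤ × ℤ) (X : (ℤ × ℤ → ℤ) → ℝ) : Prop :=
  ∀ h : ℤ × ℤ → ℤ, X h < X (Function.update h g (h g + 1))

/-- Raising a neighbour strictly raises the law of the height at `f`, on which `X` depends strictly.
Resampling thus passes strict dependence on to the neighbours. -/
theorem StrictAt.siteAvg {β : ℝ} (hβ : 0 < β) {Q : Finset (ℤ × ℤ)} {X : (ℤ × ℤ → ℤ) → ℝ}
    (hX : IsTame Q X) {f g : ℤ × ℤ} (hs : StrictAt f X) (hg : g ∈ nbrs f) :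
    StrictAt g (siteAvg β f X) := by
  intro h
  set h' := Function.update h g (h g + 1) with hh'
  have hh : h ≤ h' := by
    rw [hh', le_update_iff]
    exact ⟨by omega, fun _ _ => le_rfl⟩
  unfold XYHeight.siteAvg
  rw [div_lt_div_iff₀ (siteNorm_pos hβ f h) (siteNorm_pos hβ f h')]
  have hstrict : StrictMono fun m => X (Function.update h f m) := by
    refine strictMono_int_of_lt_succ fun m => ?_
    have := hs (Function.update h f m)
    simpa using this
  have hmlr : ∃ m, siteWeight β f h (m + 1) * siteWeight β f h' m <
      siteWeight β f h m * siteWeight β f h' (m + 1) := by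
    obtain ⟨d, hd⟩ := besselI_ratio_not_constant hβ
    -- This height makes the factor of the neighbour `g` exactly the strict log-concavity inequality
    -- at `d`; the other factors compare weakly and are positive.
    refine ⟨d + 1 + h g, ?_⟩
    simp only [siteWeight, ← Finset.prod_mul_distrib]
    refine Finset.prod_lt_prod (fun q _ => mul_pos (besselI_pos hβ _) (besselI_pos hβ _))
      (fun q _ => ?_) ⟨g, hg, ?_⟩
    · have h1 := besselI_lattice hβ (d + 1 + h g + 1) (h q) (d + 1 + h g) (h' q)
      rw [min_eq_right (by omega), max_eq_left (by omega), min_eq_left (hh q),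
        max_eq_right (hh q)] at h1
      exact h1
    · rw [hh', Function.update_self]
      rw [show d + 1 + h g + 1 - h g = d + 2 by ring, show d + 1 + h g - (h g + 1) = d by ring,
        show d + 1 + h g - h g = d + 1 by ring, show d + 1 + h g + 1 - (h g + 1) = d + 1 by ring]
      exact hd
  have h1 := mlr_lt (siteWeight_summable_one hβ f h) (siteWeight_summable_one hβ f h')
    (hX.summable_site hβ f h h) (hX.summable_site hβ f h' h) hstrict
    (siteWeight_mlr hβ f hh) hmlr
  refine h1.trans_le ?_
  rw [mul_comm]
  refine mul_le_mul_of_nonneg_right ?_ (siteNorm_pos hβ f h).le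
  refine (hX.summable_site hβ f h' h).tsum_le_tsum (fun m => ?_) (hX.summable_site hβ f h' h')
  refine mul_le_mul_of_nonneg_left (hX.mono ?_) (siteWeight_pos hβ f h' m).le
  exact update_le_update_iff.2 ⟨le_rfl, fun g _ => hh g⟩

/-! ### Resampling preserves expectations -/

/-- Detailed balance: only the four edges around `f`, all of them edges of the box, see its height,
and their weights multiply to `siteWeight`. -/
theorem hWeight_update_mul {β : ℝ} {n : ℕ} {f : ℤ × ℤ} (hf : f ∈ faceBox n) (h : ℤ × ℤ → ℤ)
    (m : ℤ) : hWeight β n (Function.update h f m) * siteWeight β f h (h f) =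
      hWeight β n h * siteWeight β f h m := by
  classical
  obtain ⟨i, j⟩ := f
  set T : Finset ((ℤ × ℤ) × Bool) :=
    {((i + 1, j), true), ((i, j), true), ((i, j + 1), false), ((i, j), false)} with hT
  have hTs : T ⊆ posEdges n := by
    intro e he
    simp only [hT, Finset.mem_insert, Finset.mem_singleton] at he
    rw [mem_faceBox] at hf
    rw [mem_posEdges, mem_box, mem_box]
    rcases he with rfl | rfl | rfl | rfl <;> simp only [tgt] at * <;> simp <;> omega
  have hTp : ∀ l : ℤ, ∏ e ∈ T, besselI β (gradH (Function.update h (i, j) l) e) =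
      siteWeight β (i, j) h l := by
    intro l
    rw [hT, Finset.prod_insert (by simp), Finset.prod_insert (by simp),
      Finset.prod_insert (by simp), Finset.prod_singleton, siteWeight, prod_nbrs]
    have n1 : ((i + 1, j) : ℤ × ℤ) ≠ (i, j) := by simp
    have n2 : ((i - 1, j) : ℤ × ℤ) ≠ (i, j) := by simp
    have n3 : ((i, j + 1) : ℤ × ℤ) ≠ (i, j) := by simp
    have n4 : ((i, j - 1) : ℤ × ℤ) ≠ (i, j) := by simp
    have a1 : gradH (Function.update h (i, j) l) ((i + 1, j), true) = -(l - h (i + 1, j)) := by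
      simp [gradH, otherFace]
    have a2 : gradH (Function.update h (i, j) l) ((i, j), true) = l - h (i - 1, j) := by
      simp [gradH, otherFace]
    have a3 : gradH (Function.update h (i, j) l) ((i, j + 1), false) = l - h (i, j + 1) := by
      simp [gradH, otherFace]
    have a4 : gradH (Function.update h (i, j) l) ((i, j), false) = -(l - h (i, j - 1)) := by
      simp [gradH, otherFace]
    rw [a1, a2, a3, a4, besselI_neg, besselI_neg]
  have hrest : ∏ e ∈ posEdges n \ T, besselI β (gradH (Function.update h (i, j) m) e) =
      ∏ e ∈ posEdges n \ T, besselI β (gradH h e) := by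
    refine Finset.prod_congr rfl fun e he => ?_
    rw [Finset.mem_sdiff] at he
    have he2 := he.2
    obtain ⟨⟨p, q⟩, b⟩ := e
    simp only [hT, Finset.mem_insert, Finset.mem_singleton, Prod.mk.injEq] at he2
    cases b
    · have n1 : ((p, q) : ℤ × ℤ) ≠ (i, j) := by rw [Ne, Prod.mk.injEq]; simp at he2; tauto
      have n2 : ((p, q - 1) : ℤ × ℤ) ≠ (i, j) := by
        rw [Ne, Prod.mk.injEq]; simp at he2; omega
      simp [gradH, otherFace, Function.update_of_ne n1, Function.update_of_ne n2]
    · have n1 : ((p, q) : ℤ × ℤ) ≠ (i, j) := by rw [Ne, Prod.mk.injEq]; simp at he2; tauto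
      have n2 : ((p - 1, q) : ℤ × ℤ) ≠ (i, j) := by
        rw [Ne, Prod.mk.injEq]; simp at he2; omega
      simp [gradH, otherFace, Function.update_of_ne n1, Function.update_of_ne n2]
  have h1 := hTp m
  have h2 := hTp (h (i, j))
  rw [Function.update_eq_self] at h2
  unfold hWeight
  rw [← Finset.prod_sdiff hTs, ← Finset.prod_sdiff hTs (f := fun e => besselI β (gradH h e)),
    hrest, h1, h2]
  ring

/-- The configuration obtained by exchanging the height of `f` with a spare height. -/
def swapSite {n : ℕ} (f : faceBox n) : (faceBox n → ℤ) × ℤ ≃ (faceBox n → ℤ) × ℤ where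
  toFun x := (Function.update x.1 f x.2, x.1 f)
  invFun x := (Function.update x.1 f x.2, x.1 f)
  left_inv x := by simp
  right_inv x := by simp

/-- Reversibility of resampling: for a configuration paired with an independent conditional sample
of the height at `f`, exchanging the old and new heights preserves the joint weight. The factor `H`,
which does not see this height, is untouched. -/
theorem hSum_siteAvg {β : ℝ} (hβ : 0 < β) {n : ℕ} {f : ℤ × ℤ} (hf : f ∈ faceBox n)
    {X H : (ℤ × ℤ → ℤ) → ℝ} (bX : LinBdd X) (bH : LinBdd H)
    (hH : ∀ h m, H (Function.update h f m) = H h) :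
    hSum β n (fun h => siteAvg β f X h * H h) = hSum β n fun h => X h * H h := by
  set W := fun k : faceBox n → ℤ => hWeight β n (extH k)
  set N := fun h : ℤ × ℤ → ℤ => ∑' m, siteWeight β f h m
  have hN : ∀ h, 0 < N h := siteNorm_pos hβ f
  set b : (faceBox n → ℤ) × ℤ → ℝ := fun x =>
    W x.1 * (X (extH x.1) * H (extH x.1)) * (siteWeight β f (extH x.1) x.2 / N (extH x.1)) with hb
  have hsum1 : ∀ h, HasSum (fun m => siteWeight β f h m / N h) 1 := fun h => by
    have := (siteWeight_summable_one hβ f h).hasSum.div_const (N h)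
    rwa [div_self (hN h).ne'] at this
  have hbs : Summable b := by
    rw [← summable_abs_iff]
    rw [summable_prod_of_nonneg (fun x => abs_nonneg _)]
    have habs : ∀ k m, |b (k, m)| = |W k * (X (extH k) * H (extH k))| *
        (siteWeight β f (extH k) m / N (extH k)) := fun k m => by
      rw [hb, abs_mul, abs_of_pos (div_pos (siteWeight_pos hβ f _ m) (hN _))]
    simp only [habs]
    refine ⟨fun k => (hsum1 _).summable.mul_left _, ?_⟩
    simp only [tsum_mul_left, (hsum1 _).tsum_eq, mul_one]
    exact (bX.summable hβ.le bH n).abs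
  have hb1 : ∑' x, b x = hSum β n fun h => X h * H h := by
    rw [hbs.tsum_prod]
    refine tsum_congr fun k => ?_
    simp only [hb, tsum_mul_left, (hsum1 _).tsum_eq, mul_one]
    rfl
  -- After the exchange, the old height is evaluated in `X` as the new sample; summing over it
  -- produces `siteAvg`.
  have has := (swapSite ⟨f, hf⟩).summable_iff.2 hbs
  have ha1 := (swapSite ⟨f, hf⟩).tsum_eq b
  rw [← hb1, ← ha1]
  change _ = ∑' x, (b ∘ swapSite ⟨f, hf⟩) x
  rw [has.tsum_prod]
  refine tsum_congr fun k => ?_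
  have hterm : ∀ m, (b ∘ swapSite ⟨f, hf⟩) (k, m) = W k * H (extH k) / N (extH k) *
      (siteWeight β f (extH k) m * X (Function.update (extH k) f m)) := by
    intro m
    have e1 : extH (Function.update k ⟨f, hf⟩ m) = Function.update (extH k) f m :=
      extH_update k ⟨f, hf⟩ m
    have e2 : N (Function.update (extH k) f m) = N (extH k) :=
      tsum_congr fun l => siteWeight_update β f _ m l
    have e3 : k ⟨f, hf⟩ = extH k f := by simp [extH, hf]
    simp only [hb, W, Function.comp_apply, swapSite, Equiv.coe_fn_mk, e1, e2, e3, hH,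
      siteWeight_update]
    have e4 := hWeight_update_mul (β := β) hf (extH k) m
    calc _ = (hWeight β n (Function.update (extH k) f m) * siteWeight β f (extH k) (extH k f)) *
          (X (Function.update (extH k) f m) * H (extH k) / N (extH k)) := by ring
      _ = _ := by rw [e4]; ring
  simp only [hterm, tsum_mul_left]
  unfold siteAvg
  ring

end XYHeight

/-! ### Increasing probes and domination of gradient covariances -/

namespace XYHeight

/-! ### Increasing probes of the height of a face -/

/-- Translation of a height configuration. -/
def translate (v : ℤ × ℤ) (h : ℤ × ℤ → ℤ) : ℤ × ℤ → ℤ := fun g => h (g + v)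

theorem translate_update (v f : ℤ × ℤ) (h : ℤ × ℤ → ℤ) (m : ℤ) :
    translate v (Function.update h (f + v) m) = Function.update (translate v h) f m := by
  funext g
  by_cases hg : g = f
  · subst hg; simp [translate]
  · have : g + v ≠ f + v := fun e => hg (add_right_cancel e)
    simp [translate, hg, this]

theorem siteWeight_translate (β : ℝ) (v f : ℤ × ℤ) (h : ℤ × ℤ → ℤ) (m : ℤ) :
    siteWeight β f (translate v h) m = siteWeight β (f + v) h m := by
  have e : ∀ x y c d : ℤ, ((x + c, y + d) : ℤ × ℤ) + v = (x + v.1 + c, y + v.2 + d) :=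
    fun x y c d =>
    Prod.ext (add_right_comm _ _ _) (add_right_comm _ _ _)
  have e1 := e f.1 f.2 1 0
  have e2 := e f.1 f.2 (-1) 0
  have e3 := e f.1 f.2 0 1
  have e4 := e f.1 f.2 0 (-1)
  simp only [add_zero, ← sub_eq_add_neg] at e1 e2 e3 e4
  simp only [siteWeight, prod_nbrs, translate, e1, e2, e3, e4, Prod.fst_add, Prod.snd_add]

theorem siteAvg_translate (β : ℝ) (v f : ℤ × ℤ) (X : (ℤ × ℤ → ℤ) → ℝ) (h : ℤ × ℤ → ℤ) :
    siteAvg β f X (translate v h) = siteAvg β (f + v) (fun h => X (translate v h)) h := by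
  simp only [siteAvg, siteWeight_translate, translate_update]

/-- An increasing observable of the heights on `Q` that, even after translation, has the same
conditional expectation as the height of `a` given the heights outside of `P`. -/
structure IsProbe (β : ℝ) (a : ℤ × ℤ) (P Q : Finset (ℤ × ℤ)) (X : (ℤ × ℤ → ℤ) → ℝ) : Prop where
  tame : IsTame Q X
  avg : ∀ (n : ℕ) (v : ℤ × ℤ) (H : (ℤ × ℤ → ℤ) → ℝ), (∀ p ∈ P, p + v ∈ faceBox n) → LinBdd H →
    (∀ p ∈ P, ∀ h m, H (Function.update h (p + v) m) = H h) →
    hSum β n (fun h => X (translate v h) * H h) = hSum β n fun h => h (a + v) * H h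

theorem IsTame.linBdd_translate {Q : Finset (ℤ × ℤ)} {X : (ℤ × ℤ → ℤ) → ℝ} (hX : IsTame Q X)
    (v : ℤ × ℤ) : LinBdd fun h => X (translate v h) := by
  refine ⟨|X 0|, 1, Q.map (addRightEmbedding v), abs_nonneg _, zero_le_one, fun h => ?_⟩
  rw [Finset.sum_map, one_mul]
  exact hX.abs_le _

theorem isProbe_eval (β : ℝ) {a : ℤ × ℤ} {P Q : Finset (ℤ × ℤ)} (ha : a ∈ Q) :
    IsProbe β a P Q fun h => (h a : ℝ) :=
  ⟨isTame_eval ha, fun _ _ _ _ _ _ => rfl⟩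

theorem IsProbe.siteAvg {β : ℝ} (hβ : 0 < β) {a f : ℤ × ℤ} {P Q : Finset (ℤ × ℤ)}
    {X : (ℤ × ℤ → ℤ) → ℝ} (hX : IsProbe β a P Q X) (hf : f ∈ P) (hQ : nbrs f ⊆ Q) :
    IsProbe β a P Q (siteAvg β f X) := by
  refine ⟨hX.tame.siteAvg hβ hQ, fun n v H hP bH hH => ?_⟩
  rw [← hX.avg n v H hP bH hH, ← hSum_siteAvg hβ (hP f hf) (hX.tame.linBdd_translate v) bH
    (hH f hf)]
  simp only [siteAvg_translate]

/-- A step of a path inside `P`. -/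
def Step (P : Finset (ℤ × ℤ)) (p q : ℤ × ℤ) : Prop := p ∈ P ∧ q ∈ nbrs p

/-- A set of faces together with its neighbours. -/
def hull (P : Finset (ℤ × ℤ)) : Finset (ℤ × ℤ) := P ∪ P.biUnion nbrs

theorem nbrs_subset_hull {P : Finset (ℤ × ℤ)} {p : ℤ × ℤ} (hp : p ∈ P) : nbrs p ⊆ hull P :=
  (Finset.subset_biUnion_of_mem nbrs hp).trans Finset.subset_union_right

/-- Start from the height of `a` itself and resample the faces along the path in turn: each
resampling carries strict dependence to the next face and leaves expectations given the outside of
`P` unchanged. -/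
theorem exists_isProbe_strictAt {β : ℝ} (hβ : 0 < β) {a : ℤ × ℤ} {P : Finset (ℤ × ℤ)}
    (ha : a ∈ P) {f : ℤ × ℤ} (hf : Relation.ReflTransGen (Step P) a f) :
    ∃ X, IsProbe β a P (hull P) X ∧ StrictAt f X := by
  induction hf with
  | refl =>
    refine ⟨_, isProbe_eval β (Finset.mem_union_left _ ha), fun h => ?_⟩
    simp
  | tail _ hs ih =>
    obtain ⟨X, hX, hst⟩ := ih
    exact ⟨_, hX.siteAvg hβ hs.1 (nbrs_subset_hull hs.1), hst.siteAvg hβ hX.tame hs.2⟩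

/-- A connected set of faces, seen from a base face. -/
structure IsCluster (a : ℤ × ℤ) (P : Finset (ℤ × ℤ)) : Prop where
  mem : a ∈ P
  path : ∀ p ∈ P, Relation.ReflTransGen (Step P) a p

theorem IsCluster.path_hull {a : ℤ × ℤ} {P : Finset (ℤ × ℤ)} (hP : IsCluster a P) {f : ℤ × ℤ}
    (hf : f ∈ hull P) : Relation.ReflTransGen (Step P) a f := by
  rcases Finset.mem_union.1 hf with h | h
  · exact hP.path f h
  · obtain ⟨p, hp, hpf⟩ := Finset.mem_biUnion.1 h
    exact (hP.path p hp).tail ⟨hp, hpf⟩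

/-- An increasing observable of the heights on the hull of `P`, strictly increasing in all of them,
and with the same conditional expectation, up to a factor, as the height of `a`. -/
structure IsStrictProbe (β : ℝ) (a : ℤ × ℤ) (P : Finset (ℤ × ℤ)) (N : ℝ)
    (X : (ℤ × ℤ → ℤ) → ℝ) : Prop where
  mono : Monotone X
  shift : ∀ (h : ℤ × ℤ → ℤ) (c : ℤ), X (fun f => h f + c) = X h + N * c
  loc : ∀ h h' : ℤ × ℤ → ℤ, (∀ f ∈ hull P, h f = h' f) → X h = X h'
  strict : ∀ f ∈ hull P, StrictAt f X
  linBdd : ∀ v, LinBdd fun h => X (translate v h)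
  avg : ∀ (n : ℕ) (v : ℤ × ℤ) (H : (ℤ × ℤ → ℤ) → ℝ), (∀ p ∈ P, p + v ∈ faceBox n) → LinBdd H →
    (∀ p ∈ P, ∀ h m, H (Function.update h (p + v) m) = H h) →
    hSum β n (fun h => X (translate v h) * H h) = N * hSum β n fun h => h (a + v) * H h

theorem LinBdd.sum {ι : Type*} (s : Finset ι) {X : ι → (ℤ × ℤ → ℤ) → ℝ}
    (hX : ∀ i ∈ s, LinBdd (X i)) : LinBdd fun h => ∑ i ∈ s, X i h := by
  classical
  induction s using Finset.induction_on with
  | empty => simpa using LinBdd.const 0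
  | insert i s hi ih =>
    simp only [Finset.sum_insert hi]
    exact (hX i (Finset.mem_insert_self _ _)).add
      (ih fun j hj => hX j (Finset.mem_insert_of_mem hj))

/-- The probes for the individual faces of the hull are added. Each is increasing, so strictness of
one summand suffices; the factor `N` is the number of summands. -/
theorem exists_isStrictProbe {β : ℝ} (hβ : 0 < β) {a : ℤ × ℤ} {P : Finset (ℤ × ℤ)}
    (hP : IsCluster a P) : ∃ N X, 0 < N ∧ IsStrictProbe β a P N X := by
  choose! Y hY hYs using fun f (hf : f ∈ hull P) =>
    exists_isProbe_strictAt hβ hP.mem (hP.path_hull hf)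
  have hne : (hull P).Nonempty := ⟨a, Finset.mem_union_left _ hP.mem⟩
  refine ⟨(hull P).card, fun h => ∑ f ∈ hull P, Y f h, by exact_mod_cast hne.card_pos, ?_⟩
  refine ⟨fun h h' hh => Finset.sum_le_sum fun f hf => (hY f hf).tame.mono hh, fun h c => ?_,
    fun h h' hh => Finset.sum_congr rfl fun f hf => (hY f hf).tame.loc h h' hh,
    fun f hf h => ?_, fun v => LinBdd.sum _ fun f hf => (hY f hf).tame.linBdd_translate v,
    fun n v H hv bH hH => ?_⟩
  · rw [Finset.sum_congr rfl fun f hf => (hY f hf).tame.shift h c, Finset.sum_add_distrib,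
      Finset.sum_const, nsmul_eq_mul]
  · refine Finset.sum_lt_sum (fun g hg => (hY g hg).tame.mono ?_) ⟨f, hf, hYs f hf h⟩
    rw [le_update_iff]
    exact ⟨by omega, fun _ _ => le_rfl⟩
  · have h1 : hSum β n (fun h => (∑ f ∈ hull P, Y f (translate v h)) * H h) =
        ∑ f ∈ hull P, hSum β n fun h => Y f (translate v h) * H h := by
      simp only [hSum, Finset.sum_mul, Finset.mul_sum]
      exact Summable.tsum_finsetSum fun f hf =>
        ((hY f hf).tame.linBdd_translate v).summable hβ.le bH n
    rw [h1, Finset.sum_congr rfl fun f hf => (hY f hf).avg n v H hv bH hH, Finset.sum_const,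
      nsmul_eq_mul]

/-! ### Domination of local functions of the gradient -/

/-- Bounded functions of the heights on the hull of `P` that are invariant under constant shifts,
and vanish if two neighbouring heights, one of them in `P`, differ by more than `Λ`. -/
structure IsGradLocal (P : Finset (ℤ × ℤ)) (Λ : ℤ) (B : ℝ) (Ψ : (ℤ × ℤ → ℤ) → ℝ) : Prop where
  bound : ∀ h, |Ψ h| ≤ B
  loc : ∀ h h' : ℤ × ℤ → ℤ, (∀ f ∈ hull P, h f = h' f) → Ψ h = Ψ h'
  supp : ∀ h, Ψ h ≠ 0 → ∀ p q, Step P p q → |h q - h p| ≤ Λ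

theorem exists_path_bound {P : Finset (ℤ × ℤ)} (Λ : ℤ) {a f : ℤ × ℤ}
    (hf : Relation.ReflTransGen (Step P) a f) :
    ∃ D : ℤ, ∀ h : ℤ × ℤ → ℤ, (∀ p q, Step P p q → |h q - h p| ≤ Λ) → |h f - h a| ≤ D := by
  induction hf with
  | refl => exact ⟨0, fun h _ => by simp⟩
  | @tail b c _ hs ih =>
    obtain ⟨D, hD⟩ := ih
    refine ⟨D + Λ, fun h hh => ?_⟩
    have h1 := hD h hh
    have h2 := hh _ _ hs
    have h3 := abs_add_le (h b - h a) (h c - h b)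
    rw [show h b - h a + (h c - h b) = h c - h a by ring] at h3
    linarith

theorem IsCluster.exists_bound {a : ℤ × ℤ} {P : Finset (ℤ × ℤ)} (hP : IsCluster a P) (Λ : ℤ) :
    ∃ D : ℤ, ∀ h : ℤ × ℤ → ℤ, (∀ p q, Step P p q → |h q - h p| ≤ Λ) →
      ∀ f ∈ hull P, |h f - h a| ≤ D := by
  choose! D hD using fun f (hf : f ∈ hull P) => exists_path_bound Λ (hP.path_hull hf)
  refine ⟨∑ f ∈ hull P, |D f|, fun h hh f hf => ?_⟩
  refine (hD f hf h hh).trans ((le_abs_self _).trans ?_)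
  exact Finset.single_le_sum (f := fun f => |D f|) (fun _ _ => abs_nonneg _) hf

theorem exists_pos_le_of_finite {T : Type*} [Finite T] (φ : T → ℝ) (hφ : ∀ t, 0 < φ t) :
    ∃ c, 0 < c ∧ ∀ t, c ≤ φ t := by
  rcases isEmpty_or_nonempty T with h | h
  · exact ⟨1, one_pos, fun t => h.elim t⟩
  · obtain ⟨t, ht⟩ := Finite.exists_min φ
    exact ⟨φ t, hφ t, ht⟩

/-- Increments of `X` are invariant under constant shifts. On a connected set, bounded gradients
leave only finitely many configurations of the hull modulo shifts, so the strictly positive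
increments have a positive minimum. -/
theorem IsStrictProbe.exists_increment {β : ℝ} {a : ℤ × ℤ} {P : Finset (ℤ × ℤ)} {N : ℝ}
    {X : (ℤ × ℤ → ℤ) → ℝ} (hX : IsStrictProbe β a P N X) (hP : IsCluster a P) (Λ : ℤ) :
    ∃ c, 0 < c ∧ ∀ h : ℤ × ℤ → ℤ, (∀ p q, Step P p q → |h q - h p| ≤ Λ) → ∀ f ∈ hull P,
      c ≤ X (Function.update h f (h f + 1)) - X h ∧
      c ≤ X h - X (Function.update h f (h f - 1)) := by
  classical
  obtain ⟨D, hD⟩ := hP.exists_bound Λ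
  let ext : (hull P → Finset.Icc (-D) D) → ℤ × ℤ → ℤ :=
    fun k q => if hq : q ∈ hull P then (k ⟨q, hq⟩ : ℤ) else 0
  have hdn : ∀ (h : ℤ × ℤ → ℤ) (f : ℤ × ℤ), f ∈ hull P →
      0 < X h - X (Function.update h f (h f - 1)) := by
    intro h f hf
    have := hX.strict f hf (Function.update h f (h f - 1))
    simp only [Function.update_self, Function.update_idem, sub_add_cancel,
      Function.update_eq_self] at this
    linarith
  obtain ⟨c, hc, hc'⟩ := exists_pos_le_of_finite
    (fun t : (hull P → Finset.Icc (-D) D) × hull P =>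
      min (X (Function.update (ext t.1) t.2 (ext t.1 t.2 + 1)) - X (ext t.1))
        (X (ext t.1) - X (Function.update (ext t.1) t.2 (ext t.1 t.2 - 1))))
    fun t => lt_min (sub_pos.2 (hX.strict _ t.2.2 _)) (hdn _ _ t.2.2)
  refine ⟨c, hc, fun h hh f hf => ?_⟩
  -- The representative modulo shifts is normalised to have height zero at `a`.
  let k : hull P → Finset.Icc (-D) D := fun q =>
    ⟨h q - h a, Finset.mem_Icc.2 (abs_le.1 (hD h hh q q.2))⟩
  have hk : ∀ q ∈ hull P, ext k q = h q + -h a := fun q hq => by simp [ext, k, hq, sub_eq_add_neg]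
  have key := hc' (k, ⟨f, hf⟩)
  simp only [le_min_iff] at key
  have e0 : X (ext k) = X h + N * (-h a : ℤ) := by
    rw [← hX.shift]; exact hX.loc _ _ hk
  have e1 : ∀ m : ℤ, X (Function.update (ext k) f (ext k f + m)) =
      X (Function.update h f (h f + m)) + N * (-h a : ℤ) := by
    intro m
    rw [← hX.shift]
    refine hX.loc _ _ fun g hg => ?_
    by_cases hgf : g = f
    · subst hgf
      simp only [Function.update_self, hk g hg]
      ring
    · simp [hgf, hk g hg]
  rw [sub_eq_add_neg (ext k f), e0, e1, e1] at key
  rw [sub_eq_add_neg (h f)]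
  constructor <;> linarith [key.1, key.2]

/-- Between ordered configurations `Ψ` changes by at most $2B$. Where it changes at all, one
endpoint has bounded gradient and the heights differ on the hull, so `X` grows by at least $c$;
hence $C=2B/c$ works. -/
theorem IsStrictProbe.dominates {β : ℝ} {a : ℤ × ℤ} {P : Finset (ℤ × ℤ)} {N : ℝ}
    {X : (ℤ × ℤ → ℤ) → ℝ} (hX : IsStrictProbe β a P N X) (hP : IsCluster a P) (Λ : ℤ) {B : ℝ}
    (hB : 0 ≤ B) : ∃ C, 0 ≤ C ∧ ∀ Ψ, IsGradLocal P Λ B Ψ →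
      Monotone (fun h => C * X h + Ψ h) ∧ Monotone fun h => C * X h - Ψ h := by
  obtain ⟨c, hc, hinc⟩ := hX.exists_increment hP Λ
  refine ⟨2 * B / c, by positivity, fun Ψ hΨ => ?_⟩
  have key : ∀ h h' : ℤ × ℤ → ℤ, h ≤ h' → |Ψ h' - Ψ h| ≤ 2 * B / c * (X h' - X h) := by
    intro h h' hh
    by_cases heq : ∀ f ∈ hull P, h f = h' f
    · rw [hΨ.loc h h' heq, hX.loc h h' heq]; simp
    push Not at heq
    obtain ⟨f, hf, hne⟩ := heq
    have hlt : h f < h' f := lt_of_le_of_ne (hh f) hne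
    have hab : |Ψ h' - Ψ h| ≤ 2 * B := by
      have := abs_sub (Ψ h') (Ψ h)
      linarith [hΨ.bound h, hΨ.bound h']
    by_cases hz : Ψ h = 0 ∧ Ψ h' = 0
    · rw [hz.1, hz.2, sub_zero, abs_zero]
      exact mul_nonneg (by positivity) (sub_nonneg.2 (hX.mono hh))
    suffices hs : c ≤ X h' - X h by
      calc _ ≤ 2 * B := hab
        _ = 2 * B / c * c := by field_simp
        _ ≤ _ := mul_le_mul_of_nonneg_left hs (by positivity)
    rw [not_and_or] at hz
    rcases hz with hz | hz
    -- If `Ψ` is nonzero at the lower endpoint, the unit step upward from it gives the gain; in the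
    -- other case it is the unit step downward from the upper endpoint.
    · have h1 := (hinc h (hΨ.supp h hz) f hf).1
      have h2 : Function.update h f (h f + 1) ≤ h' :=
        update_le_iff.2 ⟨by omega, fun g _ => hh g⟩
      have := hX.mono h2
      linarith
    · have h1 := (hinc h' (hΨ.supp h' hz) f hf).2
      have h2 : h ≤ Function.update h' f (h' f - 1) :=
        le_update_iff.2 ⟨by omega, fun g _ => hh g⟩
      have := hX.mono h2
      linarith
  constructor <;> intro h h' hh <;> have h1 := abs_le.1 (key h h' hh) <;>
    dsimp only <;> linarith [h1.1, h1.2]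

/-! ### Covariances of local functions of the gradient -/

theorem translate_mono (v : ℤ × ℤ) : Monotone (translate v) := fun _ _ hh g => hh (g + v)

theorem hSum_mul_comm (β : ℝ) (n : ℕ) (X Y : (ℤ × ℤ → ℤ) → ℝ) :
    hSum β n (fun h => X h * Y h) = hSum β n fun h => Y h * X h := by
  simp only [mul_comm]

theorem hSum_lin_mul_lin {β : ℝ} (hβ : 0 ≤ β) (n : ℕ) {X Y X' Y' : (ℤ × ℤ → ℤ) → ℝ}
    (bX : LinBdd X) (bY : LinBdd Y) (bX' : LinBdd X') (bY' : LinBdd Y') (s t s' t' : ℝ) :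
    hSum β n (fun h => (s * X h + t * Y h) * (s' * X' h + t' * Y' h)) =
      s * s' * hSum β n (fun h => X h * X' h) + s * t' * hSum β n (fun h => X h * Y' h) +
      t * s' * hSum β n (fun h => Y h * X' h) + t * t' * hSum β n (fun h => Y h * Y' h) := by
  have s1 := bX.summable hβ bX' n
  have s2 := bX.summable hβ bY' n
  have s3 := bY.summable hβ bX' n
  have s4 := bY.summable hβ bY' n
  unfold hSum
  simp only [← tsum_mul_left]
  rw [← (s1.mul_left _).tsum_add (s2.mul_left _),
    ← ((s1.mul_left _).add (s2.mul_left _)).tsum_add (s3.mul_left _),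
    ← (((s1.mul_left _).add (s2.mul_left _)).add (s3.mul_left _)).tsum_add (s4.mul_left _)]
  exact tsum_congr fun k => by ring

theorem hSum_lin {β : ℝ} (hβ : 0 ≤ β) (n : ℕ) {X Y : (ℤ × ℤ → ℤ) → ℝ}
    (bX : LinBdd X) (bY : LinBdd Y) (s t : ℝ) :
    hSum β n (fun h => s * X h + t * Y h) = s * hSum β n X + t * hSum β n Y := by
  have s1 := bX.summable_one hβ n
  have s2 := bY.summable_one hβ n
  unfold hSum
  simp only [← tsum_mul_left]
  rw [← (s1.mul_left _).tsum_add (s2.mul_left _)]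
  exact tsum_congr fun k => by ring

/-- Covariances of local functions of the gradient are dominated by the covariances of the
heights, uniformly in the volume and in the location. -/
theorem IsCluster.cov_le {β : ℝ} (hβ : 0 < β) {a a' : ℤ × ℤ} {P : Finset (ℤ × ℤ)}
    (hP : IsCluster a P) (hP' : IsCluster a' P) (Λ : ℤ) {B : ℝ} (hB : 0 ≤ B) :
    ∃ C, 0 ≤ C ∧ ∀ Ψ Ψ' : (ℤ × ℤ → ℤ) → ℝ, IsGradLocal P Λ B Ψ → IsGradLocal P Λ B Ψ' →
      ∀ (n : ℕ) (v v' : ℤ × ℤ), (∀ p ∈ P, p + v ∈ faceBox n) → (∀ p ∈ P, p + v' ∈ faceBox n) →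
      (∀ p ∈ P, ∀ q ∈ hull P, p + v ≠ q + v') →
      hSum β n (fun _ => 1) * hSum β n (fun h => Ψ (translate v h) * Ψ' (translate v' h)) -
        hSum β n (fun h => Ψ (translate v h)) * hSum β n (fun h => Ψ' (translate v' h)) ≤
      C * (hSum β n (fun _ => 1) * hSum β n fun h => h (a + v) * h (a' + v')) := by
  obtain ⟨N, X, hN, hX⟩ := exists_isStrictProbe hβ hP
  obtain ⟨C, hC, hdom⟩ := hX.dominates hP Λ hB
  obtain ⟨N', X', hN', hX'⟩ := exists_isStrictProbe hβ hP'
  obtain ⟨C', hC', hdom'⟩ := hX'.dominates hP' Λ hB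
  refine ⟨C * C' * (N * N'), by positivity, fun Ψ Ψ' hΨ hΨ' n v v' hv hv' hdis => ?_⟩
  have bΨ : LinBdd fun h => Ψ (translate v h) := LinBdd.of_bounded fun h => hΨ.bound _
  have bΨ' : LinBdd fun h => Ψ' (translate v' h) := LinBdd.of_bounded fun h => hΨ'.bound _
  have bX := hX.linBdd v
  have bX' := hX'.linBdd v'
  have m1 := hdom Ψ hΨ
  have m2 := hdom' Ψ' hΨ'
  have lin : ∀ (s t : ℝ) {Y Z : (ℤ × ℤ → ℤ) → ℝ}, LinBdd Y → LinBdd Z →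
      LinBdd fun h => s * Y h + t * Z h := fun s t _ _ bY bZ =>
    (bY.const_mul s).add (bZ.const_mul t)
  -- FKG for $(CX+\Psi,\,C'X'-\Psi')$ and for $(CX-\Psi,\,C'X'+\Psi')$: on adding, the mixed terms
  -- cancel and $\mathrm{Cov}(\Psi,\Psi')\le CC'\,\mathrm{Cov}(X,X')$ remains.
  have f1 := hSum_fkg hβ n (X := fun h => C * X (translate v h) + 1 * Ψ (translate v h))
    (Y := fun h => C' * X' (translate v' h) + (-1) * Ψ' (translate v' h))
    (fun h h' hh => by simpa using m1.1 (translate_mono v hh))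
    (fun h h' hh => by simpa [sub_eq_add_neg] using m2.2 (translate_mono v' hh))
    (lin _ _ bX bΨ) (lin _ _ bX' bΨ')
  have f2 := hSum_fkg hβ n (X := fun h => C * X (translate v h) + (-1) * Ψ (translate v h))
    (Y := fun h => C' * X' (translate v' h) + 1 * Ψ' (translate v' h))
    (fun h h' hh => by simpa [sub_eq_add_neg] using m1.2 (translate_mono v hh))
    (fun h h' hh => by simpa using m2.1 (translate_mono v' hh))
    (lin _ _ bX bΨ) (lin _ _ bX' bΨ')
  rw [hSum_lin_mul_lin hβ.le n bX bΨ bX' bΨ', hSum_lin hβ.le n bX bΨ, hSum_lin hβ.le n bX' bΨ']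
    at f1 f2
  have z : ∀ {a : ℤ × ℤ} {N : ℝ} {X : (ℤ × ℤ → ℤ) → ℝ} {w : ℤ × ℤ}, IsStrictProbe β a P N X →
      (∀ p ∈ P, p + w ∈ faceBox n) → hSum β n (fun h => X (translate w h)) = 0 := by
    intro a N X w hX hw
    have h1 := hX.avg n w (fun _ => 1) hw (LinBdd.const 1) fun _ _ _ _ => rfl
    simp only [mul_one] at h1
    rw [h1, hSum_odd n (fun h => by simp), mul_zero]
  have e1 : hSum β n (fun h => X (translate v h) * X' (translate v' h)) =
      N * N' * hSum β n fun h => h (a + v) * h (a' + v') := by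
    -- The probes are replaced by heights one at a time. The first replacement needs `X'` not to see
    -- the resampled faces of `X`; the second needs the height at `a + v` to avoid those of `X'`.
    rw [hX.avg n v (fun h => X' (translate v' h)) hv bX' fun p hp h m => ?_, hSum_mul_comm,
      hX'.avg n v' (fun h => h (a + v)) hv' (LinBdd.eval _) fun p hp h m => ?_, mul_assoc]
    · simp only [mul_comm]
    · rw [Function.update_of_ne]
      exact hdis a hP.mem p (Finset.mem_union_left _ hp)
    · refine hX'.loc _ _ fun q hq => ?_
      simp only [translate]
      rw [Function.update_of_ne (hdis p hp q hq).symm]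
  rw [z hX hv, z hX' hv', e1] at f1 f2
  linarith

end XYHeight

/-! ### From sourceless currents to heights with Bessel weights -/

namespace XYHeight

/-! ### Currents and heights -/

/-- The two orientations of the positive edges are the directed edges. -/
noncomputable def orient (n : ℕ) (t : posEdges n × Bool) : dirEdges n :=
  if t.2 then ⟨(t.1.1.1, tgt t.1.1), by
    have h := mem_posEdges.1 t.1.2
    refine Finset.mem_filter.2 ⟨Finset.mem_product.2 h, ?_⟩
    rw [adj_iff, tgt]; split <;> simp⟩
  else ⟨(tgt t.1.1, t.1.1.1), by
    have h := mem_posEdges.1 t.1.2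
    refine Finset.mem_filter.2 ⟨Finset.mem_product.2 h.symm, ?_⟩
    rw [adj_iff, tgt]; split <;> simp⟩

theorem orient_true {n : ℕ} (e : posEdges n) : (orient n (e, true)).1 = (e.1.1, tgt e.1) := rfl

theorem orient_false {n : ℕ} (e : posEdges n) : (orient n (e, false)).1 = (tgt e.1, e.1.1) := rfl

theorem orient_bijective (n : ℕ) : Function.Bijective (orient n) := by
  constructor
  · rintro ⟨⟨⟨⟨i, j⟩, b⟩, he⟩, s⟩ ⟨⟨⟨⟨i', j'⟩, b'⟩, he'⟩, s'⟩ h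
    have h1 := congrArg Subtype.val h
    cases s <;> cases s' <;> cases b <;> cases b' <;>
      simp only [orient_true, orient_false, tgt, Prod.mk.injEq, if_true, Bool.false_eq_true,
        if_false] at h1 <;> first
      | (obtain ⟨⟨h1, h2⟩, -⟩ := h1; subst h1; subst h2; rfl)
      | (obtain ⟨-, h1, h2⟩ := h1; subst h1; subst h2; rfl)
      | omega
  · rintro ⟨⟨x, y⟩, h⟩
    have h1 := Finset.mem_filter.1 h
    have h2 := Finset.mem_product.1 h1.1
    obtain ⟨i, j⟩ := x
    have h3 := (adj_iff _ _).1 h1.2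
    dsimp only at h3
    rcases h3 with rfl | rfl | rfl | rfl
    · exact ⟨(⟨((i, j), false), mem_posEdges.2 h2⟩, true), rfl⟩
    · refine ⟨(⟨((i - 1, j), false), mem_posEdges.2 ?_⟩, false), Subtype.ext ?_⟩
      · simpa [tgt] using h2.symm
      · simp [orient_false, tgt]
    · exact ⟨(⟨((i, j), true), mem_posEdges.2 h2⟩, true), rfl⟩
    · refine ⟨(⟨((i, j - 1), true), mem_posEdges.2 ?_⟩, false), Subtype.ext ?_⟩
      · simpa [tgt] using h2.symm
      · simp [orient_false, tgt]

/-- The two orientations of the positive edges are the directed edges. -/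
noncomputable def orientEquiv (n : ℕ) : posEdges n × Bool ≃ dirEdges n :=
  Equiv.ofBijective _ (orient_bijective n)

/-- Extension of edge functions by zero. -/
noncomputable def extE {n : ℕ} (d : posEdges n → ℤ) (e : (ℤ × ℤ) × Bool) : ℤ :=
  if h : e ∈ posEdges n then d ⟨e, h⟩ else 0

/-- The current with given values on the two orientations of the positive edges. -/
noncomputable def pairCurrent {n : ℕ} (p : posEdges n → ℕ × ℕ) : Current n := fun e =>
  if ((orientEquiv n).symm e).2 then (p ((orientEquiv n).symm e).1).1
  else (p ((orientEquiv n).symm e).1).2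

theorem pairCurrent_orient {n : ℕ} (p : posEdges n → ℕ × ℕ) (t : posEdges n × Bool) :
    pairCurrent p (orient n t) = if t.2 then (p t.1).1 else (p t.1).2 := by
  have : (orientEquiv n).symm (orient n t) = t := (orientEquiv n).symm_apply_apply t
  simp only [pairCurrent, this]

theorem val_orient {n : ℕ} (c : Current n) (t : posEdges n × Bool) {x y : ℤ × ℤ}
    (h : (orient n t).1 = (x, y)) : c.val x y = c (orient n t) := by
  have h1 : (x, y) ∈ dirEdges n := h ▸ (orient n t).2
  have h2 : (⟨(x, y), h1⟩ : dirEdges n) = orient n t := Subtype.ext h.symm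
  simp only [Current.val, h1, dif_pos, h2]

theorem flow_eq_extE {n : ℕ} (c : Current n) (e : (ℤ × ℤ) × Bool) :
    c.flow e.1 (tgt e) =
      extE (fun e => (c (orient n (e, true)) : ℤ) - c (orient n (e, false))) e := by
  by_cases he : e ∈ posEdges n
  · rw [Current.flow, val_orient c (⟨e, he⟩, true) rfl, val_orient c (⟨e, he⟩, false) rfl]
    simp [extE, he]
  · rw [flow_eq_zero]
    · simp [extE, he]
    · exact fun h => he (mem_posEdges.2 ⟨h.1, h.2.1⟩)

theorem flow_pairCurrent {n : ℕ} (p : posEdges n → ℕ × ℕ) (e : (ℤ × ℤ) × Bool) :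
    (pairCurrent p).flow e.1 (tgt e) = extE (fun e => ((p e).1 : ℤ) - (p e).2) e := by
  rw [flow_eq_extE]
  simp only [pairCurrent_orient, if_true, Bool.false_eq_true, if_false]

theorem gradH_of_notMem {n : ℕ} (k : faceBox n → ℤ) {e : (ℤ × ℤ) × Bool} (he : e ∉ posEdges n) :
    gradH (extH k) e = 0 := by
  obtain ⟨⟨i, j⟩, b⟩ := e
  rw [mem_posEdges, mem_box, mem_box] at he
  have z : ∀ a b : ℤ, ¬((-(n : ℤ) ≤ a ∧ a < n) ∧ -(n : ℤ) ≤ b ∧ b < n) → extH k (a, b) = 0 :=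
    fun a b h => extH_apply_of_notMem k (by rw [mem_faceBox]; exact h)
  cases b <;> simp only [tgt, if_true, Bool.false_eq_true, if_false] at he <;>
    simp only [gradH, otherFace, if_true, Bool.false_eq_true, if_false] <;>
    rw [z _ _ (by omega), z _ _ (by omega), sub_zero]

theorem extE_gradH {n : ℕ} (k : faceBox n → ℤ) (e : (ℤ × ℤ) × Bool) :
    extE (fun e : posEdges n => gradH (extH k) e.1) e = gradH (extH k) e := by
  by_cases he : e ∈ posEdges n
  · simp [extE, he]
  · simp [extE, he, gradH_of_notMem]

/-- The divergence of a function on the edges. -/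
noncomputable def divE {n : ℕ} (d : posEdges n → ℤ) (x : ℤ × ℤ) : ℤ :=
  extE d (x, false) - extE d ((x.1 - 1, x.2), false) + extE d (x, true)
    - extE d ((x.1, x.2 - 1), true)

theorem source_eq_divE {n : ℕ} (c : Current n) (x : ℤ × ℤ) : c.source x =
    divE (fun e => (c (orient n (e, true)) : ℤ) - c (orient n (e, false))) x := by
  obtain ⟨i, j⟩ := x
  rw [source_eq, divE, ← flow_eq_extE c ((i, j), false), ← flow_eq_extE c ((i, j), true),
    ← flow_eq_extE c ((i - 1, j), false), ← flow_eq_extE c ((i, j - 1), true)]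
  simp only [tgt, if_true, Bool.false_eq_true, if_false, sub_add_cancel]
  rw [flow_swap c (i - 1, j) (i, j), flow_swap c (i, j - 1) (i, j)]
  ring

theorem divE_gradH {n : ℕ} (k : faceBox n → ℤ) (x : ℤ × ℤ) :
    divE (fun e : posEdges n => gradH (extH k) e.1) x = 0 := by
  rw [divE, extE_gradH, extE_gradH, extE_gradH, extE_gradH]
  simp only [gradH, otherFace, if_true, Bool.false_eq_true, if_false]
  ring

theorem gradH_injective {n : ℕ} :
    Function.Injective fun (k : faceBox n → ℤ) (e : posEdges n) => gradH (extH k) e.1 := by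
  intro k k' h
  refine extH_injective (funext fun ⟨i, j⟩ => ?_)
  rw [height_eq_sum, height_eq_sum]
  refine Finset.sum_congr rfl fun l _ => ?_
  rw [← extE_gradH, ← extE_gradH]
  exact congrArg (fun d => extE d _) h

theorem IsHeight.extH_restrict {n : ℕ} {c : Current n} {h : ℤ × ℤ → ℤ} (hh : IsHeight c h) :
    extH (fun f : faceBox n => h f) = h := by
  funext a
  by_cases ha : a ∈ faceBox n
  · simp [extH, ha]
  · rw [extH_apply_of_notMem _ ha, hh.outer a ha]

theorem IsHeight.flow_eq {n : ℕ} {c : Current n} {h : ℤ × ℤ → ℤ} (hh : IsHeight c h)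
    (e : (ℤ × ℤ) × Bool) : c.flow e.1 (tgt e) = gradH h e := by
  obtain ⟨⟨i, j⟩, b⟩ := e
  cases b
  · simp [tgt, gradH, otherFace, ← hh.rightward]
  · simp [tgt, gradH, otherFace, ← hh.upward]

theorem isHeight_extH {n : ℕ} {c : Current n} {k : faceBox n → ℤ}
    (h : ∀ e, c.flow e.1 (tgt e) = gradH (extH k) e) : IsHeight c (extH k) :=
  ⟨fun _ ha => extH_apply_of_notMem k ha, fun i j => (h ((i, j), true)).symm,
    fun i j => (h ((i, j), false)).symm⟩

/-- An edge function without divergence is the gradient of heights. -/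
theorem exists_gradH_eq {n : ℕ} {d : posEdges n → ℤ} (hd : ∀ x ∈ box n, divE d x = 0) :
    ∃ k : faceBox n → ℤ, (fun e : posEdges n => gradH (extH k) e.1) = d := by
  -- The edge function is realised as the flow of a current with zero minima, so that the height
  -- function of that current can be used.
  set c := pairCurrent fun e => diffMinEquiv (d e, 0) with hc
  have hp : (fun e => (c (orient n (e, true)) : ℤ) - c (orient n (e, false))) = d := by
    funext e
    simp only [hc, pairCurrent_orient, if_true, Bool.false_eq_true, if_false, diffMinEquiv,
      Equiv.coe_fn_mk]
    omega
  have hs : c.Sourceless := fun x hx => by rw [source_eq_divE, hp, hd x hx]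
  have hh := isHeight_height c hs
  refine ⟨fun f => height c f, funext fun e => ?_⟩
  rw [hh.extH_restrict, ← hh.flow_eq, flow_eq_extE, hp]
  simp [extE]

/-- The sourceless current with given heights and given minima on the edges. -/
noncomputable def heightCurrent (n : ℕ) (t : (faceBox n → ℤ) × (posEdges n → ℕ)) :
    {c : Current n // c.Sourceless} :=
  ⟨pairCurrent fun e => diffMinEquiv (gradH (extH t.1) e.1, t.2 e), fun x _ => by
    rw [source_eq_divE, ← divE_gradH t.1 x]
    congr 1
    funext e
    simp only [pairCurrent_orient, if_true, Bool.false_eq_true, if_false, diffMinEquiv,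
      Equiv.coe_fn_mk]
    omega⟩

theorem heightCurrent_orient {n : ℕ} (t : (faceBox n → ℤ) × (posEdges n → ℕ)) (e : posEdges n) :
    ((heightCurrent n t).1 (orient n (e, true)), (heightCurrent n t).1 (orient n (e, false))) =
      diffMinEquiv (gradH (extH t.1) e.1, t.2 e) := by
  simp [heightCurrent, pairCurrent_orient]

theorem height_heightCurrent {n : ℕ} (t : (faceBox n → ℤ) × (posEdges n → ℕ)) :
    height (heightCurrent n t).1 = extH t.1 := by
  refine ((isHeight_iff _ (heightCurrent n t).2 _).1 (isHeight_extH fun e => ?_)).symm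
  rw [heightCurrent, flow_pairCurrent, ← extE_gradH]
  congr 1
  funext e
  simp only [diffMinEquiv, Equiv.coe_fn_mk]
  omega

/-- A sourceless current is determined by its net flows, which are the gradient of its heights, and
by the smaller of the two opposite values on each edge. The minima are unconstrained. -/
theorem heightCurrent_bijective (n : ℕ) : Function.Bijective (heightCurrent n) := by
  constructor
  · intro t t' h
    have h1 : t.1 = t'.1 := extH_injective (by
      rw [← height_heightCurrent, ← height_heightCurrent, h])
    refine Prod.ext h1 (funext fun e => ?_)
    have h2 := heightCurrent_orient t e
    rw [h, heightCurrent_orient] at h2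
    exact (Prod.ext_iff.1 (diffMinEquiv.injective h2)).2.symm
  · rintro ⟨c, hc⟩
    have hh := isHeight_height c hc
    refine ⟨(fun f => height c f, fun e =>
      min (c (orient n (e, true))) (c (orient n (e, false)))), Subtype.ext (funext fun e => ?_)⟩
    obtain ⟨⟨e, b⟩, rfl⟩ := (orient_bijective n).2 e
    have h1 := heightCurrent_orient (n := n) (fun f => height c f, fun e =>
      min (c (orient n (e, true))) (c (orient n (e, false)))) e
    have h2 : gradH (extH fun f : faceBox n => height c f) e.1 =
        (c (orient n (e, true)) : ℤ) - c (orient n (e, false)) := by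
      rw [hh.extH_restrict, ← hh.flow_eq, flow_eq_extE]
      simp [extE]
    have h3 := diffMinEquiv.apply_symm_apply (c (orient n (e, true)), c (orient n (e, false)))
    simp only [h2] at h1
    have h4 := h1.trans h3
    rw [Prod.mk.injEq] at h4
    cases b
    · exact h4.2
    · exact h4.1

theorem weight_eq {n : ℕ} (β : ℝ) (c : Current n) : c.weight β = ∏ e : posEdges n,
    ((β / 2) ^ c (orient n (e, true)) / (Nat.factorial (c (orient n (e, true))) : ℝ) *
      ((β / 2) ^ c (orient n (e, false)) / (Nat.factorial (c (orient n (e, false))) : ℝ))) := by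
  rw [Current.weight, ← (orientEquiv n).prod_comp, Fintype.prod_prod_type]
  refine Finset.prod_congr rfl fun e _ => ?_
  rw [Fintype.prod_bool]
  rfl

theorem weight_heightCurrent {n : ℕ} (β : ℝ) (t : (faceBox n → ℤ) × (posEdges n → ℕ)) :
    (heightCurrent n t).1.weight β = ∏ e : posEdges n,
      ((β / 2) ^ (2 * t.2 e + (gradH (extH t.1) e.1).natAbs) /
        (((t.2 e).factorial : ℝ) * ((t.2 e + (gradH (extH t.1) e.1).natAbs).factorial : ℝ))) := by
  rw [weight_eq]
  refine Finset.prod_congr rfl fun e _ => ?_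
  rw [← diffMin_weight, ← heightCurrent_orient]

/-- For fixed heights, the sum over the minima factorises over the edges, and each factor is the
series of $I_d(\beta)$ at the gradient $d$. -/
theorem tsum_sourceless {β : ℝ} (hβ : 0 ≤ β) (n : ℕ) {F : (ℤ × ℤ → ℤ) → ℝ}
    (hF : Summable fun k : faceBox n → ℤ => hWeight β n (extH k) * F (extH k)) :
    ∑' c : {c : Current n // c.Sourceless}, F (height c.1) * c.1.weight β = hSum β n F := by
  have hw0 : ∀ t, 0 ≤ (heightCurrent n t).1.weight β := fun t => by
    rw [weight_heightCurrent]
    exact Finset.prod_nonneg fun e _ => by positivity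
  have hs : ∀ k, HasSum (fun m => (heightCurrent n (k, m)).1.weight β) (hWeight β n (extH k)) := by
    intro k
    simp only [weight_heightCurrent]
    have h1 := hasSum_pi_prod (f := fun (e : posEdges n) (j : ℕ) =>
      (β / 2) ^ (2 * j + (gradH (extH k) e.1).natAbs) /
        ((j.factorial : ℝ) * ((j + (gradH (extH k) e.1).natAbs).factorial : ℝ)))
      fun e => (besselI_summable β _).norm
    rw [hWeight, ← Finset.prod_coe_sort]
    exact h1
  let E := Equiv.ofBijective _ (heightCurrent_bijective n)
  rw [← E.tsum_eq]
  have hE : ∀ t, F (height (E t).1) * (E t).1.weight β =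
      F (extH t.1) * (heightCurrent n t).1.weight β := fun t => by
    rw [← height_heightCurrent]; rfl
  simp only [hE]
  have hsum : Summable fun t : (faceBox n → ℤ) × (posEdges n → ℕ) =>
      F (extH t.1) * (heightCurrent n t).1.weight β := by
    rw [← summable_abs_iff, summable_prod_of_nonneg fun t => abs_nonneg _]
    simp only [abs_mul, abs_of_nonneg (hw0 _)]
    refine ⟨fun k => (hs k).summable.mul_left _, ?_⟩
    simp only [tsum_mul_left, (hs _).tsum_eq]
    refine hF.abs.congr fun k => ?_
    have hW : 0 ≤ hWeight β n (extH k) := Finset.prod_nonneg fun e _ => besselI_nonneg hβ _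
    rw [abs_mul, mul_comm, abs_of_nonneg hW]
  rw [hsum.tsum_prod]
  refine tsum_congr fun k => ?_
  dsimp only
  rw [tsum_mul_left, (hs k).tsum_eq, mul_comm]

theorem heightCov_eq {β : ℝ} (hβ : 0 ≤ β) (n : ℕ) (a b : ℤ × ℤ) :
    heightCov n β a b = hSum β n (fun h => h a * h b) / hSum β n fun _ => 1 := by
  have h1 := tsum_sourceless hβ n (F := fun h => (h a : ℝ) * h b)
    ((LinBdd.eval a).summable hβ (LinBdd.eval b) n)
  have h2 := tsum_sourceless hβ n (F := fun _ => 1) ((LinBdd.const 1).summable_one hβ n)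
  simp only [one_mul] at h2
  rw [heightCov, currentExpect, h1, h2]

theorem heightCov_nonneg {β : ℝ} (hβ : 0 < β) (n : ℕ) (a b : ℤ × ℤ) : 0 ≤ heightCov n β a b := by
  rw [heightCov_eq hβ.le]
  have h1 := hSum_fkg hβ n (X := fun h => (h a : ℝ)) (Y := fun h => (h b : ℝ))
    (fun h h' hh => Int.cast_le.2 (hh a)) (fun h h' hh => Int.cast_le.2 (hh b))
    (LinBdd.eval a) (LinBdd.eval b)
  rw [hSum_odd n (X := fun h => (h a : ℝ)) (fun h => by simp), zero_mul] at h1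
  have h2 := hSum_one_pos hβ n
  exact div_nonneg (nonneg_of_mul_nonneg_right h1 h2) h2.le

end XYHeight

/-! ### Ginibre's inequality -/

namespace XYHeight

set_option linter.unusedSectionVars false

/-! ### Ginibre's inequality on compact abelian groups -/

section group

variable {G : Type*} [CommGroup G] [TopologicalSpace G] [IsTopologicalGroup G] [CompactSpace G]

/-- Products `u ⊗ u` of a function with itself. -/
def squareKernels (G : Type*) [TopologicalSpace G] : Submonoid C(G × G, ℝ) where
  carrier := {κ | ∃ u : C(G, ℝ), ∀ x, κ x = u x.1 * u x.2}
  mul_mem' := by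
    rintro κ κ' ⟨u, hu⟩ ⟨v, hv⟩
    refine ⟨u * v, fun x => ?_⟩
    rw [ContinuousMap.mul_apply, hu, hv, ContinuousMap.mul_apply, ContinuousMap.mul_apply]
    ring
  one_mem' := ⟨1, fun x => by simp⟩

/-- The kernels which are limits of sums of products `u ⊗ u`. -/
noncomputable def posKernels (G : Type*) [TopologicalSpace G] [CompactSpace G] :
    Subsemiring C(G × G, ℝ) := (squareKernels G).subsemiringClosure.topologicalClosure

theorem mem_posKernels_of_eq {κ : C(G × G, ℝ)} (u : C(G, ℝ)) (h : ∀ x, κ x = u x.1 * u x.2) :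
    κ ∈ posKernels G :=
  Subsemiring.le_topologicalClosure _ (AddSubmonoid.subset_closure ⟨u, h⟩)

theorem smul_mem_posKernels {κ : C(G × G, ℝ)} {r : ℝ} (hr : 0 ≤ r) (h : κ ∈ posKernels G) :
    r • κ ∈ posKernels G := by
  have h1 : (ContinuousMap.const _ r : C(G × G, ℝ)) ∈ posKernels G :=
    mem_posKernels_of_eq (ContinuousMap.const _ (√r)) fun x => (Real.mul_self_sqrt hr).symm
  have h2 : r • κ = ContinuousMap.const _ r * κ := by ext; simp
  rw [h2]
  exact mul_mem h1 h

theorem mem_posKernels_of_hasSum {f : ℕ → C(G × G, ℝ)} {κ : C(G × G, ℝ)} (h : HasSum f κ)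
    (hf : ∀ k, f k ∈ posKernels G) : κ ∈ posKernels G :=
  (Subsemiring.isClosed_topologicalClosure _).mem_of_tendsto h
    (Eventually.of_forall fun _ => sum_mem fun k _ => hf k)

/-- Kernels of positive type are closed under sums, products and uniform limits, and the exponential
series has nonnegative coefficients. -/
theorem exp_mem_posKernels {κ : C(G × G, ℝ)} (h : κ ∈ posKernels G) :
    NormedSpace.exp κ ∈ posKernels G :=
  mem_posKernels_of_hasSum (NormedSpace.exp_series_hasSum_exp' (𝕂 := ℝ) κ)
    fun k => smul_mem_posKernels (by positivity) (pow_mem h k)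

/-- Even powers cancel in $2\sinh\kappa$, and odd powers keep nonnegative coefficients. -/
theorem exp_sub_exp_neg_mem_posKernels {κ : C(G × G, ℝ)} (h : κ ∈ posKernels G) :
    NormedSpace.exp κ - NormedSpace.exp (-κ) ∈ posKernels G := by
  refine mem_posKernels_of_hasSum ((NormedSpace.exp_series_hasSum_exp' (𝕂 := ℝ) κ).sub
    (NormedSpace.exp_series_hasSum_exp' (𝕂 := ℝ) (-κ))) fun k => ?_
  rcases k.even_or_odd with hk | hk
  · rw [hk.neg_pow, sub_self]
    exact zero_mem _
  · rw [hk.neg_pow, smul_neg, sub_neg_eq_add]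
    have := smul_mem_posKernels (r := ((k.factorial : ℝ))⁻¹) (by positivity) (pow_mem h k)
    exact add_mem this this

theorem exp_apply_continuousMap {X : Type*} [TopologicalSpace X] [CompactSpace X] (κ : C(X, ℝ))
    (x : X) : NormedSpace.exp κ x = Real.exp (κ x) := by
  have h := NormedSpace.map_exp (ContinuousMap.evalAlgHom ℝ ℝ x).toRingHom
    (continuous_eval_const x) κ
  rw [Real.exp_eq_exp_ℝ]
  exact h

variable [MeasurableSpace G] [BorelSpace G] [SecondCountableTopology G]

theorem integrable_continuousMap {X E : Type*} [TopologicalSpace X] [CompactSpace X]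
    [MeasurableSpace X] [BorelSpace X] [NormedAddCommGroup E] [SecondCountableTopologyEither X E]
    (μ : Measure X) [IsFiniteMeasure μ] {f : X → E} (hf : Continuous f) : Integrable f μ := by
  obtain ⟨C, hC⟩ := (isCompact_range hf).isBounded.exists_norm_le
  exact Integrable.of_bound hf.aestronglyMeasurable C (ae_of_all _ fun x => hC _ ⟨x, rfl⟩)

theorem continuous_integral_continuousMap {X : Type*} [TopologicalSpace X] [CompactSpace X]
    [MeasurableSpace X] [BorelSpace X] (E : Type*) [NormedAddCommGroup E] [NormedSpace ℝ E]
    [SecondCountableTopologyEither X E] (μ : Measure X) [IsProbabilityMeasure μ] :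
    Continuous fun f : C(X, E) => ∫ x, f x ∂μ := by
  refine LipschitzWith.continuous (K := 1) (LipschitzWith.of_dist_le_mul fun f g => ?_)
  rw [dist_eq_norm, ← integral_sub (integrable_continuousMap μ f.continuous)
    (integrable_continuousMap μ g.continuous), NNReal.coe_one, one_mul]
  refine (norm_integral_le_of_norm_le_const (C := dist f g) (ae_of_all _ fun x => ?_)).trans ?_
  · rw [← dist_eq_norm]
    exact ContinuousMap.dist_apply_le_dist x
  · simp

/-- A generator $u\otimes u$ integrates to $(\int u)^2$; sums and limits preserve nonnegativity. -/
theorem integral_nonneg_of_mem_posKernels (μ : Measure G) [IsProbabilityMeasure μ]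
    {κ : C(G × G, ℝ)} (h : κ ∈ posKernels G) : 0 ≤ ∫ x, κ x ∂(μ.prod μ) := by
  have hcl : IsClosed {κ : C(G × G, ℝ) | 0 ≤ ∫ x, κ x ∂(μ.prod μ)} :=
    isClosed_le continuous_const (continuous_integral_continuousMap ℝ (μ.prod μ))
  refine closure_minimal ?_ hcl h
  intro κ hκ
  refine AddSubmonoid.closure_induction (motive := fun κ _ => 0 ≤ ∫ x, κ x ∂(μ.prod μ))
    ?_ ?_ ?_ hκ
  · rintro κ ⟨u, hu⟩
    simp only [hu, integral_prod_mul (μ := μ) (ν := μ) (fun x => u x) fun x => u x]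
    exact mul_self_nonneg _
  · simp
  · intro κ κ' _ _ h1 h2
    simp only [ContinuousMap.add_apply]
    rw [integral_add (integrable_continuousMap _ κ.continuous)
      (integrable_continuousMap _ κ'.continuous)]
    exact add_nonneg h1 h2

/-- Haar integrals are preserved by surjective homomorphisms. -/
theorem integral_comp_hom {G' : Type*} [Group G'] [TopologicalSpace G'] [IsTopologicalGroup G']
    [CompactSpace G'] [MeasurableSpace G'] [BorelSpace G'] (μ : Measure G) [μ.IsHaarMeasure]
    [IsProbabilityMeasure μ] (ν : Measure G') [ν.IsHaarMeasure] [IsProbabilityMeasure ν]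
    {E : Type*} [NormedAddCommGroup E] [NormedSpace ℝ E] [SecondCountableTopologyEither G' E]
    (φ : G →* G') (hφ : Continuous φ) (hs : Function.Surjective φ) {f : G' → E}
    (hf : Continuous f) : ∫ x, f (φ x) ∂μ = ∫ y, f y ∂ν := by
  have hp : MeasurePreserving φ μ ν := φ.measurePreserving hφ hs (by simp)
  rw [← hp.map_eq]
  exact (integral_map hφ.measurable.aemeasurable hf.aestronglyMeasurable).symm

/-- The rotation `(a, b) ↦ (a b, a / b)`. -/
def mulDivHom (G : Type*) [CommGroup G] : G × G →* G × G where
  toFun x := (x.1 * x.2, x.1 / x.2)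
  map_one' := by simp
  map_mul' x y := by
    ext
    · exact mul_mul_mul_comm _ _ _ _
    · exact mul_div_mul_comm _ _ _ _

theorem mulDivHom_surjective (hsq : ∀ g : G, ∃ s, s * s = g) :
    Function.Surjective (mulDivHom G) := by
  rintro ⟨x, y⟩
  obtain ⟨s, hs⟩ := hsq (x * y)
  refine ⟨(s, x / s), Prod.ext ?_ ?_⟩
  · simp [mulDivHom]
  · have : s / (x / s) = s * s / x := by rw [div_div_eq_mul_div]
    simp [mulDivHom, this, hs]

/-- A ferromagnetic energy: a combination of real parts of characters. -/
noncomputable def charEnergy {ι : Type*} (T : Finset ι) (c : ι → ℝ) (χ : ι → G →ₜ* Circle)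
    (g : G) : ℝ := ∑ i ∈ T, c i * (χ i g : ℂ).re

variable {ι : Type*} {c : ι → ℝ} {χ : ι → G →ₜ* Circle}

theorem continuous_charEnergy (T : Finset ι) : Continuous (charEnergy T c χ) :=
  continuous_finsetSum _ fun i _ => continuous_const.mul
    (Complex.continuous_re.comp (continuous_subtype_val.comp (χ i).continuous_toFun))

theorem continuous_re_char (χ : G →ₜ* Circle) : Continuous fun g => (χ g : ℂ).re :=
  Complex.continuous_re.comp (continuous_subtype_val.comp χ.continuous_toFun)

theorem continuous_im_char (χ : G →ₜ* Circle) : Continuous fun g => (χ g : ℂ).im :=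
  Complex.continuous_im.comp (continuous_subtype_val.comp χ.continuous_toFun)

theorem char_mul (χ : G →ₜ* Circle) (a b : G) : (χ (a * b) : ℂ).re =
    (χ a : ℂ).re * (χ b : ℂ).re - (χ a : ℂ).im * (χ b : ℂ).im := by
  rw [map_mul, Circle.coe_mul, Complex.mul_re]

theorem char_div (χ : G →ₜ* Circle) (a b : G) : (χ (a / b) : ℂ).re =
    (χ a : ℂ).re * (χ b : ℂ).re + (χ a : ℂ).im * (χ b : ℂ).im := by
  rw [map_div, div_eq_mul_inv, Circle.coe_mul, Circle.coe_inv_eq_conj, Complex.mul_re,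
    Complex.conj_re, Complex.conj_im]
  ring

/-- The kernel `∑ c_i f_i ⊗ f_i`. -/
noncomputable def sumKernel (T : Finset ι) (c : ι → ℝ) (f : ι → C(G, ℝ)) : C(G × G, ℝ) :=
  ∑ i ∈ T, c i • ((f i).comp ContinuousMap.fst * (f i).comp ContinuousMap.snd)

theorem sumKernel_mem (T : Finset ι) (hc : ∀ i, 0 ≤ c i) (f : ι → C(G, ℝ)) :
    sumKernel T c f ∈ posKernels G :=
  sum_mem fun i _ => smul_mem_posKernels (hc i) (mem_posKernels_of_eq (f i) fun _ => rfl)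

theorem sumKernel_apply (T : Finset ι) (f : ι → C(G, ℝ)) (x : G × G) :
    sumKernel T c f x = ∑ i ∈ T, c i * (f i x.1 * f i x.2) := by
  simp [sumKernel, ContinuousMap.sum_apply]

/-- Ginibre's inequality. -/
theorem ginibre (hsq : ∀ g : G, ∃ s, s * s = g) (μ : Measure G) [μ.IsHaarMeasure]
    [IsProbabilityMeasure μ] (hc : ∀ i, 0 ≤ c i) (T U : Finset ι) (ψ : G →ₜ* Circle) :
    (∫ g, (ψ g : ℂ).re * Real.exp (charEnergy T c χ g) ∂μ) *
        ∫ g, Real.exp (charEnergy T c χ g + charEnergy U c χ g) ∂μ ≤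
      (∫ g, (ψ g : ℂ).re * Real.exp (charEnergy T c χ g + charEnergy U c χ g) ∂μ) *
        ∫ g, Real.exp (charEnergy T c χ g) ∂μ := by
  set H := charEnergy T c χ
  set K := charEnergy U c χ
  set f : G → ℝ := fun g => (ψ g : ℂ).re
  have cH : Continuous H := continuous_charEnergy T
  have cK : Continuous K := continuous_charEnergy U
  have cf : Continuous f := continuous_re_char ψ
  let re : ι → C(G, ℝ) := fun i => ⟨_, continuous_re_char (χ i)⟩
  let im : ι → C(G, ℝ) := fun i => ⟨_, continuous_im_char (χ i)⟩
  set R := sumKernel U c re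
  set S := sumKernel U c im
  set R' := sumKernel T c re
  set S' := sumKernel T c im
  let t : C(G, ℝ) := ⟨_, continuous_im_char ψ⟩
  -- After rotating two copies, $\Phi$ becomes $2\kappa$: the difference of the two cosines is $-2$
  -- times a product of sines, the extra energies are $R\mp S$, and the common energy is $2R'$.
  let κ : C(G × G, ℝ) := t.comp ContinuousMap.fst * t.comp ContinuousMap.snd *
    NormedSpace.exp R * (NormedSpace.exp S - NormedSpace.exp (-S)) *
    (NormedSpace.exp R' * NormedSpace.exp R')
  have hκ : κ ∈ posKernels G :=
    mul_mem (mul_mem (mul_mem (mem_posKernels_of_eq t fun _ => rfl)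
      (exp_mem_posKernels (sumKernel_mem U hc re)))
      (exp_sub_exp_neg_mem_posKernels (sumKernel_mem U hc im)))
      (mul_mem (exp_mem_posKernels (sumKernel_mem T hc re))
        (exp_mem_posKernels (sumKernel_mem T hc re)))
  have emul : ∀ (V : Finset ι) (x : G × G), charEnergy V c χ (x.1 * x.2) =
      sumKernel V c re x - sumKernel V c im x := by
    intro V x
    rw [sumKernel_apply, sumKernel_apply, ← Finset.sum_sub_distrib, charEnergy]
    exact Finset.sum_congr rfl fun i _ => by rw [char_mul, mul_sub]; rfl
  have ediv : ∀ (V : Finset ι) (x : G × G), charEnergy V c χ (x.1 / x.2) =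
      sumKernel V c re x + sumKernel V c im x := by
    intro V x
    rw [sumKernel_apply, sumKernel_apply, ← Finset.sum_add_distrib, charEnergy]
    exact Finset.sum_congr rfl fun i _ => by rw [char_div, mul_add]; rfl
  -- For two independent copies, the integral of $\Phi$ is twice the difference of the two sides of
  -- the claim.
  set Φ : G × G → ℝ := fun y => (f y.1 - f y.2) * (Real.exp (K y.1) - Real.exp (K y.2)) *
    Real.exp (H y.1 + H y.2) with hΦ
  have cΦ : Continuous Φ := by fun_prop
  have key : ∀ x, Φ (mulDivHom G x) = 2 * κ x := by
    intro x
    change (f (x.1 * x.2) - f (x.1 / x.2)) * (Real.exp (K (x.1 * x.2)) - Real.exp (K (x.1 / x.2))) *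
      Real.exp (H (x.1 * x.2) + H (x.1 / x.2)) = 2 * (t x.1 * t x.2 * NormedSpace.exp R x *
        (NormedSpace.exp S x - NormedSpace.exp (-S) x) *
        (NormedSpace.exp R' x * NormedSpace.exp R' x))
    simp only [exp_apply_continuousMap, ContinuousMap.neg_apply]
    have k1 : K (x.1 * x.2) = R x - S x := emul U x
    have k2 : K (x.1 / x.2) = R x + S x := ediv U x
    have k3 : H (x.1 * x.2) = R' x - S' x := emul T x
    have k4 : H (x.1 / x.2) = R' x + S' x := ediv T x
    rw [k1, k2, k3, k4]
    have e1 : f (x.1 * x.2) - f (x.1 / x.2) = -2 * (t x.1 * t x.2) := by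
      change (ψ (x.1 * x.2) : ℂ).re - (ψ (x.1 / x.2) : ℂ).re =
        -2 * ((ψ x.1 : ℂ).im * (ψ x.2 : ℂ).im)
      rw [char_mul, char_div]; ring
    rw [e1, sub_eq_add_neg (R x), Real.exp_add, Real.exp_add (R x), ← Real.exp_add (R' x),
      show R' x - S' x + (R' x + S' x) = R' x + R' x by ring]
    ring
  have h1 : 0 ≤ ∫ y, Φ y ∂(μ.prod μ) := by
    rw [← integral_comp_hom (μ.prod μ) (μ.prod μ) (mulDivHom G)
      ((continuous_fst.mul continuous_snd).prodMk (continuous_fst.div' continuous_snd))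
      (mulDivHom_surjective hsq) cΦ]
    simp only [key]
    rw [integral_const_mul]
    exact mul_nonneg zero_le_two (integral_nonneg_of_mem_posKernels μ hκ)
  have h2 : ∫ y, Φ y ∂(μ.prod μ) =
      2 * ((∫ g, f g * Real.exp (H g + K g) ∂μ) * (∫ g, Real.exp (H g) ∂μ) -
      (∫ g, f g * Real.exp (H g) ∂μ) * ∫ g, Real.exp (H g + K g) ∂μ) := by
    have e : ∀ y : G × G, Φ y = f y.1 * Real.exp (H y.1 + K y.1) * Real.exp (H y.2) +
        Real.exp (H y.1) * (f y.2 * Real.exp (H y.2 + K y.2)) -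
        (f y.1 * Real.exp (H y.1) * Real.exp (H y.2 + K y.2) +
        Real.exp (H y.1 + K y.1) * (f y.2 * Real.exp (H y.2))) := by
      intro y
      simp only [hΦ, Real.exp_add]
      ring
    have i1 : ∀ {u : G × G → ℝ}, Continuous u → Integrable u (μ.prod μ) := fun hu =>
      integrable_continuousMap _ hu
    simp only [e]
    rw [integral_sub (i1 (by fun_prop)) (i1 (by fun_prop)), integral_add (i1 (by fun_prop))
      (i1 (by fun_prop)), integral_add (i1 (by fun_prop)) (i1 (by fun_prop)),
      integral_prod_mul (μ := μ) (ν := μ) (fun x => f x * Real.exp (H x + K x)) fun x =>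
        Real.exp (H x),
      integral_prod_mul (μ := μ) (ν := μ) (fun x => Real.exp (H x)) fun x =>
        f x * Real.exp (H x + K x),
      integral_prod_mul (μ := μ) (ν := μ) (fun x => f x * Real.exp (H x)) fun x =>
        Real.exp (H x + K x),
      integral_prod_mul (μ := μ) (ν := μ) (fun x => Real.exp (H x + K x)) fun x =>
        f x * Real.exp (H x)]
    ring
  rw [h2] at h1
  linarith

/-- A nontrivial character has integral zero. -/
theorem integral_char_eq_zero (μ : Measure G) [μ.IsHaarMeasure] (ψ : G →ₜ* Circle) {g₀ : G}
    (h : ψ g₀ ≠ 1) : ∫ g, (ψ g : ℂ) ∂μ = 0 := by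
  have h1 := integral_mul_left_eq_self (μ := μ) (fun g => (ψ g : ℂ)) g₀
  simp only [map_mul, Circle.coe_mul, integral_const_mul] at h1
  have h2 : ((ψ g₀ : ℂ) - 1) * ∫ g, (ψ g : ℂ) ∂μ = 0 := by rw [sub_mul, h1, one_mul, sub_self]
  refine (mul_eq_zero.1 h2).resolve_left fun h3 => h (Circle.ext ?_)
  rw [Circle.coe_one]
  exact sub_eq_zero.1 h3

end group

end XYHeight

/-! ### The XY model in infinite volume -/

namespace XYHeight

/-! ### The XY model on the group of all spin configurations -/

/-- The compact group of all spin configurations on `ℤ²`. -/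
abbrev Spins : Type := ℤ × ℤ → Circle

/-- The Haar probability measure on the spin configurations. -/
noncomputable def spinHaar : Measure Spins := Measure.haarMeasure ⊤

instance : spinHaar.IsHaarMeasure := by unfold spinHaar; infer_instance

instance : IsProbabilityMeasure spinHaar :=
  ⟨Measure.haarMeasure_self (K₀ := (⊤ : TopologicalSpace.PositiveCompacts Spins))⟩

instance (n : ℕ) : (spinMeasure n).IsHaarMeasure := by unfold spinMeasure; infer_instance

instance (n : ℕ) : IsProbabilityMeasure (spinMeasure n) := by
  have :
      IsProbabilityMeasure (Measure.haarMeasure (⊤ : TopologicalSpace.PositiveCompacts Circle)) :=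
    ⟨Measure.haarMeasure_self (K₀ := (⊤ : TopologicalSpace.PositiveCompacts Circle))⟩
  unfold spinMeasure
  infer_instance

theorem Spins.exists_sq (σ : Spins) : ∃ s : Spins, s * s = σ := by
  refine ⟨fun x => Circle.exp (Complex.arg (σ x) / 2), funext fun x => ?_⟩
  rw [Pi.mul_apply, ← Circle.exp_add, add_halves, Circle.exp_arg]

/-- The character `σ_x σ̄_y`. -/
noncomputable def pairChar (x y : ℤ × ℤ) : Spins →ₜ* Circle where
  toFun σ := σ x / σ y
  map_one' := by simp
  map_mul' a b := by simp [mul_div_mul_comm]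
  continuous_toFun := by fun_prop

theorem coe_pairChar (x y : ℤ × ℤ) (σ : Spins) :
    (pairChar x y σ : ℂ) = σ x * (starRingEnd ℂ) (σ y : ℂ) := by
  change ((σ x / σ y : Circle) : ℂ) = _
  rw [div_eq_mul_inv, Circle.coe_mul, Circle.coe_inv_eq_conj]

/-- The energy of the XY model with interactions along the pairs in `T`. -/
noncomputable def energy (β : ℝ) (T : Finset ((ℤ × ℤ) × (ℤ × ℤ))) (σ : Spins) : ℝ :=
  charEnergy T (fun _ => β / 2) (fun e => pairChar e.1 e.2) σ

theorem continuous_energy (β : ℝ) (T : Finset ((ℤ × ℤ) × (ℤ × ℤ))) : Continuous (energy β T) :=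
  continuous_charEnergy T

/-- The partition function. -/
noncomputable def partZ (β : ℝ) (T : Finset ((ℤ × ℤ) × (ℤ × ℤ))) : ℝ :=
  ∫ σ, Real.exp (energy β T σ) ∂spinHaar

/-- The Gibbs expectation with interactions along the pairs in `T`. -/
noncomputable def gibbs (β : ℝ) (T : Finset ((ℤ × ℤ) × (ℤ × ℤ))) (F : Spins → ℂ) : ℂ :=
  (∫ σ, F σ * (Real.exp (energy β T σ) : ℂ) ∂spinHaar) / (partZ β T : ℂ)

theorem partZ_pos (β : ℝ) (T : Finset ((ℤ × ℤ) × (ℤ × ℤ))) : 0 < partZ β T :=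
  integral_exp_pos (integrable_continuousMap _ (by have := continuous_energy β T; fun_prop))

theorem continuous_boltzmann (β : ℝ) (T : Finset ((ℤ × ℤ) × (ℤ × ℤ))) {F : Spins → ℂ}
    (hF : Continuous F) : Continuous fun σ => F σ * (Real.exp (energy β T σ) : ℂ) := by
  have := continuous_energy β T
  fun_prop

theorem integrable_boltzmann (β : ℝ) (T : Finset ((ℤ × ℤ) × (ℤ × ℤ))) {F : Spins → ℂ}
    (hF : Continuous F) : Integrable (fun σ => F σ * (Real.exp (energy β T σ) : ℂ)) spinHaar :=
  integrable_continuousMap _ (continuous_boltzmann β T hF)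

theorem gibbs_add (β : ℝ) (T : Finset ((ℤ × ℤ) × (ℤ × ℤ))) {F F' : Spins → ℂ} (hF : Continuous F)
    (hF' : Continuous F') : gibbs β T (fun σ => F σ + F' σ) = gibbs β T F + gibbs β T F' := by
  simp only [gibbs, add_mul]
  rw [integral_add (integrable_boltzmann β T hF) (integrable_boltzmann β T hF'), add_div]

theorem gibbs_const_mul (β : ℝ) (T : Finset ((ℤ × ℤ) × (ℤ × ℤ))) (c : ℂ) (F : Spins → ℂ) :
    gibbs β T (fun σ => c * F σ) = c * gibbs β T F := by
  simp only [gibbs, mul_assoc]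
  rw [integral_const_mul, mul_div_assoc]

theorem gibbs_const (β : ℝ) (T : Finset ((ℤ × ℤ) × (ℤ × ℤ))) (c : ℂ) :
    gibbs β T (fun _ => c) = c := by
  have h : (partZ β T : ℂ) ≠ 0 := by exact_mod_cast (partZ_pos β T).ne'
  rw [gibbs, integral_const_mul, integral_complex_ofReal]
  exact mul_div_cancel_right₀ _ h

theorem norm_gibbs_le (β : ℝ) (T : Finset ((ℤ × ℤ) × (ℤ × ℤ))) {F : Spins → ℂ} {C : ℝ}
    (hF : ∀ σ, ‖F σ‖ ≤ C) : ‖gibbs β T F‖ ≤ C := by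
  have hp := partZ_pos β T
  rw [gibbs, norm_div, Complex.norm_real, Real.norm_of_nonneg hp.le, div_le_iff₀ hp, partZ,
    ← integral_const_mul]
  have hc : Continuous fun σ => C * Real.exp (energy β T σ) := by
    have := continuous_energy β T
    fun_prop
  refine norm_integral_le_of_norm_le (integrable_continuousMap _ hc) (ae_of_all _ fun σ => ?_)
  rw [norm_mul, Complex.norm_real, Real.norm_of_nonneg (Real.exp_pos _).le]
  exact mul_le_mul_of_nonneg_right (hF σ) (Real.exp_pos _).le

theorem gibbs_sub_le (β : ℝ) (T : Finset ((ℤ × ℤ) × (ℤ × ℤ))) {F F' : Spins → ℂ}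
    (hF : Continuous F) (hF' : Continuous F') {C : ℝ} (h : ∀ σ, ‖F σ - F' σ‖ ≤ C) :
    ‖gibbs β T F - gibbs β T F'‖ ≤ C := by
  have h1 : gibbs β T F - gibbs β T F' = gibbs β T fun σ => F σ - F' σ := by
    simp only [gibbs, sub_mul]
    rw [integral_sub (integrable_boltzmann β T hF) (integrable_boltzmann β T hF'), sub_div]
  rw [h1]
  exact norm_gibbs_le β T h

theorem continuous_char (ψ : Spins →ₜ* Circle) : Continuous fun σ => (ψ σ : ℂ) := by fun_prop

theorem charEnergy_inv {G ι : Type*} [CommGroup G] [TopologicalSpace G] (T : Finset ι)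
    (c : ι → ℝ) (χ : ι → G →ₜ* Circle) (g : G) : charEnergy T c χ g⁻¹ = charEnergy T c χ g := by
  refine Finset.sum_congr rfl fun i _ => ?_
  rw [map_inv, Circle.coe_inv_eq_conj, Complex.conj_re]

theorem gibbs_inv (β : ℝ) (T : Finset ((ℤ × ℤ) × (ℤ × ℤ))) {F : Spins → ℂ} (hF : Continuous F) :
    gibbs β T (fun σ => F σ⁻¹) = gibbs β T F := by
  have h := integral_comp_hom spinHaar spinHaar (invMonoidHom : Spins →* Spins) continuous_inv
    inv_surjective (continuous_boltzmann β T hF)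
  unfold gibbs
  rw [← h]
  simp only [invMonoidHom_apply, energy, charEnergy_inv]

/-- The real Gibbs expectation of a character. -/
noncomputable def charMean (β : ℝ) (T : Finset ((ℤ × ℤ) × (ℤ × ℤ))) (ψ : Spins →ₜ* Circle) : ℝ :=
  (∫ σ, (ψ σ : ℂ).re * Real.exp (energy β T σ) ∂spinHaar) / partZ β T

/-- Inverting all spins preserves the Gibbs measure and conjugates characters, so their means are
real. -/
theorem gibbs_char (β : ℝ) (T : Finset ((ℤ × ℤ) × (ℤ × ℤ))) (ψ : Spins →ₜ* Circle) :
    gibbs β T (fun σ => (ψ σ : ℂ)) = charMean β T ψ := by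
  have hc := continuous_char ψ
  have h1 := gibbs_inv β T hc
  have h2 := gibbs_add β T hc (hc.comp continuous_inv)
  change gibbs β T (fun σ => (ψ σ : ℂ) + (ψ σ⁻¹ : ℂ)) = gibbs β T (fun σ => (ψ σ : ℂ)) +
    gibbs β T (fun σ => (ψ σ⁻¹ : ℂ)) at h2
  rw [h1] at h2
  have h3 : ∀ σ, (ψ σ : ℂ) + (ψ σ⁻¹ : ℂ) = 2 * (((ψ σ : ℂ).re : ℝ) : ℂ) := fun σ => by
    rw [map_inv, Circle.coe_inv_eq_conj, Complex.add_conj]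
    push_cast; ring
  simp only [h3] at h2
  rw [gibbs_const_mul] at h2
  have h4 : gibbs β T (fun σ => (((ψ σ : ℂ).re : ℝ) : ℂ)) = charMean β T ψ := by
    rw [gibbs, charMean, Complex.ofReal_div, ← integral_complex_ofReal]
    simp only [Complex.ofReal_mul]
  rw [h4] at h2
  linear_combination -h2 / 2

/-- Ginibre's inequality with the additional interactions as the second energy. -/
theorem charMean_mono {β : ℝ} (hβ : 0 ≤ β) {T T' : Finset ((ℤ × ℤ) × (ℤ × ℤ))} (h : T ⊆ T')
    (ψ : Spins →ₜ* Circle) : charMean β T ψ ≤ charMean β T' ψ := by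
  have h1 := ginibre Spins.exists_sq spinHaar (c := fun _ => β / 2)
    (χ := fun e : (ℤ × ℤ) × (ℤ × ℤ) => pairChar e.1 e.2) (fun _ => by positivity) T (T' \ T) ψ
  have h2 : ∀ σ, energy β T' σ = charEnergy T (fun _ => β / 2)
      (fun e : (ℤ × ℤ) × (ℤ × ℤ) => pairChar e.1 e.2) σ +
      charEnergy (T' \ T) (fun _ => β / 2) (fun e => pairChar e.1 e.2) σ := fun σ => by
    rw [add_comm]; exact (Finset.sum_sdiff h).symm
  simp only [← h2] at h1
  rw [charMean, charMean, div_le_div_iff₀ (partZ_pos β T) (partZ_pos β T')]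
  exact h1

theorem abs_charMean_le (β : ℝ) (T : Finset ((ℤ × ℤ) × (ℤ × ℤ))) (ψ : Spins →ₜ* Circle) :
    |charMean β T ψ| ≤ 1 := by
  have h := norm_gibbs_le β T (F := fun σ => (ψ σ : ℂ)) (C := 1) fun σ => (Circle.norm_coe _).le
  rwa [gibbs_char, Complex.norm_real, Real.norm_eq_abs] at h

/-! ### The infinite-volume limit -/

theorem dirEdges_mono : Monotone dirEdges := by
  intro m n h
  have h1 : box m ⊆ box n := fun x hx => by rw [mem_box] at *; omega
  exact Finset.filter_subset_filter _ (Finset.product_subset_product h1 h1)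

/-- Characters span a dense subspace of the continuous functions. -/
theorem submodule_eq_top {S : Submodule ℂ C(Spins, ℂ)} (hS : IsClosed (S : Set C(Spins, ℂ)))
    (h : ∀ ψ : Spins →ₜ* Circle, (⟨_, continuous_char ψ⟩ : C(Spins, ℂ)) ∈ S) : S = ⊤ := by
  let chars : Submonoid C(Spins, ℂ) :=
    { carrier := Set.range fun ψ : Spins →ₜ* Circle => ⟨_, continuous_char ψ⟩
      mul_mem' := by
        rintro _ _ ⟨ψ, rfl⟩ ⟨φ, rfl⟩
        exact ⟨ψ * φ, by ext; simp⟩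
      one_mem' := ⟨1, by ext; simp⟩ }
  have hstar : star (chars : Set C(Spins, ℂ)) ⊆ chars := by
    rintro F ⟨ψ, hψ⟩
    refine ⟨ψ⁻¹, ?_⟩
    rw [← star_star F, ← hψ]
    ext σ
    exact Circle.coe_inv_eq_conj (ψ σ)
  let A := StarAlgebra.adjoin ℂ (chars : Set C(Spins, ℂ))
  have hA : ∀ F ∈ A, F ∈ S := by
    intro F hF
    have h1 : F ∈ Algebra.adjoin ℂ
        ((chars : Set C(Spins, ℂ)) ∪ star (chars : Set C(Spins, ℂ))) := by
      rw [← StarAlgebra.adjoin_toSubalgebra]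
      exact hF
    rw [Set.union_eq_self_of_subset_right hstar, ← Subalgebra.mem_toSubmodule,
      Algebra.adjoin_eq_span, Submonoid.closure_eq] at h1
    refine Submodule.span_le.2 ?_ h1
    rintro _ ⟨ψ, rfl⟩
    exact h ψ
  have hsep : A.SeparatesPoints := by
    intro σ τ hne
    obtain ⟨x, hx⟩ := Function.ne_iff.1 hne
    let e : Spins →ₜ* Circle := ⟨Pi.evalMonoidHom _ x, continuous_apply x⟩
    refine ⟨fun σ => (e σ : ℂ), ⟨⟨_, continuous_char e⟩,
      StarAlgebra.subset_adjoin ℂ _ ⟨e, rfl⟩, rfl⟩, ?_⟩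
    exact fun h => hx (Circle.ext h)
  have hd := ContinuousMap.starSubalgebra_topologicalClosure_eq_top_of_separatesPoints A hsep
  refine top_unique fun F _ => ?_
  have h2 : F ∈ A.topologicalClosure := hd ▸ trivial
  exact closure_minimal hA hS h2

theorem exists_tendsto_charMean {β : ℝ} (hβ : 0 ≤ β) (ψ : Spins →ₜ* Circle) :
    ∃ L, Tendsto (fun n => charMean β (dirEdges n) ψ) atTop (𝓝 L) :=
  ⟨_, tendsto_atTop_ciSup (fun _ _ h => charMean_mono hβ (dirEdges_mono h) ψ)
    ⟨1, by rintro _ ⟨n, rfl⟩; exact (abs_le.1 (abs_charMean_le β _ ψ)).2⟩⟩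

/-- Means of characters are increasing in the volume and bounded. The observables with Cauchy
expectations form a closed subspace, and characters span a dense one by Stone–Weierstrass. -/
theorem cauchySeq_gibbs {β : ℝ} (hβ : 0 ≤ β) (F : C(Spins, ℂ)) :
    CauchySeq fun n => gibbs β (dirEdges n) F := by
  let S : Submodule ℂ C(Spins, ℂ) :=
    { carrier := {F | CauchySeq fun n => gibbs β (dirEdges n) F}
      add_mem' := fun {F F'} h h' => by
        have e : ∀ n, gibbs β (dirEdges n) (F + F' : C(Spins, ℂ)) =
            gibbs β (dirEdges n) F + gibbs β (dirEdges n) F' :=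
          fun n => gibbs_add β _ F.continuous F'.continuous
        change CauchySeq fun n => gibbs β (dirEdges n) (F + F' : C(Spins, ℂ))
        simp only [e]
        exact CauchySeq.add h h'
      zero_mem' := by
        have : ∀ n, gibbs β (dirEdges n) (0 : C(Spins, ℂ)) = 0 := fun n => gibbs_const β _ 0
        change CauchySeq fun n => gibbs β (dirEdges n) (0 : C(Spins, ℂ))
        simp only [this]
        exact cauchySeq_const 0
      smul_mem' := fun c F h => by
        have e : ∀ n, gibbs β (dirEdges n) (c • F : C(Spins, ℂ)) = c * gibbs β (dirEdges n) F :=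
          fun n => gibbs_const_mul β _ c F
        change CauchySeq fun n => gibbs β (dirEdges n) (c • F : C(Spins, ℂ))
        simp only [e]
        exact (uniformContinuous_const_smul c).comp_cauchySeq h }
  suffices h : S = ⊤ by
    have : F ∈ S := h ▸ trivial
    exact this
  refine submodule_eq_top ?_ fun ψ => ?_
  · refine isClosed_of_closure_subset fun F hF => ?_
    rw [Metric.mem_closure_iff] at hF
    refine Metric.cauchySeq_iff.2 fun ε hε => ?_
    obtain ⟨F', h1, h2⟩ := hF (ε / 3) (by positivity)
    obtain ⟨N, hN⟩ := Metric.cauchySeq_iff.1 h1 (ε / 3) (by positivity)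
    have h3 : ∀ n, dist (gibbs β (dirEdges n) F) (gibbs β (dirEdges n) F') ≤ dist F F' :=
        fun n => by
      rw [dist_eq_norm]
      exact gibbs_sub_le β _ F.continuous F'.continuous fun σ => by
        rw [← dist_eq_norm]; exact ContinuousMap.dist_apply_le_dist σ
    refine ⟨N, fun m hm n hn => ?_⟩
    have h4 := dist_triangle4 (gibbs β (dirEdges m) F) (gibbs β (dirEdges m) F')
      (gibbs β (dirEdges n) F') (gibbs β (dirEdges n) F)
    have h5 := hN m hm n hn
    have h6 := h3 n
    rw [dist_comm] at h6
    linarith [h3 m]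
  · obtain ⟨L, hL⟩ := exists_tendsto_charMean hβ ψ
    have h1 : Tendsto (fun n => ((charMean β (dirEdges n) ψ : ℝ) : ℂ)) atTop (𝓝 (L : ℂ)) :=
      (Complex.continuous_ofReal.tendsto L).comp hL
    have h2 := h1.cauchySeq
    simp only [← gibbs_char] at h2
    exact h2

/-- The infinite-volume expectation. -/
noncomputable def omega (β : ℝ) (F : Spins → ℂ) : ℂ :=
  lim (map (fun n => gibbs β (dirEdges n) F) atTop)

theorem tendsto_omega {β : ℝ} (hβ : 0 ≤ β) {F : Spins → ℂ} (hF : Continuous F) :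
    Tendsto (fun n => gibbs β (dirEdges n) F) atTop (𝓝 (omega β F)) :=
  (cauchySeq_tendsto_of_complete (cauchySeq_gibbs hβ ⟨F, hF⟩)).elim fun L hL =>
    tendsto_nhds_limUnder ⟨L, hL⟩

theorem omega_eq_of_tendsto {β : ℝ} {F : Spins → ℂ} {L : ℂ}
    (h : Tendsto (fun n => gibbs β (dirEdges n) F) atTop (𝓝 L)) :
    omega β F = L := h.limUnder_eq

theorem omega_add {β : ℝ} (hβ : 0 ≤ β) {F F' : Spins → ℂ} (hF : Continuous F)
    (hF' : Continuous F') : omega β (fun σ => F σ + F' σ) = omega β F + omega β F' :=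
  omega_eq_of_tendsto (((tendsto_omega hβ hF).add (tendsto_omega hβ hF')).congr fun _ =>
    (gibbs_add β _ hF hF').symm)

theorem omega_const_mul {β : ℝ} (hβ : 0 ≤ β) {F : Spins → ℂ} (hF : Continuous F) (c : ℂ) :
    omega β (fun σ => c * F σ) = c * omega β F :=
  omega_eq_of_tendsto (((tendsto_omega hβ hF).const_mul c).congr fun _ =>
    (gibbs_const_mul β _ c F).symm)

theorem omega_const (β : ℝ) (c : ℂ) : omega β (fun _ => c) = c :=
  omega_eq_of_tendsto (by simp only [gibbs_const]; exact tendsto_const_nhds)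

theorem norm_omega_le {β : ℝ} (hβ : 0 ≤ β) {F : Spins → ℂ} (hF : Continuous F) {C : ℝ}
    (h : ∀ σ, ‖F σ‖ ≤ C) : ‖omega β F‖ ≤ C :=
  le_of_tendsto (tendsto_omega hβ hF).norm (Eventually.of_forall fun _ => norm_gibbs_le β _ h)

theorem omega_sub_le {β : ℝ} (hβ : 0 ≤ β) {F G : Spins → ℂ} (hF : Continuous F)
    (hG : Continuous G) {C : ℝ} (h : ∀ σ, ‖F σ - G σ‖ ≤ C) : ‖omega β F - omega β G‖ ≤ C :=
  le_of_tendsto ((tendsto_omega hβ hF).sub (tendsto_omega hβ hG)).norm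
    (Eventually.of_forall fun _ => gibbs_sub_le β _ hF hG h)

/-! ### Symmetries -/

/-- The pullback of spins under a permutation of the lattice. -/
def pullHom (π : Equiv.Perm (ℤ × ℤ)) : Spins →ₜ* Spins where
  toFun σ := σ ∘ π
  map_one' := rfl
  map_mul' _ _ := rfl
  continuous_toFun := by fun_prop

/-- The action of a permutation of the lattice on pairs. -/
def mapPairs (π : Equiv.Perm (ℤ × ℤ)) (T : Finset ((ℤ × ℤ) × (ℤ × ℤ))) :
    Finset ((ℤ × ℤ) × (ℤ × ℤ)) := T.map (π.prodCongr π).toEmbedding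

theorem energy_comp (β : ℝ) (T : Finset ((ℤ × ℤ) × (ℤ × ℤ))) (π : Equiv.Perm (ℤ × ℤ))
    (σ : Spins) : energy β T (σ ∘ π) = energy β (mapPairs π T) σ := by
  simp only [energy, charEnergy, mapPairs, Finset.sum_map]
  rfl

theorem pullHom_surjective (π : Equiv.Perm (ℤ × ℤ)) : Function.Surjective (pullHom π) := fun σ =>
  ⟨σ ∘ π.symm, funext fun x => congrArg σ (π.symm_apply_apply x)⟩

theorem partZ_mapPairs (β : ℝ) (T : Finset ((ℤ × ℤ) × (ℤ × ℤ))) (π : Equiv.Perm (ℤ × ℤ)) :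
    partZ β (mapPairs π T) = partZ β T := by
  have hc : Continuous fun σ => Real.exp (energy β T σ) := by
    have := continuous_energy β T
    fun_prop
  have h := integral_comp_hom spinHaar spinHaar (pullHom π).toMonoidHom (pullHom π).continuous_toFun
    (pullHom_surjective π) hc
  rw [partZ, partZ, ← h]
  simp only [← energy_comp]
  rfl

theorem gibbs_comp (β : ℝ) (T : Finset ((ℤ × ℤ) × (ℤ × ℤ))) (π : Equiv.Perm (ℤ × ℤ))
    {F : Spins → ℂ} (hF : Continuous F) :
    gibbs β (mapPairs π T) (fun σ => F (σ ∘ π)) = gibbs β T F := by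
  have h := integral_comp_hom spinHaar spinHaar (pullHom π).toMonoidHom (pullHom π).continuous_toFun
    (pullHom_surjective π) (continuous_boltzmann β T hF)
  rw [gibbs, gibbs, partZ_mapPairs, ← h]
  simp only [← energy_comp]
  rfl

theorem pairwise_adj_iff (v x y : ℤ × ℤ) : Adj (x + v) (y + v) ↔ Adj x y := by
  simp [Adj]

theorem mapPairs_addRight_subset (v : ℤ × ℤ) (n : ℕ) : mapPairs (Equiv.addRight v) (dirEdges n) ⊆
    dirEdges (n + (v.1.natAbs + v.2.natAbs)) := by
  intro e he
  obtain ⟨⟨x, y⟩, h, rfl⟩ := Finset.mem_map.1 he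
  have h1 := Finset.mem_filter.1 h
  have h2 := Finset.mem_product.1 h1.1
  have h3 : ∀ x : ℤ × ℤ, x ∈ box n → x + v ∈ box (n + (v.1.natAbs + v.2.natAbs)) := by
    intro x hx
    rw [mem_box] at *
    simp only [Prod.fst_add, Prod.snd_add, Nat.cast_add, Int.natCast_natAbs]
    have := abs_le.1 (le_refl |v.1|)
    have := abs_le.1 (le_refl |v.2|)
    omega
  exact Finset.mem_filter.2 ⟨Finset.mem_product.2 ⟨h3 _ h2.1, h3 _ h2.2⟩,
    (pairwise_adj_iff v x y).2 h1.2⟩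

/-- The invariance to be shown is a closed linear condition on `F`, so it suffices to verify it on
characters. -/
theorem submodule_eq_top_of_forall_omega {β : ℝ} (hβ : 0 ≤ β) (π : Equiv.Perm (ℤ × ℤ))
    (h : ∀ ψ : Spins →ₜ* Circle, omega β (fun σ => (ψ (σ ∘ π) : ℂ)) = omega β fun σ => (ψ σ : ℂ))
    {F : Spins → ℂ} (hF : Continuous F) : omega β (fun σ => F (σ ∘ π)) = omega β F := by
  have hπ : Continuous fun σ : Spins => σ ∘ π := (pullHom π).continuous_toFun
  let S : Submodule ℂ C(Spins, ℂ) :=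
    { carrier := {F | omega β (fun σ => F (σ ∘ π)) = omega β F}
      add_mem' := fun {F F'} h h' => by
        have e1 := omega_add hβ F.continuous F'.continuous
        have e2 := omega_add hβ (F.continuous.comp hπ) (F'.continuous.comp hπ)
        exact e2.trans ((congrArg₂ _ h h').trans e1.symm)
      zero_mem' := rfl
      smul_mem' := fun c F h => by
        have e1 := omega_const_mul hβ F.continuous c
        have e2 := omega_const_mul hβ (F.continuous.comp hπ) c
        exact e2.trans ((congrArg _ h).trans e1.symm) }
  suffices h : S = ⊤ by
    have : (⟨F, hF⟩ : C(Spins, ℂ)) ∈ S := h ▸ trivial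
    exact this
  have hlip : ∀ g : Spins → Spins, Continuous g →
      Continuous fun F : C(Spins, ℂ) => omega β fun σ => F (g σ) := by
    intro g hg
    refine LipschitzWith.continuous (K := 1) (LipschitzWith.of_dist_le_mul fun F F' => ?_)
    rw [NNReal.coe_one, one_mul, dist_eq_norm]
    exact omega_sub_le hβ (F.continuous.comp hg) (F'.continuous.comp hg) fun σ => by
      rw [← dist_eq_norm]; exact ContinuousMap.dist_apply_le_dist _
  exact submodule_eq_top (isClosed_eq (hlip _ hπ) (hlip id continuous_id)) h

theorem omega_char (β : ℝ) (hβ : 0 ≤ β) (ψ : Spins →ₜ* Circle) :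
    Tendsto (fun n => charMean β (dirEdges n) ψ) atTop (𝓝 (omega β fun σ => (ψ σ : ℂ)).re) ∧
    (omega β fun σ => (ψ σ : ℂ)).im = 0 := by
  obtain ⟨L, hL⟩ := exists_tendsto_charMean hβ ψ
  have h1 : Tendsto (fun n => ((charMean β (dirEdges n) ψ : ℝ) : ℂ)) atTop (𝓝 (L : ℂ)) :=
    (Complex.continuous_ofReal.tendsto L).comp hL
  simp only [← gibbs_char] at h1
  rw [omega_eq_of_tendsto h1]
  exact ⟨hL, Complex.ofReal_im L⟩

/-- Translation invariance in infinite volume. -/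
theorem omega_translate {β : ℝ} (hβ : 0 ≤ β) (v : ℤ × ℤ) {F : Spins → ℂ} (hF : Continuous F) :
    omega β (fun σ => F (σ ∘ (Equiv.addRight v : Equiv.Perm (ℤ × ℤ)))) = omega β F := by
  -- A translated box lies in a larger centred box, so monotonicity in the volume gives one
  -- inequality; the opposite translation gives the other.
  have key : ∀ (v : ℤ × ℤ) (ψ : Spins →ₜ* Circle),
      (omega β fun σ => (ψ σ : ℂ)).re ≤
      (omega β fun σ => (ψ (σ ∘ (Equiv.addRight v : Equiv.Perm (ℤ × ℤ))) : ℂ)).re := by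
    intro v ψ
    set π : Equiv.Perm (ℤ × ℤ) := Equiv.addRight v
    let ψ' : Spins →ₜ* Circle := ψ.comp (pullHom π)
    have h1 := (omega_char β hβ ψ).1
    have h2 := ((omega_char β hβ ψ').1).comp (tendsto_add_atTop_nat (v.1.natAbs + v.2.natAbs))
    refine le_of_tendsto_of_tendsto' h1 h2 fun n => ?_
    have h3 := gibbs_comp β (dirEdges n) π (continuous_char ψ)
    have h4 := gibbs_char β (mapPairs π (dirEdges n)) ψ'
    have h5 : charMean β (dirEdges n) ψ = charMean β (mapPairs π (dirEdges n)) ψ' := by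
      have := h4.symm.trans (h3.trans (gibbs_char β _ ψ))
      exact_mod_cast this.symm
    rw [h5]
    exact charMean_mono hβ (mapPairs_addRight_subset v n) ψ'
  refine submodule_eq_top_of_forall_omega hβ _ (fun ψ => ?_) hF
  set π : Equiv.Perm (ℤ × ℤ) := Equiv.addRight v
  have h1 := key v ψ
  have h2 := key (-v) (ψ.comp (pullHom π))
  have h3 : ∀ σ : Spins,
      (ψ.comp (pullHom π)) (σ ∘ (Equiv.addRight (-v) : Equiv.Perm (ℤ × ℤ))) = ψ σ := by
    intro σ
    change ψ ((σ ∘ (Equiv.addRight (-v) : Equiv.Perm (ℤ × ℤ))) ∘ π) = ψ σ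
    congr 1
    funext x
    simp [π]
  simp only [h3] at h2
  refine Complex.ext (le_antisymm h2 h1) ?_
  rw [(omega_char β hβ ψ).2]
  exact (omega_char β hβ (ψ.comp (pullHom π))).2

/-- Symmetries of the boxes are symmetries of the infinite-volume expectation. -/
theorem omega_comp_of_mapPairs {β : ℝ} (hβ : 0 ≤ β) (π : Equiv.Perm (ℤ × ℤ))
    (hπ : ∀ n, mapPairs π (dirEdges n) = dirEdges n) {F : Spins → ℂ} (hF : Continuous F) :
    omega β (fun σ => F (σ ∘ π)) = omega β F := by
  refine omega_eq_of_tendsto ((tendsto_omega hβ hF).congr fun n => ?_)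
  rw [← gibbs_comp β (dirEdges n) π hF, hπ]

/-! ### The two-point function -/

/-- The restriction of spins to a box. -/
def restrictHom (n : ℕ) : Spins →* (box n → Circle) where
  toFun σ x := σ x
  map_one' := rfl
  map_mul' _ _ := rfl

theorem restrictHom_surjective (n : ℕ) : Function.Surjective (restrictHom n) := fun τ => by
  classical
  exact ⟨fun x => if h : x ∈ box n then τ ⟨x, h⟩ else 1, by funext x; simp [restrictHom]⟩

theorem spin_restrict {n : ℕ} (σ : Spins) {x : ℤ × ℤ} (hx : x ∈ box n) :
    spin (restrictHom n σ) x = σ x := by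
  simp [spin, hx, restrictHom]

theorem xyWeight_restrict (β : ℝ) (n : ℕ) (σ : Spins) :
    xyWeight β (restrictHom n σ) = Real.exp (energy β (dirEdges n) σ) := by
  rw [xyWeight]
  congr 1
  refine Finset.sum_congr rfl fun e he => ?_
  have h := Finset.mem_product.1 (Finset.mem_filter.1 he).1
  rw [spin_restrict σ h.1, spin_restrict σ h.2, coe_pairChar]

theorem continuous_spin {n : ℕ} (x : ℤ × ℤ) : Continuous fun σ : box n → Circle => spin σ x := by
  unfold spin
  split <;> fun_prop

theorem continuous_xyWeight (n : ℕ) (β : ℝ) :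
    Continuous fun σ : box n → Circle => xyWeight β σ := by
  unfold xyWeight
  refine Real.continuous_exp.comp (continuous_finsetSum _ fun e _ => continuous_const.mul ?_)
  exact Complex.continuous_re.comp ((continuous_spin _).mul
    (Complex.continuous_conj.comp (continuous_spin _)))

/-- Restriction to the box is a surjective homomorphism of compact groups, hence preserves Haar
measure. All volumes can thus live on one spin space. -/
theorem xyTwoPointBox_eq (n : ℕ) (β : ℝ) {x y : ℤ × ℤ} (hx : x ∈ box n) (hy : y ∈ box n) :
    xyTwoPointBox n β x y = charMean β (dirEdges n) (pairChar x y) := by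
  have hr : Continuous (restrictHom n) := continuous_pi fun x => continuous_apply x.1
  have h1 := integral_comp_hom spinHaar (spinMeasure n) (restrictHom n) hr
    (restrictHom_surjective n) (continuous_xyWeight n β)
  have h2 := integral_comp_hom spinHaar (spinMeasure n) (restrictHom n) hr
    (restrictHom_surjective n) (f := fun σ => (spin σ x * (starRingEnd ℂ) (spin σ y)) *
      (xyWeight β σ : ℂ)) (((continuous_spin x).mul (Complex.continuous_conj.comp
        (continuous_spin y))).mul (Complex.continuous_ofReal.comp (continuous_xyWeight n β)))
  simp only [xyWeight_restrict, spin_restrict _ hx, spin_restrict _ hy, ← coe_pairChar] at h1 h2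
  have h3 := gibbs_char β (dirEdges n) (pairChar x y)
  rw [xyTwoPointBox, xyExpect, xyPartition, ← h1, ← h2]
  rw [gibbs, partZ] at h3
  rw [h3, Complex.ofReal_re]

theorem xyTwoPoint_eq {β : ℝ} (hβ : 0 ≤ β) (x y : ℤ × ℤ) :
    xyTwoPoint β x y = (omega β fun σ => (pairChar x y σ : ℂ)).re := by
  refine Tendsto.limsup_eq (((omega_char β hβ (pairChar x y)).1).congr' ?_)
  filter_upwards [eventually_ge_atTop (x.1.natAbs + x.2.natAbs + (y.1.natAbs + y.2.natAbs))]
    with n hn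
  refine (xyTwoPointBox_eq n β ?_ ?_).symm <;> rw [mem_box] <;> omega

end XYHeight

/-! ### Reflection positivity through lines of vertices -/

namespace XYHeight

/-! ### Reflection positivity -/

/-- Reflections of the lattice through lines of vertices; `S` is a closed half-plane. -/
structure IsReflection (ρ : Equiv.Perm (ℤ × ℤ)) (S : Set (ℤ × ℤ)) : Prop where
  invol : ∀ x, ρ (ρ x) = x
  cover : ∀ x, x ∈ S ∨ ρ x ∈ S
  fixed : ∀ x, x ∈ S → ρ x ∈ S → ρ x = x
  adj : ∀ x y, Adj x y → (x ∈ S ∧ y ∈ S) ∨ (ρ x ∈ S ∧ ρ y ∈ S)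
  box : ∀ n, mapPairs ρ (dirEdges n) = dirEdges n

section reflection

variable {ρ : Equiv.Perm (ℤ × ℤ)} {S : Set (ℤ × ℤ)}

open scoped Classical in
/-- Spins on the reflection line, on the half-plane, and on the reflected half-plane. -/
noncomputable def unfoldHom (ρ : Equiv.Perm (ℤ × ℤ)) (S : Set (ℤ × ℤ)) :
    Spins × (Spins × Spins) →* Spins where
  toFun p x := if ρ x = x then p.1 x else if x ∈ S then p.2.1 x else p.2.2 (ρ x)
  map_one' := by funext x; simp
  map_mul' p q := by funext x; simp only [Pi.mul_apply]; split_ifs <;> rfl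

theorem continuous_unfoldHom (ρ : Equiv.Perm (ℤ × ℤ)) (S : Set (ℤ × ℤ)) :
    Continuous (unfoldHom ρ S) := by
  classical
  refine continuous_pi fun x => ?_
  change Continuous fun p : Spins × (Spins × Spins) =>
    if ρ x = x then p.1 x else if x ∈ S then p.2.1 x else p.2.2 (ρ x)
  split_ifs <;> fun_prop

theorem IsReflection.unfoldHom_surjective (h : IsReflection ρ S) :
    Function.Surjective (unfoldHom ρ S) := fun σ => by
  classical
  refine ⟨(σ, σ, σ ∘ ρ), funext fun x => ?_⟩
  change (if ρ x = x then σ x else if x ∈ S then σ x else σ (ρ (ρ x))) = σ x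
  rw [h.invol]
  simp

open scoped Classical in
/-- Spins from `s` on the reflection line and from `t` elsewhere. -/
noncomputable def mixSpins (ρ : Equiv.Perm (ℤ × ℤ)) (s t : Spins) : Spins := fun x =>
  if ρ x = x then s x else t x

/-- Given the spins on the reflection line, the two half-planes carry independent copies, so the
integral equals $\int ds\,|\int dt\,A(s,t)|^2$. -/
theorem IsReflection.integral_mul_conj (h : IsReflection ρ S) {A : Spins → ℂ} (hA : Continuous A)
    (hS : DependsOn A S) :
    ∃ r : ℝ, 0 ≤ r ∧ ∫ σ, A σ * (starRingEnd ℂ) (A (σ ∘ ρ)) ∂spinHaar = (r : ℂ) := by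
  classical
  have hmix : Continuous fun p : Spins × Spins => mixSpins ρ p.1 p.2 := by
    refine continuous_pi fun x => ?_
    unfold mixSpins
    split_ifs <;> fun_prop
  have hf : Continuous fun p : Spins × Spins => A (mixSpins ρ p.1 p.2) := hA.comp hmix
  have e1 : ∀ s t u, A (unfoldHom ρ S (s, t, u)) = A (mixSpins ρ s t) := fun s t u =>
    hS fun x hx => by
      change (if ρ x = x then s x else if x ∈ S then t x else u (ρ x)) =
        if ρ x = x then s x else t x
      simp [hx]
  have e2 : ∀ s t u, A (unfoldHom ρ S (s, t, u) ∘ ρ) = A (mixSpins ρ s u) := fun s t u =>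
    hS fun x hx => by
      change (if ρ (ρ x) = ρ x then s (ρ x) else if ρ x ∈ S then t (ρ x) else u (ρ (ρ x))) =
        if ρ x = x then s x else u x
      rw [h.invol]
      by_cases hx' : ρ x = x
      · simp [hx']
      · have : ρ x ∉ S := fun h' => hx' (h.fixed x hx h')
        rw [if_neg (Ne.symm hx'), if_neg this, if_neg hx']
  have hB : Continuous fun σ : Spins => A σ * (starRingEnd ℂ) (A (σ ∘ ρ)) :=
    hA.mul (Complex.continuous_conj.comp (hA.comp (pullHom ρ).continuous_toFun))
  have : (spinHaar.prod (spinHaar.prod spinHaar)).IsHaarMeasure :=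
    Measure.prod.instIsHaarMeasure _ _
  have h1 := integral_comp_hom (spinHaar.prod (spinHaar.prod spinHaar)) spinHaar (unfoldHom ρ S)
    (continuous_unfoldHom ρ S) h.unfoldHom_surjective hB
  have h2 : ∀ p : Spins × (Spins × Spins), A (unfoldHom ρ S p) *
      (starRingEnd ℂ) (A (unfoldHom ρ S p ∘ ρ)) =
      A (mixSpins ρ p.1 p.2.1) * (starRingEnd ℂ) (A (mixSpins ρ p.1 p.2.2)) := fun p => by
    rw [← e1 p.1 p.2.1 p.2.2, ← e2 p.1 p.2.1 p.2.2]
  simp only [h2] at h1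
  have hc : Continuous fun p : Spins × (Spins × Spins) =>
      A (mixSpins ρ p.1 p.2.1) * (starRingEnd ℂ) (A (mixSpins ρ p.1 p.2.2)) :=
    (hf.comp (continuous_fst.prodMk (continuous_fst.comp continuous_snd))).mul
      (Complex.continuous_conj.comp
        (hf.comp (continuous_fst.prodMk (continuous_snd.comp continuous_snd))))
  rw [integral_prod _ (integrable_continuousMap _ hc)] at h1
  refine ⟨∫ s, ‖∫ t, A (mixSpins ρ s t) ∂spinHaar‖ ^ 2 ∂spinHaar,
    integral_nonneg fun s => by positivity, ?_⟩
  rw [← h1, ← integral_complex_ofReal]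
  refine integral_congr_ae (ae_of_all _ fun s => ?_)
  dsimp only
  rw [integral_prod_mul (μ := spinHaar) (ν := spinHaar) (fun t => A (mixSpins ρ s t))
    fun u => (starRingEnd ℂ) (A (mixSpins ρ s u)), integral_conj, Complex.mul_conj,
    Complex.normSq_eq_norm_sq]

open scoped Classical in
/-- The spins in the half-plane and their mirror images. -/
noncomputable def foldSpins (ρ : Equiv.Perm (ℤ × ℤ)) (S : Set (ℤ × ℤ)) (σ : Spins) : Spins :=
  fun x => if x ∈ S then σ x else σ (ρ x)

theorem continuous_foldSpins (ρ : Equiv.Perm (ℤ × ℤ)) (S : Set (ℤ × ℤ)) :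
    Continuous (foldSpins ρ S) := by
  refine continuous_pi fun x => ?_
  unfold foldSpins
  split_ifs <;> fun_prop

theorem IsReflection.foldSpins_of_mem (h : IsReflection ρ S) (σ : Spins) {x : ℤ × ℤ}
    (hx : ρ x ∈ S) : foldSpins ρ S σ x = σ (ρ x) := by
  unfold foldSpins
  split_ifs with h1
  · rw [h.fixed x h1 hx]
  · rfl

/-- No edge crosses the line, so on each edge the two folded configurations are `σ` and its mirror
image, in some order; both have the same total energy. -/
theorem IsReflection.energy_fold (h : IsReflection ρ S) (β : ℝ) (n : ℕ) (σ : Spins) :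
    energy β (dirEdges n) (foldSpins ρ S σ) + energy β (dirEdges n) (foldSpins ρ S (σ ∘ ρ)) =
      2 * energy β (dirEdges n) σ := by
  have h1 : energy β (dirEdges n) (σ ∘ ρ) = energy β (dirEdges n) σ := by
    rw [energy_comp, h.box]
  have h2 : 2 * energy β (dirEdges n) σ =
      energy β (dirEdges n) σ + energy β (dirEdges n) (σ ∘ ρ) := by rw [h1]; ring
  rw [h2]
  simp only [energy, charEnergy, ← Finset.sum_add_distrib]
  refine Finset.sum_congr rfl fun e he => ?_
  have hadj := h.adj e.1 e.2 (Finset.mem_filter.1 he).2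
  simp only [coe_pairChar]
  rcases hadj with ⟨ha, hb⟩ | ⟨ha, hb⟩
  · simp [foldSpins, ha, hb]
  · rw [h.foldSpins_of_mem _ ha, h.foldSpins_of_mem _ hb, h.foldSpins_of_mem _ ha,
      h.foldSpins_of_mem _ hb]
    simp only [Function.comp_apply, h.invol]
    ring

/-- The Boltzmann weight is $w(\sigma)\,w(\sigma\circ\rho)$ with $w$ depending on the half-plane
only, so it can be absorbed into $A$. -/
theorem IsReflection.gibbs_mul_conj (h : IsReflection ρ S) (β : ℝ) (n : ℕ) {A : Spins → ℂ}
    (hA : Continuous A) (hS : DependsOn A S) :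
    ∃ r : ℝ, 0 ≤ r ∧
      gibbs β (dirEdges n) (fun σ => A σ * (starRingEnd ℂ) (A (σ ∘ ρ))) = (r : ℂ) := by
  set w : Spins → ℝ := fun σ => Real.exp (energy β (dirEdges n) (foldSpins ρ S σ) / 2) with hw
  have cw : Continuous w := by
    have := (continuous_energy β (dirEdges n)).comp (continuous_foldSpins ρ S)
    exact Real.continuous_exp.comp (this.div_const 2)
  have hww : ∀ σ, Real.exp (energy β (dirEdges n) σ) = w σ * w (σ ∘ ρ) := by
    intro σ
    rw [hw]
    dsimp only
    rw [← Real.exp_add]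
    congr 1
    linarith [h.energy_fold β n σ]
  have hAw : Continuous fun σ => A σ * (w σ : ℂ) := by fun_prop
  have hSw : DependsOn (fun σ => A σ * (w σ : ℂ)) S := by
    intro σ τ hστ
    have h1 : foldSpins ρ S σ = foldSpins ρ S τ := by
      funext x
      unfold foldSpins
      split_ifs with hx
      · exact hστ x hx
      · exact hστ _ ((h.cover x).resolve_left hx)
    simp only [hS hστ, hw, h1]
  obtain ⟨r, hr, he⟩ := h.integral_mul_conj hAw hSw
  refine ⟨r / partZ β (dirEdges n), div_nonneg hr (partZ_pos _ _).le, ?_⟩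
  rw [gibbs, Complex.ofReal_div, ← he]
  congr 1
  refine integral_congr_ae (ae_of_all _ fun σ => ?_)
  simp only [hww, map_mul, Complex.conj_ofReal, Complex.ofReal_mul]
  ring

/-- The reflected inner product. -/
noncomputable def reflForm (β : ℝ) (ρ : Equiv.Perm (ℤ × ℤ)) (A B : Spins → ℂ) : ℂ :=
  omega β fun σ => A σ * (starRingEnd ℂ) (B (σ ∘ ρ))

theorem IsReflection.reflForm_self (h : IsReflection ρ S) {β : ℝ} (hβ : 0 ≤ β) {A : Spins → ℂ}
    (hA : Continuous A) (hS : DependsOn A S) :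
    0 ≤ (reflForm β ρ A A).re ∧ (reflForm β ρ A A).im = 0 := by
  have hB : Continuous fun σ : Spins => A σ * (starRingEnd ℂ) (A (σ ∘ ρ)) :=
    hA.mul (Complex.continuous_conj.comp (hA.comp (pullHom ρ).continuous_toFun))
  have ht := tendsto_omega hβ hB
  constructor
  · refine ge_of_tendsto ((Complex.continuous_re.tendsto _).comp ht)
      (Eventually.of_forall fun n => ?_)
    obtain ⟨r, hr, he⟩ := h.gibbs_mul_conj β n hA hS
    rw [Function.comp_apply, he, Complex.ofReal_re]
    exact hr
  · refine tendsto_nhds_unique ((Complex.continuous_im.tendsto _).comp ht)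
      (tendsto_const_nhds.congr fun n => ?_)
    obtain ⟨r, hr, he⟩ := h.gibbs_mul_conj β n hA hS
    rw [Function.comp_apply, he, Complex.ofReal_im]

theorem reflForm_add_smul {β : ℝ} (hβ : 0 ≤ β) (ρ : Equiv.Perm (ℤ × ℤ)) {A B : Spins → ℂ}
    (hA : Continuous A) (hB : Continuous B) (c : ℂ) :
    reflForm β ρ (fun σ => A σ + c * B σ) (fun σ => A σ + c * B σ) =
      reflForm β ρ A A + (starRingEnd ℂ) c * reflForm β ρ A B +
      (c * reflForm β ρ B A + c * (starRingEnd ℂ) c * reflForm β ρ B B) := by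
  have hc : ∀ {A B : Spins → ℂ}, Continuous A → Continuous B →
      Continuous fun σ : Spins => A σ * (starRingEnd ℂ) (B (σ ∘ ρ)) := fun hA hB =>
    hA.mul (Complex.continuous_conj.comp (hB.comp (pullHom ρ).continuous_toFun))
  have h1 := hc hA hA
  have h2 := hc hA hB
  have h3 := hc hB hA
  have h4 := hc hB hB
  unfold reflForm
  have hm : ∀ (d : ℂ) {f : Spins → ℂ}, Continuous f → Continuous fun σ => d * f σ :=
    fun d _ hf => continuous_const.mul hf
  have ha : ∀ {f g : Spins → ℂ}, Continuous f → Continuous g → Continuous fun σ => f σ + g σ :=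
    fun hf hg => hf.add hg
  have e2 := hm ((starRingEnd ℂ) c) h2
  have e3 := hm c h3
  have e4 := hm (c * (starRingEnd ℂ) c) h4
  have e12 := ha h1 e2
  have e34 := ha e3 e4
  rw [← omega_const_mul hβ h2, ← omega_const_mul hβ h3, ← omega_const_mul hβ h4,
    ← omega_add hβ h1 e2, ← omega_add hβ e3 e4]
  refine Eq.trans ?_ (omega_add hβ e12 e34)
  congr 1
  funext σ
  simp only [map_add, map_mul]
  ring

/-- The Cauchy–Schwarz inequality for the reflected inner product. -/
theorem IsReflection.cauchy_schwarz (h : IsReflection ρ S) {β : ℝ} (hβ : 0 ≤ β) {A B : Spins → ℂ}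
    (hA : Continuous A) (hB : Continuous B) (hAS : DependsOn A S) (hBS : DependsOn B S) :
    ‖reflForm β ρ A B‖ ^ 2 ≤ (reflForm β ρ A A).re * (reflForm β ρ B B).re := by
  have key : ∀ c : ℂ, _ := fun c => h.reflForm_self hβ (A := fun σ => A σ + c * B σ)
    (hA.add (continuous_const.mul hB)) fun σ τ hστ => by simp only [hAS hστ, hBS hστ]
  simp only [reflForm_add_smul hβ ρ hA hB] at key
  obtain ⟨-, a2⟩ := h.reflForm_self hβ hA hAS
  obtain ⟨b1, b2⟩ := h.reflForm_self hβ hB hBS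
  obtain ⟨a1, -⟩ := h.reflForm_self hβ hA hAS
  set a := reflForm β ρ A A
  set b := reflForm β ρ B B
  set u := reflForm β ρ A B
  set v := reflForm β ρ B A
  -- Reality of the form at $A+B$ and $A+iB$ gives its Hermitian symmetry.
  have k1 := (key 1).2
  have k2 := (key Complex.I).2
  simp only [map_one, one_mul, Complex.add_im, a2, b2, Complex.conj_I, Complex.mul_im,
    Complex.neg_re, Complex.neg_im, Complex.I_re, Complex.I_im, Complex.mul_re] at k1 k2
  have hv1 : v.im = -u.im := by linarith
  have hv2 : v.re = u.re := by linarith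
  set N := ‖u‖ ^ 2 with hN
  have hN' : N = u.re ^ 2 + u.im ^ 2 := by
    rw [hN, ← Complex.normSq_eq_norm_sq, Complex.normSq_apply]; ring
  -- Nonnegativity at $A-tuB$ with $u$ the mixed term; the discriminant inequality is $N^2\le
  -- N\,a\,b$.
  have hq : ∀ t : ℝ, 0 ≤ (N * b.re) * (t * t) + (-2 * N) * t + a.re := by
    intro t
    have k := (key (-(t : ℂ) * u)).1
    simp only [map_mul, map_neg, Complex.conj_ofReal, Complex.add_re, Complex.mul_re,
      Complex.mul_im, Complex.neg_re, Complex.neg_im, Complex.ofReal_re, Complex.ofReal_im,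
      Complex.conj_re, Complex.conj_im, b2, hv1, hv2] at k
    rw [hN']
    linarith
  have hd := discrim_le_zero hq
  rw [discrim] at hd
  have hN0 : 0 ≤ N := by positivity
  rcases hN0.eq_or_lt with h0 | h0
  · rw [← h0]; exact mul_nonneg a1 b1
  · have : N * N ≤ N * (a.re * b.re) := by nlinarith
    exact le_of_mul_le_mul_left this h0

end reflection

/-! ### Reflections in the coordinate axes -/

theorem mapPairs_eq_of_involutive {π : Equiv.Perm (ℤ × ℤ)} (hπ : ∀ x, π (π x) = x)
    (hadj : ∀ x y, Adj x y → Adj (π x) (π y)) (hbox : ∀ n x, x ∈ box n → π x ∈ box n) (n : ℕ) :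
    mapPairs π (dirEdges n) = dirEdges n := by
  have h1 : ∀ e : (ℤ × ℤ) × (ℤ × ℤ), e ∈ dirEdges n → (π e.1, π e.2) ∈ dirEdges n := by
    intro e he
    have h := Finset.mem_filter.1 he
    have h2 := Finset.mem_product.1 h.1
    exact Finset.mem_filter.2 ⟨Finset.mem_product.2 ⟨hbox n _ h2.1, hbox n _ h2.2⟩, hadj _ _ h.2⟩
  ext ⟨x, y⟩
  constructor
  · intro h
    obtain ⟨e, he, h2⟩ := Finset.mem_map.1 h
    rw [← h2]
    exact h1 e he
  · intro h
    refine Finset.mem_map.2 ⟨(π x, π y), h1 _ h, ?_⟩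
    change (π (π x), π (π y)) = (x, y)
    rw [hπ, hπ]

/-- The reflection in the horizontal axis. -/
def reflVert : Equiv.Perm (ℤ × ℤ) := (Equiv.refl ℤ).prodCongr (Equiv.neg ℤ)

/-- The reflection in the vertical axis. -/
def reflHoriz : Equiv.Perm (ℤ × ℤ) := (Equiv.neg ℤ).prodCongr (Equiv.refl ℤ)

theorem reflVert_apply (x : ℤ × ℤ) : reflVert x = (x.1, -x.2) := rfl

theorem reflHoriz_apply (x : ℤ × ℤ) : reflHoriz x = (-x.1, x.2) := rfl

theorem isReflection_reflVert : IsReflection reflVert {x | 0 ≤ x.2} where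
  invol x := by simp [reflVert_apply]
  cover x := by
    simp only [reflVert_apply]
    change 0 ≤ x.2 ∨ 0 ≤ -x.2
    omega
  fixed x h1 h2 := by
    change 0 ≤ x.2 at h1
    change 0 ≤ -x.2 at h2
    exact Prod.ext rfl (by change -x.2 = x.2; omega)
  adj x y h := by
    change (0 ≤ x.2 ∧ 0 ≤ y.2) ∨ (0 ≤ -x.2 ∧ 0 ≤ -y.2)
    rcases (adj_iff x y).1 h with h | h | h | h <;> rw [h] <;> dsimp only <;> omega
  box := mapPairs_eq_of_involutive (fun x => by simp [reflVert_apply])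
    (fun x y h => by
      simp only [Adj, reflVert_apply] at *
      linarith [h])
    fun n x h => by
      rw [mem_box] at *
      simp only [reflVert_apply]
      omega

theorem isReflection_reflHoriz : IsReflection reflHoriz {x | x.1 ≤ 0} where
  invol x := by simp [reflHoriz_apply]
  cover x := by
    simp only [reflHoriz_apply]
    change x.1 ≤ 0 ∨ -x.1 ≤ 0
    omega
  fixed x h1 h2 := by
    change x.1 ≤ 0 at h1
    change -x.1 ≤ 0 at h2
    exact Prod.ext (by change -x.1 = x.1; omega) rfl
  adj x y h := by
    change (x.1 ≤ 0 ∧ y.1 ≤ 0) ∨ (-x.1 ≤ 0 ∧ -y.1 ≤ 0)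
    rcases (adj_iff x y).1 h with h | h | h | h <;> rw [h] <;> dsimp only <;> omega
  box := mapPairs_eq_of_involutive (fun x => by simp [reflHoriz_apply])
    (fun x y h => by
      simp only [Adj, reflHoriz_apply] at *
      linarith [h])
    fun n x h => by
      rw [mem_box] at *
      simp only [reflHoriz_apply]
      omega

/-- The exchange of the coordinates. -/
theorem omega_swap {β : ℝ} (hβ : 0 ≤ β) {F : Spins → ℂ} (hF : Continuous F) :
    omega β (fun σ => F (σ ∘ (Equiv.prodComm ℤ ℤ : Equiv.Perm (ℤ × ℤ)))) = omega β F := by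
  refine omega_comp_of_mapPairs hβ _ (mapPairs_eq_of_involutive (fun x => rfl) (fun x y h => ?_)
    fun n x h => ?_) hF
  · simp only [Adj, Equiv.prodComm_apply, Prod.fst_swap, Prod.snd_swap] at *
    linarith
  · rw [mem_box] at *
    simp only [Equiv.prodComm_apply, Prod.fst_swap, Prod.snd_swap]
    omega

end XYHeight

/-! ### Fourier duality between spins and heights -/

namespace XYHeight

/-! ### Fourier expansion of the XY model -/

/-- The character `∏_e (σ_x σ̄_y)^{d_e}`. -/
noncomputable def gradChar {n : ℕ} (d : posEdges n → ℤ) : Spins →ₜ* Circle where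
  toFun σ := ∏ e, pairChar e.1.1 (tgt e.1) σ ^ d e
  map_one' := by simp
  map_mul' σ τ := by simp only [map_mul, mul_zpow, Finset.prod_mul_distrib]
  continuous_toFun := by fun_prop

theorem coe_gradChar {n : ℕ} (d : posEdges n → ℤ) (σ : Spins) :
    (gradChar d σ : ℂ) = ∏ e, (pairChar e.1.1 (tgt e.1) σ : ℂ) ^ d e := by
  change ((∏ e, pairChar e.1.1 (tgt e.1) σ ^ d e : Circle) : ℂ) = _
  exact (map_prod Circle.coeHom _ _).trans (Finset.prod_congr rfl fun e _ => Circle.coe_zpow _ _)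

theorem prod_extE {M : Type*} [CommMonoid M] {n : ℕ} (d : posEdges n → ℤ)
    (g : (ℤ × ℤ) × Bool → ℤ → M) :
    ∏ e : posEdges n, g e.1 (d e) = ∏ e ∈ posEdges n, g e (extE d e) := by
  rw [← Finset.prod_coe_sort (posEdges n) fun e => g e (extE d e)]
  exact Finset.prod_congr rfl fun e _ => by simp [extE]

theorem prod_posEdges_fst {n : ℕ} (d : posEdges n → ℤ) (σ : Spins) :
    ∏ e : posEdges n, σ e.1.1 ^ d e =
      ∏ x ∈ box n, σ x ^ (extE d (x, false) + extE d (x, true)) := by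
  have h1 : ∏ e : posEdges n, σ e.1.1 ^ d e = ∏ e ∈ posEdges n, σ e.1 ^ extE d e :=
    prod_extE d fun e m => σ e.1 ^ m
  rw [h1]
  have h2 : posEdges n ⊆ box n ×ˢ Finset.univ := Finset.filter_subset _ _
  rw [Finset.prod_subset h2 fun e _ he => by simp [extE, he], Finset.prod_product]
  refine Finset.prod_congr rfl fun x _ => ?_
  rw [Fintype.prod_bool, zpow_add, mul_comm]

theorem prod_posEdges_tgt {n : ℕ} (d : posEdges n → ℤ) (σ : Spins) :
    ∏ e : posEdges n, σ (tgt e.1) ^ d e = ∏ x ∈ box n,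
      σ x ^ (extE d ((x.1 - 1, x.2), false) + extE d ((x.1, x.2 - 1), true)) := by
  set back : (ℤ × ℤ) × Bool → (ℤ × ℤ) × Bool := fun t =>
    (if t.2 then (t.1.1, t.1.2 - 1) else (t.1.1 - 1, t.1.2), t.2) with hback
  have h1 : ∏ e : posEdges n, σ (tgt e.1) ^ d e = ∏ e ∈ posEdges n, σ (tgt e) ^ extE d e :=
    prod_extE d fun e m => σ (tgt e) ^ m
  have h2 : ∏ e ∈ posEdges n, σ (tgt e) ^ extE d e =
      ∏ t ∈ (posEdges n).image fun e => (tgt e, e.2), σ t.1 ^ extE d (back t) := by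
    rw [Finset.prod_image]
    · refine Finset.prod_congr rfl fun e _ => ?_
      obtain ⟨⟨i, j⟩, b⟩ := e
      cases b <;> simp [hback, tgt]
    · rintro ⟨⟨i, j⟩, b⟩ _ ⟨⟨i', j'⟩, b'⟩ _ h
      cases b <;> cases b' <;> simp_all [tgt]
  have h3 : ((posEdges n).image fun e => (tgt e, e.2)) ⊆ box n ×ˢ Finset.univ := by
    intro t ht
    obtain ⟨e, he, rfl⟩ := Finset.mem_image.1 ht
    exact Finset.mem_product.2 ⟨(mem_posEdges.1 he).2, Finset.mem_univ _⟩
  rw [h1, h2, Finset.prod_subset h3 fun t ht ht' => ?_, Finset.prod_product]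
  · refine Finset.prod_congr rfl fun x _ => ?_
    rw [Fintype.prod_bool, zpow_add, mul_comm]
    rfl
  · have : back t ∉ posEdges n := by
      refine fun hb => ht' (Finset.mem_image.2 ⟨back t, hb, ?_⟩)
      obtain ⟨⟨i, j⟩, b⟩ := t
      cases b <;> simp [hback, tgt]
    simp [extE, this]

/-- Summation by parts: regrouping the edge factors by vertex leaves each spin to the power of the
divergence. -/
theorem gradChar_apply {n : ℕ} (d : posEdges n → ℤ) (σ : Spins) :
    gradChar d σ = ∏ x ∈ box n, σ x ^ divE d x := by
  have h1 : gradChar d σ = ∏ e : posEdges n, (σ e.1.1 ^ d e / σ (tgt e.1) ^ d e) :=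
    Finset.prod_congr rfl fun e _ => div_zpow _ _ _
  rw [h1, Finset.prod_div_distrib, prod_posEdges_fst, prod_posEdges_tgt, ← Finset.prod_div_distrib]
  refine Finset.prod_congr rfl fun x _ => ?_
  rw [div_eq_mul_inv, ← zpow_sub, divE]
  congr 1
  ring

theorem exists_zpow_ne_one {m : ℤ} (hm : m ≠ 0) : ∃ z : Circle, z ^ m ≠ 1 := by
  refine ⟨Circle.exp (Real.pi / m), fun h => ?_⟩
  rw [← Circle.exp_intCast_mul] at h
  have hm' : (m : ℝ) ≠ 0 := by exact_mod_cast hm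
  rw [mul_div_cancel₀ _ hm'] at h
  have h2 := congrArg (fun z : Circle => (z : ℂ)) h
  simp only [Circle.coe_exp, Complex.exp_pi_mul_I, Circle.coe_one] at h2
  norm_num at h2

open scoped Classical in
theorem integral_gradChar {n : ℕ} (d : posEdges n → ℤ) :
    ∫ σ, (gradChar d σ : ℂ) ∂spinHaar = if ∀ x ∈ box n, divE d x = 0 then 1 else 0 := by
  split_ifs with h
  · have : ∀ σ, gradChar d σ = 1 := fun σ => by
      rw [gradChar_apply]
      exact Finset.prod_eq_one fun x hx => by rw [h x hx, zpow_zero]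
    simp [this]
  · push Not at h
    obtain ⟨x, hx, hne⟩ := h
    obtain ⟨z, hz⟩ := exists_zpow_ne_one hne
    refine integral_char_eq_zero spinHaar _ (g₀ := Pi.mulSingle x z) ?_
    rw [gradChar_apply, Finset.prod_eq_single_of_mem x hx]
    · simpa using hz
    · intro y _ hy
      rw [Pi.mulSingle_eq_of_ne hy, one_zpow]

theorem norm_pairChar_zpow (x y : ℤ × ℤ) (σ : Spins) (d : ℤ) :
    ‖(pairChar x y σ : ℂ) ^ d‖ = 1 := by
  rw [norm_zpow, Circle.norm_coe, one_zpow]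

/-- Termwise integration of products of Fourier series in the spin differences. -/
theorem hasSum_integral_prod {n : ℕ} (χ : Spins →ₜ* Circle) {a : posEdges n → ℤ → ℂ}
    (ha : ∀ e, Summable fun d => ‖a e d‖) :
    HasSum (fun d : posEdges n → ℤ => (∏ e, a e (d e)) * ∫ σ, (χ σ : ℂ) * gradChar d σ ∂spinHaar)
      (∫ σ, (χ σ : ℂ) * ∏ e, ∑' d, a e d * (pairChar e.1.1 (tgt e.1) σ : ℂ) ^ d ∂spinHaar) := by
  have hn := summable_norm_pi_prod ha
  have hint : ∀ d : posEdges n → ℤ, Integrable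
      (fun σ => (χ σ : ℂ) * ((∏ e, a e (d e)) * gradChar d σ)) spinHaar := fun d =>
    integrable_continuousMap _ (by fun_prop)
  have h1 := hasSum_integral_of_summable_integral_norm hint (by
    refine hn.congr fun d => ?_
    simp only [norm_mul, Circle.norm_coe, one_mul, mul_one, integral_const, probReal_univ,
      one_smul])
  have h2 : ∀ σ, ∑' d : posEdges n → ℤ, (χ σ : ℂ) * ((∏ e, a e (d e)) * gradChar d σ) =
      (χ σ : ℂ) * ∏ e, ∑' d, a e d * (pairChar e.1.1 (tgt e.1) σ : ℂ) ^ d := by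
    intro σ
    rw [tsum_mul_left]
    congr 1
    have h3 := hasSum_pi_prod (f := fun (e : posEdges n) d =>
      a e d * (pairChar e.1.1 (tgt e.1) σ : ℂ) ^ d) fun e => by
        simpa only [norm_mul, norm_pairChar_zpow, mul_one] using ha e
    rw [← h3.tsum_eq]
    refine tsum_congr fun d => ?_
    rw [coe_gradChar, Finset.prod_mul_distrib]
  simp only [h2] at h1
  refine h1.congr_fun ?_
  intro d
  rw [← integral_const_mul]
  exact integral_congr_ae (ae_of_all _ fun σ => by ring)

/-- Duality: integrals over the spins as sums over the heights. -/
theorem integral_prod_eq_tsum {n : ℕ} {a : posEdges n → ℤ → ℂ}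
    (ha : ∀ e, Summable fun d => ‖a e d‖) :
    ∫ σ, ∏ e, ∑' d, a e d * (pairChar e.1.1 (tgt e.1) σ : ℂ) ^ d ∂spinHaar =
      ∑' k : faceBox n → ℤ, ∏ e : posEdges n, a e (gradH (extH k) e.1) := by
  classical
  have h := hasSum_integral_prod 1 ha
  have e1 : ∀ σ : Spins, (((1 : Spins →ₜ* Circle) σ : Circle) : ℂ) = 1 := fun _ => rfl
  simp only [e1, one_mul, integral_gradChar] at h
  rw [← h.tsum_eq]
  -- Only divergence-free edge functions contribute, and these are exactly the gradients of heights.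
  refine ((gradH_injective (n := n)).tsum_eq ?_).symm.trans (tsum_congr fun k => ?_)
  · intro d hd
    by_contra hne
    refine hd ?_
    dsimp only
    rw [if_neg, mul_zero]
    exact fun h0 => hne (exists_gradH_eq h0)
  · rw [if_pos fun x _ => divE_gradH k x, mul_one]

/-! ### Boltzmann weights as Fourier series -/

theorem circle_exp_re (β : ℝ) (z : Circle) :
    Complex.exp ((β / 2 : ℝ) * ((z : ℂ) + (z : ℂ)⁻¹)) = (Real.exp (β * (z : ℂ).re) : ℂ) := by
  rw [← Circle.coe_inv, Circle.coe_inv_eq_conj, Complex.add_conj, Complex.ofReal_exp]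
  congr 1
  push_cast
  ring

theorem besselI_hasSum_circle (β : ℝ) (z : Circle) :
    HasSum (fun d : ℤ => (besselI β d : ℂ) * (z : ℂ) ^ d) (Real.exp (β * (z : ℂ).re) : ℂ) := by
  rw [← circle_exp_re]
  exact besselI_hasSum β (Circle.coe_ne_zero z)

theorem sum_dirEdges {M : Type*} [AddCommMonoid M] (n : ℕ) (f : (ℤ × ℤ) × (ℤ × ℤ) → M) :
    ∑ e ∈ dirEdges n, f e = ∑ e : posEdges n, (f (e.1.1, tgt e.1) + f (tgt e.1, e.1.1)) := by
  rw [← Finset.sum_coe_sort, ← (orientEquiv n).sum_comp, Fintype.sum_prod_type]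
  refine Finset.sum_congr rfl fun e _ => ?_
  rw [Fintype.sum_bool]
  rfl

theorem energy_eq_sum (β : ℝ) (n : ℕ) (σ : Spins) :
    energy β (dirEdges n) σ = ∑ e : posEdges n, β * (pairChar e.1.1 (tgt e.1) σ : ℂ).re := by
  rw [energy, charEnergy, sum_dirEdges]
  refine Finset.sum_congr rfl fun e _ => ?_
  dsimp only
  have h : (pairChar (tgt e.1) e.1.1 σ : ℂ).re = (pairChar e.1.1 (tgt e.1) σ : ℂ).re := by
    rw [coe_pairChar, coe_pairChar]
    simp only [Complex.mul_re, Complex.conj_re, Complex.conj_im]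
    ring
  rw [h]
  ring

theorem exp_energy_eq_prod (β : ℝ) (n : ℕ) (σ : Spins) :
    (Real.exp (energy β (dirEdges n) σ) : ℂ) =
      ∏ e : posEdges n, (Real.exp (β * (pairChar e.1.1 (tgt e.1) σ : ℂ).re) : ℂ) := by
  rw [energy_eq_sum, Real.exp_sum, Complex.ofReal_prod]

/-! ### Local observables and their duals -/

/-- The Laurent polynomial with coefficients `c`, relative to the Boltzmann weight of an edge. -/
noncomputable def relTrunc (β : ℝ) (Λ : ℕ) (c : ℤ → ℝ) (z : Circle) : ℂ :=
  (∑ d ∈ Finset.Icc (-(Λ : ℤ)) Λ, (c d : ℂ) * (z : ℂ) ^ d) / (Real.exp (β * (z : ℂ).re) : ℂ)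

/-- A product of functions of the spin differences along the edges in `E`. -/
noncomputable def edgeObs (β : ℝ) (Λ : ℕ) (E : Finset ((ℤ × ℤ) × Bool))
    (a : (ℤ × ℤ) × Bool → ℤ → ℝ) (σ : Spins) : ℂ :=
  ∏ e ∈ E, relTrunc β Λ (a e) (pairChar e.1 (tgt e) σ)

/-- The truncated coefficients relative to the weights of the height differences. -/
noncomputable def relCoeff (β : ℝ) (Λ : ℕ) (c : ℤ → ℝ) (d : ℤ) : ℝ :=
  if |d| ≤ Λ then c d / besselI β d else 0

/-- The function of the heights which is dual to `edgeObs`. -/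
noncomputable def edgeFun (β : ℝ) (Λ : ℕ) (E : Finset ((ℤ × ℤ) × Bool))
    (a : (ℤ × ℤ) × Bool → ℤ → ℝ) (h : ℤ × ℤ → ℤ) : ℝ :=
  ∏ e ∈ E, relCoeff β Λ (a e) (gradH h e)

theorem continuous_relTrunc (β : ℝ) (Λ : ℕ) (c : ℤ → ℝ) : Continuous (relTrunc β Λ c) := by
  unfold relTrunc
  refine Continuous.div ?_ (by fun_prop) fun z => by
    exact_mod_cast (Real.exp_pos _).ne'
  refine continuous_finsetSum _ fun d _ => continuous_const.mul ?_
  exact Continuous.zpow₀ (by fun_prop) d fun z => Or.inl (Circle.coe_ne_zero z)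

theorem continuous_edgeObs (β : ℝ) (Λ : ℕ) (E : Finset ((ℤ × ℤ) × Bool))
    (a : (ℤ × ℤ) × Bool → ℤ → ℝ) : Continuous (edgeObs β Λ E a) :=
  continuous_finsetProd _ fun e _ =>
    (continuous_relTrunc β Λ (a e)).comp (pairChar e.1 (tgt e)).continuous_toFun

open scoped Classical in
theorem prod_subset_posEdges {M : Type*} [CommMonoid M] {n : ℕ} {E : Finset ((ℤ × ℤ) × Bool)}
    (hE : E ⊆ posEdges n) (f : (ℤ × ℤ) × Bool → M) :
    ∏ e ∈ E, f e = ∏ e : posEdges n, if e.1 ∈ E then f e.1 else 1 := by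
  rw [Finset.prod_coe_sort (posEdges n) fun e => if e ∈ E then f e else 1, ← Finset.prod_filter,
    Finset.filter_mem_eq_inter, Finset.inter_eq_right.2 hE]

/-- On an edge of `E` the denominator cancels the Boltzmann factor, so its Bessel coefficients are
replaced by the truncated `a`. Relative to the height weight, this multiplies by their quotient. -/
theorem gibbs_edgeObs {β : ℝ} (hβ : 0 < β) (Λ : ℕ) {n : ℕ} {E : Finset ((ℤ × ℤ) × Bool)}
    (hE : E ⊆ posEdges n) (a : (ℤ × ℤ) × Bool → ℤ → ℝ) :
    gibbs β (dirEdges n) (edgeObs β Λ E a) =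
      ((hSum β n (edgeFun β Λ E a) / hSum β n fun _ => 1 : ℝ) : ℂ) := by
  classical
  have key : ∀ E ⊆ posEdges n, ∫ σ, edgeObs β Λ E a σ * (Real.exp (energy β (dirEdges n) σ) : ℂ)
      ∂spinHaar = (hSum β n (edgeFun β Λ E a) : ℂ) := by
    intro E hE
    let A : posEdges n → ℤ → ℝ := fun e d =>
      if e.1 ∈ E then (if |d| ≤ (Λ : ℤ) then a e.1 d else 0) else besselI β d
    have hfin : ∀ (c : ℤ → ℝ) (d : ℤ), d ∉ Finset.Icc (-(Λ : ℤ)) Λ →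
        (if |d| ≤ (Λ : ℤ) then c d else 0) = 0 := fun c d hd => by
      rw [if_neg]
      rw [Finset.mem_Icc] at hd
      exact fun h => hd (abs_le.1 h)
    have hA : ∀ e, Summable fun d => ‖(A e d : ℂ)‖ := by
      intro e
      simp only [Complex.norm_real, A]
      split_ifs
      · refine summable_of_ne_finset_zero (s := Finset.Icc (-(Λ : ℤ)) Λ) fun d hd => ?_
        rw [hfin _ d hd, norm_zero]
      · exact (besselI_summable_int hβ.le).norm
    have h1 := integral_prod_eq_tsum hA
    have h2 : ∀ σ, ∏ e : posEdges n, ∑' d, (A e d : ℂ) * (pairChar e.1.1 (tgt e.1) σ : ℂ) ^ d =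
        edgeObs β Λ E a σ * (Real.exp (energy β (dirEdges n) σ) : ℂ) := by
      intro σ
      rw [exp_energy_eq_prod, edgeObs, prod_subset_posEdges hE, ← Finset.prod_mul_distrib]
      refine Finset.prod_congr rfl fun e _ => ?_
      simp only [A]
      split_ifs with he
      · rw [relTrunc, div_mul_cancel₀, tsum_eq_sum (s := Finset.Icc (-(Λ : ℤ)) Λ)]
        · refine Finset.sum_congr rfl fun d hd => ?_
          rw [if_pos (abs_le.2 (Finset.mem_Icc.1 hd))]
        · intro d hd
          rw [hfin _ d hd, Complex.ofReal_zero, zero_mul]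
        · exact_mod_cast (Real.exp_pos _).ne'
      · rw [one_mul]
        exact (besselI_hasSum_circle β _).tsum_eq
    simp only [h2] at h1
    rw [h1, hSum, Complex.ofReal_tsum]
    refine tsum_congr fun k => ?_
    rw [← Complex.ofReal_prod, Complex.ofReal_inj, hWeight, edgeFun, prod_subset_posEdges hE,
      ← Finset.prod_coe_sort (posEdges n) fun e => besselI β (gradH (extH k) e),
      ← Finset.prod_mul_distrib]
    refine Finset.prod_congr rfl fun e _ => ?_
    simp only [A, relCoeff]
    split_ifs
    · rw [mul_div_cancel₀ _ (besselI_pos hβ _).ne']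
    · rw [mul_zero]
    · rw [mul_one]
  have h0 := key ∅ (Finset.empty_subset _)
  simp only [edgeObs, Finset.prod_empty, one_mul] at h0
  have e0 : edgeFun β Λ ∅ a = fun _ => 1 := funext fun h => Finset.prod_empty
  rw [integral_complex_ofReal, e0] at h0
  rw [gibbs, key E hE, partZ, h0, Complex.ofReal_div]

theorem edgeObs_conj (β : ℝ) (Λ : ℕ) (E : Finset ((ℤ × ℤ) × Bool))
    (a : (ℤ × ℤ) × Bool → ℤ → ℝ) (σ : Spins) :
    (starRingEnd ℂ) (edgeObs β Λ E a σ) = edgeObs β Λ E (fun e d => a e (-d)) σ := by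
  rw [edgeObs, map_prod]
  refine Finset.prod_congr rfl fun e _ => ?_
  rw [relTrunc, relTrunc, map_div₀, Complex.conj_ofReal, map_sum]
  congr 1
  refine Finset.sum_nbij' (fun d => -d) (fun d => -d) ?_ ?_ (by simp) (by simp) ?_
  · intro d hd; rw [Finset.mem_Icc] at *; omega
  · intro d hd; rw [Finset.mem_Icc] at *; omega
  · intro d _
    dsimp only
    rw [map_mul, Complex.conj_ofReal, map_zpow₀, ← Circle.coe_inv_eq_conj, Circle.coe_inv, neg_neg,
      inv_zpow, zpow_neg]

/-- Translation of edges. -/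
def shiftEdge (v : ℤ × ℤ) : (ℤ × ℤ) × Bool ↪ (ℤ × ℤ) × Bool :=
  ⟨fun e => (e.1 + v, e.2), fun e e' h => by
    rw [Prod.mk.injEq] at h
    exact Prod.ext (add_right_cancel h.1) h.2⟩

theorem shiftEdge_apply (v : ℤ × ℤ) (e : (ℤ × ℤ) × Bool) : shiftEdge v e = (e.1 + v, e.2) := rfl

theorem tgt_shiftEdge (v : ℤ × ℤ) (e : (ℤ × ℤ) × Bool) : tgt (shiftEdge v e) = tgt e + v := by
  obtain ⟨⟨i, j⟩, b⟩ := e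
  cases b <;> simp [shiftEdge_apply, tgt, Prod.ext_iff, add_right_comm]

theorem gradH_shiftEdge (v : ℤ × ℤ) (h : ℤ × ℤ → ℤ) (e : (ℤ × ℤ) × Bool) :
    gradH h (shiftEdge v e) = gradH (translate v h) e := by
  obtain ⟨⟨i, j⟩, b⟩ := e
  obtain ⟨p, q⟩ := v
  cases b <;> simp [shiftEdge_apply, gradH, otherFace, translate, sub_add_eq_add_sub]

theorem edgeObs_translate (β : ℝ) (Λ : ℕ) (E : Finset ((ℤ × ℤ) × Bool)) (v : ℤ × ℤ)
    (a : (ℤ × ℤ) × Bool → ℤ → ℝ) (σ : Spins) :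
    edgeObs β Λ E a (σ ∘ (Equiv.addRight v : Equiv.Perm (ℤ × ℤ))) =
      edgeObs β Λ (E.map (shiftEdge v)) (fun e => a (e.1 - v, e.2)) σ := by
  rw [edgeObs, edgeObs, Finset.prod_map]
  refine Finset.prod_congr rfl fun e _ => ?_
  rw [tgt_shiftEdge, shiftEdge_apply]
  simp only [add_sub_cancel_right, Prod.mk.eta]
  rfl

theorem edgeFun_translate (β : ℝ) (Λ : ℕ) (E : Finset ((ℤ × ℤ) × Bool)) (v : ℤ × ℤ)
    (a : (ℤ × ℤ) × Bool → ℤ → ℝ) (h : ℤ × ℤ → ℤ) :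
    edgeFun β Λ E a (translate v h) =
      edgeFun β Λ (E.map (shiftEdge v)) (fun e => a (e.1 - v, e.2)) h := by
  rw [edgeFun, edgeFun, Finset.prod_map]
  refine Finset.prod_congr rfl fun e _ => ?_
  rw [gradH_shiftEdge, shiftEdge_apply]
  simp only [add_sub_cancel_right, Prod.mk.eta]

theorem gibbs_edgeObs_translate {β : ℝ} (hβ : 0 < β) (Λ : ℕ) {n : ℕ}
    {E : Finset ((ℤ × ℤ) × Bool)} {v : ℤ × ℤ} (hE : E.map (shiftEdge v) ⊆ posEdges n)
    (a : (ℤ × ℤ) × Bool → ℤ → ℝ) :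
    gibbs β (dirEdges n) (fun σ => edgeObs β Λ E a (σ ∘ (Equiv.addRight v : Equiv.Perm (ℤ × ℤ)))) =
      ((hSum β n (fun h => edgeFun β Λ E a (translate v h)) / hSum β n fun _ => 1 : ℝ) : ℂ) := by
  have := gibbs_edgeObs hβ Λ hE fun e => a (e.1 - v, e.2)
  simp only [edgeObs_translate, edgeFun_translate]
  exact this

/-- For disjoint edge sets, the two coefficient families glue to one family on the union, to which
the duality applies. -/
theorem gibbs_edgeObs_mul {β : ℝ} (hβ : 0 < β) (Λ : ℕ) {n : ℕ} {E : Finset ((ℤ × ℤ) × Bool)}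
    {v : ℤ × ℤ} (hE : E ⊆ posEdges n) (hEv : E.map (shiftEdge v) ⊆ posEdges n)
    (hdis : Disjoint (E.map (shiftEdge v)) E) (a b : (ℤ × ℤ) × Bool → ℤ → ℝ) :
    gibbs β (dirEdges n) (fun σ => edgeObs β Λ E a (σ ∘ (Equiv.addRight v : Equiv.Perm (ℤ × ℤ))) *
        edgeObs β Λ E b σ) =
      ((hSum β n (fun h => edgeFun β Λ E a (translate v h) * edgeFun β Λ E b h) /
        hSum β n fun _ => 1 : ℝ) : ℂ) := by
  classical
  let c : (ℤ × ℤ) × Bool → ℤ → ℝ := fun e => if e ∈ E then b e else a (e.1 - v, e.2)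
  have h1 := gibbs_edgeObs hβ Λ (Finset.union_subset hEv hE) c
  have h2 : ∀ e ∈ E, c e = b e := fun e he => if_pos he
  have h3 : ∀ e ∈ E.map (shiftEdge v), c e = a (e.1 - v, e.2) := fun e he =>
    if_neg (Finset.disjoint_left.1 hdis he)
  have e1 : ∀ σ, edgeObs β Λ (E.map (shiftEdge v) ∪ E) c σ =
      edgeObs β Λ E a (σ ∘ (Equiv.addRight v : Equiv.Perm (ℤ × ℤ))) * edgeObs β Λ E b σ := by
    intro σ
    rw [edgeObs_translate, edgeObs, Finset.prod_union hdis]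
    exact congrArg₂ _ (Finset.prod_congr rfl fun e he => by rw [h3 e he])
      (Finset.prod_congr rfl fun e he => by rw [h2 e he])
  have e2 : ∀ h, edgeFun β Λ (E.map (shiftEdge v) ∪ E) c h =
      edgeFun β Λ E a (translate v h) * edgeFun β Λ E b h := by
    intro σ
    rw [edgeFun_translate, edgeFun, Finset.prod_union hdis]
    exact congrArg₂ _ (Finset.prod_congr rfl fun e he => by rw [h3 e he])
      (Finset.prod_congr rfl fun e he => by rw [h2 e he])
  rw [show edgeObs β Λ (E.map (shiftEdge v) ∪ E) c = _ from funext e1,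
    show edgeFun β Λ (E.map (shiftEdge v) ∪ E) c = _ from funext e2] at h1
  exact h1

end XYHeight

/-! ### The McBryan–Spencer bound and decay of the two-point function -/

namespace XYHeight

/-! ### The McBryan–Spencer bound -/

theorem exists_circle_exp_ne_one {L : ℝ} (hL : L ≠ 0) : ∃ t : ℝ, Circle.exp (t * L) ≠ 1 := by
  refine ⟨Real.pi / L, fun h => ?_⟩
  rw [div_mul_cancel₀ _ hL] at h
  have h2 := congrArg (fun z : Circle => (z : ℂ)) h
  simp only [Circle.coe_exp, Complex.exp_pi_mul_I, Circle.coe_one] at h2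
  norm_num at h2

theorem circle_exp_sum {ι : Type*} (s : Finset ι) (f : ι → ℝ) :
    Circle.exp (∑ i ∈ s, f i) = ∏ i ∈ s, Circle.exp (f i) := by
  classical
  induction s using Finset.induction_on with
  | empty => simp
  | insert i s hi ih => rw [Finset.sum_insert hi, Finset.prod_insert hi, Circle.exp_add, ih]

theorem pairChar_exp (a : ℤ × ℤ → ℝ) (t : ℝ) (x y : ℤ × ℤ) :
    pairChar x y (fun u => Circle.exp (t * a u)) = Circle.exp (t * (a x - a y)) := by
  rw [mul_sub, Circle.exp_sub]
  rfl

/-- Along the rotations by $t\,a$ the character is $e^{itL}$, with $L$ the stated linear form. If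
$L\ne0$, it is nontrivial and integrates to zero. -/
theorem integral_pairChar_gradChar {n : ℕ} (x y : ℤ × ℤ) (d : posEdges n → ℤ) (a : ℤ × ℤ → ℝ)
    (h : a x - a y + ∑ e, d e * (a e.1.1 - a (tgt e.1)) ≠ 0) :
    ∫ σ, (pairChar x y σ : ℂ) * gradChar d σ ∂spinHaar = 0 := by
  obtain ⟨t, ht⟩ := exists_circle_exp_ne_one h
  refine integral_char_eq_zero spinHaar (pairChar x y * gradChar d)
    (g₀ := fun u => Circle.exp (t * a u)) ?_
  have h1 : gradChar d (fun u => Circle.exp (t * a u)) =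
      Circle.exp (t * ∑ e, d e * (a e.1.1 - a (tgt e.1))) := by
    change ∏ e, pairChar e.1.1 (tgt e.1) (fun u => Circle.exp (t * a u)) ^ d e = _
    rw [Finset.mul_sum, circle_exp_sum]
    refine Finset.prod_congr rfl fun e _ => ?_
    rw [pairChar_exp, ← Circle.exp_intCast_mul]
    congr 1
    ring
  change pairChar x y (fun u => Circle.exp (t * a u)) *
    gradChar d (fun u => Circle.exp (t * a u)) ≠ 1
  rw [h1, pairChar_exp, ← Circle.exp_add, ← mul_add]
  exact ht

/-- The generating function at $e^sz$ has modulus $\exp(\beta\cosh s\,\mathrm{Re}\,z)$, and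
$\mathrm{Re}\,z\le1$ bounds the excess over the untwisted weight. -/
theorem norm_twisted_le {β : ℝ} (hβ : 0 ≤ β) (s : ℝ) (z : Circle) :
    ‖∑' d : ℤ, ((besselI β d * Real.exp s ^ d : ℝ) : ℂ) * (z : ℂ) ^ d‖ ≤
      Real.exp (β * (z : ℂ).re) * Real.exp (β * (Real.cosh s - 1)) := by
  have hz : (Real.exp s : ℂ) * (z : ℂ) ≠ 0 :=
    mul_ne_zero (by exact_mod_cast (Real.exp_pos s).ne') (Circle.coe_ne_zero z)
  have h1 := (besselI_hasSum β hz).tsum_eq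
  have h2 : ∀ d : ℤ, ((besselI β d * Real.exp s ^ d : ℝ) : ℂ) * (z : ℂ) ^ d =
      (besselI β d : ℂ) * ((Real.exp s : ℂ) * (z : ℂ)) ^ d := fun d => by
    rw [mul_zpow]; push_cast; ring
  simp only [h2]
  rw [h1, Complex.norm_exp, ← Real.exp_add, Real.exp_le_exp, mul_inv, ← Circle.coe_inv,
    Circle.coe_inv_eq_conj, ← Complex.ofReal_inv, ← Real.exp_neg]
  have hre : ((β / 2 : ℝ) * ((Real.exp s : ℂ) * (z : ℂ) +
      (Real.exp (-s) : ℂ) * (starRingEnd ℂ) (z : ℂ)) : ℂ).re = β * (Real.cosh s * (z : ℂ).re) := by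
    rw [Complex.re_ofReal_mul, Complex.add_re, Complex.re_ofReal_mul, Complex.re_ofReal_mul,
      Complex.conj_re, Real.cosh_eq]
    ring
  rw [hre, ← mul_add]
  refine mul_le_mul_of_nonneg_left ?_ hβ
  have h3 : (z : ℂ).re ≤ 1 := (Complex.re_le_norm _).trans (Circle.norm_coe z).le
  nlinarith [mul_nonneg (sub_nonneg.2 (Real.one_le_cosh s)) (sub_nonneg.2 h3)]

/-- The complex rotation $\theta_u\mapsto\theta_u-ia_u$, performed on Fourier coefficients:
nonvanishing terms have $\sum_e d_es_e=-(a_x-a_y)$, so twisting every coefficient by $e^{s_ed_e}$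
costs exactly the prefactor $e^{a_x-a_y}$. -/
theorem abs_charMean_pairChar_le {β : ℝ} (hβ : 0 ≤ β) (n : ℕ) (x y : ℤ × ℤ) (a : ℤ × ℤ → ℝ) :
    |charMean β (dirEdges n) (pairChar x y)| ≤ Real.exp (a x - a y +
      β * ∑ e : posEdges n, (Real.cosh (a e.1.1 - a (tgt e.1)) - 1)) := by
  set s : posEdges n → ℝ := fun e => a e.1.1 - a (tgt e.1) with hs
  have hA1 : ∀ e : posEdges n, Summable fun d : ℤ => ‖(besselI β d : ℂ)‖ := fun e => by
    simpa using (besselI_summable_int hβ).norm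
  have hA2 : ∀ e : posEdges n,
      Summable fun d : ℤ => ‖((besselI β d * Real.exp (s e) ^ d : ℝ) : ℂ)‖ := fun e => by
    simpa only [Complex.norm_real] using (besselI_zpow_summable hβ (Real.exp_pos (s e))).norm
  have h1 := hasSum_integral_prod (pairChar x y) (a := fun _ d => (besselI β d : ℂ)) hA1
  have h2 := hasSum_integral_prod (pairChar x y)
    (a := fun e d => ((besselI β d * Real.exp (s e) ^ d : ℝ) : ℂ)) hA2
  have h3 := h2.mul_left (Real.exp (a x - a y) : ℂ)
  have hterm : ∀ d : posEdges n → ℤ, (∏ e, (besselI β (d e) : ℂ)) *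
      ∫ σ, (pairChar x y σ : ℂ) * gradChar d σ ∂spinHaar = (Real.exp (a x - a y) : ℂ) *
      ((∏ e, ((besselI β (d e) * Real.exp (s e) ^ d e : ℝ) : ℂ)) *
        ∫ σ, (pairChar x y σ : ℂ) * gradChar d σ ∂spinHaar) := by
    intro d
    by_cases hL : a x - a y + ∑ e, d e * s e = 0
    · have e1 : ∏ e, Real.exp (s e) ^ d e = Real.exp (-(a x - a y)) := by
        rw [show -(a x - a y) = ∑ e, d e * s e by linarith, Real.exp_sum]
        exact Finset.prod_congr rfl fun e _ => by
          rw [← Real.rpow_intCast, ← Real.exp_mul, mul_comm]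
      have e2 : ∏ e, ((besselI β (d e) * Real.exp (s e) ^ d e : ℝ) : ℂ) =
          (∏ e, (besselI β (d e) : ℂ)) * (Real.exp (-(a x - a y)) : ℂ) := by
        rw [← e1, Complex.ofReal_prod, ← Finset.prod_mul_distrib]
        exact Finset.prod_congr rfl fun e _ => by push_cast; rfl
      rw [e2, Real.exp_neg]
      have : (Real.exp (a x - a y) : ℂ) ≠ 0 := by exact_mod_cast (Real.exp_pos _).ne'
      push_cast
      push_cast at this
      field_simp
    · rw [integral_pairChar_gradChar x y d a hL]
      simp
  simp only [hterm] at h1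
  have h4 := h1.unique h3
  have h5 : ∀ σ : Spins, ∏ e : posEdges n,
      ∑' d, (besselI β d : ℂ) * (pairChar e.1.1 (tgt e.1) σ : ℂ) ^ d =
      (Real.exp (energy β (dirEdges n) σ) : ℂ) := fun σ => by
    rw [exp_energy_eq_prod]
    exact Finset.prod_congr rfl fun e _ => (besselI_hasSum_circle β _).tsum_eq
  simp only [h5] at h4
  set K := Real.exp (β * ∑ e, (Real.cosh (s e) - 1)) with hK
  have h6 : ∀ σ : Spins, ‖(pairChar x y σ : ℂ) * ∏ e : posEdges n,
      ∑' d, ((besselI β d * Real.exp (s e) ^ d : ℝ) : ℂ) * (pairChar e.1.1 (tgt e.1) σ : ℂ) ^ d‖ ≤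
      Real.exp (energy β (dirEdges n) σ) * K := fun σ => by
    rw [norm_mul, Circle.norm_coe, one_mul, norm_prod, energy_eq_sum, Real.exp_sum, hK,
      Finset.mul_sum, Real.exp_sum, ← Finset.prod_mul_distrib]
    exact Finset.prod_le_prod (fun _ _ => norm_nonneg _) fun e _ => norm_twisted_le hβ _ _
  have hc : Continuous fun σ => Real.exp (energy β (dirEdges n) σ) * K := by
    have := continuous_energy β (dirEdges n)
    fun_prop
  have h7 := norm_integral_le_of_norm_le (integrable_continuousMap spinHaar hc) (ae_of_all _ h6)
  rw [integral_mul_const] at h7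
  have hZ := partZ_pos β (dirEdges n)
  rw [← Real.norm_eq_abs, ← Complex.norm_real, ← gibbs_char, gibbs, h4, norm_div, norm_mul,
    Complex.norm_real, Complex.norm_real, Real.norm_of_nonneg hZ.le, Real.norm_of_nonneg
    (Real.exp_pos _).le, div_le_iff₀ hZ, Real.exp_add, mul_assoc]
  refine mul_le_mul_of_nonneg_left (h7.trans_eq ?_) (Real.exp_pos _).le
  rw [mul_comm]
  rfl

/-! ### Decay of the two-point function -/

/-- The distance from `x` in the supremum norm. -/
def supDist (x u : ℤ × ℤ) : ℕ := max (u.1 - x.1).natAbs (u.2 - x.2).natAbs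

/-- The partial harmonic sum up to a cutoff. -/
noncomputable def cutHarmonic (L N : ℕ) : ℝ := ∑ j ∈ Finset.range (min N L), 1 / ((j : ℝ) + 1)

/-- The squares of the increments of `cutHarmonic`. -/
noncomputable def cutSquare (L N : ℕ) : ℝ := if 1 ≤ N ∧ N ≤ L then 1 / (N : ℝ) ^ 2 else 0

theorem cutSquare_nonneg (L N : ℕ) : 0 ≤ cutSquare L N := by
  unfold cutSquare; split_ifs <;> positivity

theorem cutHarmonic_succ_sub_sq (L N : ℕ) :
    (cutHarmonic L (N + 1) - cutHarmonic L N) ^ 2 = cutSquare L (N + 1) := by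
  unfold cutHarmonic cutSquare
  by_cases h : N + 1 ≤ L
  · rw [min_eq_left h, min_eq_left (by omega), Finset.sum_range_succ, if_pos ⟨by omega, h⟩]
    push_cast
    rw [add_sub_cancel_left, div_pow, one_pow]
  · rw [min_eq_right (by omega), min_eq_right (by omega), if_neg (by omega)]
    simp

theorem cutHarmonic_sub_sq_le (L M N : ℕ) (h1 : M ≤ N + 1) (h2 : N ≤ M + 1) :
    (cutHarmonic L M - cutHarmonic L N) ^ 2 ≤ cutSquare L M + cutSquare L N := by
  have hM := cutSquare_nonneg L M
  have hN := cutSquare_nonneg L N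
  rcases (by omega : M = N ∨ M = N + 1 ∨ N = M + 1) with rfl | rfl | rfl
  · simpa using add_nonneg hM hN
  · rw [cutHarmonic_succ_sub_sq]; linarith
  · rw [← neg_sub, neg_sq, cutHarmonic_succ_sub_sq]; linarith

/-- There are $8r$ sites at sup-distance $r\ge1$, each contributing $1/r^2$. In two dimensions the
energy of the logarithmic profile therefore grows no faster than the profile itself. -/
theorem sum_cutSquare_le (L : ℕ) (x : ℤ × ℤ) (T : Finset (ℤ × ℤ)) :
    ∑ u ∈ T, cutSquare L (supDist x u) ≤ 8 * cutHarmonic L L := by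
  classical
  set S := T.filter fun u => 1 ≤ supDist x u ∧ supDist x u ≤ L
  have h1 : ∑ u ∈ T, cutSquare L (supDist x u) = ∑ u ∈ S, 1 / (supDist x u : ℝ) ^ 2 := by
    rw [Finset.sum_filter]
    rfl
  have hmaps : ∀ u ∈ S, supDist x u - 1 ∈ Finset.range L := fun u hu => by
    have := (Finset.mem_filter.1 hu).2
    rw [Finset.mem_range]; omega
  rw [h1, ← Finset.sum_fiberwise_of_maps_to hmaps, cutHarmonic, min_self, Finset.mul_sum]
  refine Finset.sum_le_sum fun j _ => ?_
  have h2 : ∀ u ∈ S.filter (fun u => supDist x u - 1 = j), 1 / (supDist x u : ℝ) ^ 2 =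
      1 / ((j : ℝ) + 1) ^ 2 := fun u hu => by
    have h3 := (Finset.mem_filter.1 hu).2
    have h4 := (Finset.mem_filter.1 (Finset.mem_filter.1 hu).1).2
    rw [show supDist x u = j + 1 by omega]
    push_cast; rfl
  rw [Finset.sum_congr rfl h2, Finset.sum_const, nsmul_eq_mul]
  have hcard : (S.filter fun u => supDist x u - 1 = j).card ≤ 8 * (j + 1) := by
    rw [← Int.card_box (n := j + 1) (by omega)]
    refine Finset.card_le_card_of_injOn (fun u => u - x) (fun u hu => ?_)
      fun u _ v _ h => sub_left_injective h
    have h3 := (Finset.mem_filter.1 hu).2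
    have h4 := (Finset.mem_filter.1 (Finset.mem_filter.1 hu).1).2
    rw [Finset.mem_coe, Int.mem_box]
    change supDist x u = j + 1
    omega
  have hcard' : ((S.filter fun u => supDist x u - 1 = j).card : ℝ) ≤ 8 * ((j : ℝ) + 1) := by
    exact_mod_cast hcard
  calc _ ≤ 8 * ((j : ℝ) + 1) * (1 / ((j : ℝ) + 1) ^ 2) :=
        mul_le_mul_of_nonneg_right hcard' (by positivity)
    _ = _ := by field_simp

theorem sum_posEdges_cutSquare_le (L n : ℕ) (x : ℤ × ℤ) :
    ∑ e : posEdges n, (cutHarmonic L (supDist x e.1.1) - cutHarmonic L (supDist x (tgt e.1))) ^ 2 ≤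
      32 * cutHarmonic L L := by
  have h1 : ∀ e : (ℤ × ℤ) × Bool,
      (cutHarmonic L (supDist x e.1) - cutHarmonic L (supDist x (tgt e))) ^ 2 ≤
      cutSquare L (supDist x e.1) + cutSquare L (supDist x (tgt e)) := by
    rintro ⟨⟨i, j⟩, b⟩
    refine cutHarmonic_sub_sq_le _ _ _ ?_ ?_ <;> cases b <;> simp [supDist, tgt] <;> omega
  rw [Finset.sum_coe_sort (posEdges n) fun e =>
    (cutHarmonic L (supDist x e.1) - cutHarmonic L (supDist x (tgt e))) ^ 2]
  refine (Finset.sum_le_sum fun e _ => h1 e).trans ?_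
  rw [Finset.sum_add_distrib]
  have h2 : ∑ e ∈ posEdges n, cutSquare L (supDist x e.1) ≤ 16 * cutHarmonic L L := by
    refine (Finset.sum_le_sum_of_subset_of_nonneg (Finset.filter_subset _ _)
      fun _ _ _ => cutSquare_nonneg _ _).trans ?_
    rw [Finset.sum_product]
    simp only [Fintype.sum_bool, Finset.sum_add_distrib]
    linarith [sum_cutSquare_le L x (box n)]
  have h3 : ∑ e ∈ posEdges n, cutSquare L (supDist x (tgt e)) ≤ 16 * cutHarmonic L L := by
    have h4 : ∑ e ∈ posEdges n, cutSquare L (supDist x (tgt e)) =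
        ∑ t ∈ (posEdges n).image fun e => (tgt e, e.2), cutSquare L (supDist x t.1) := by
      rw [Finset.sum_image]
      rintro ⟨⟨i, j⟩, b⟩ _ ⟨⟨i', j'⟩, b'⟩ _ h
      cases b <;> cases b' <;> simp_all [tgt]
    have h5 : ((posEdges n).image fun e => (tgt e, e.2)) ⊆ box n ×ˢ Finset.univ := by
      intro t ht
      obtain ⟨e, he, rfl⟩ := Finset.mem_image.1 ht
      exact Finset.mem_product.2 ⟨(mem_posEdges.1 he).2, Finset.mem_univ _⟩
    rw [h4]
    refine (Finset.sum_le_sum_of_subset_of_nonneg h5 fun _ _ _ => cutSquare_nonneg _ _).trans ?_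
    rw [Finset.sum_product]
    simp only [Fintype.sum_bool, Finset.sum_add_distrib]
    linarith [sum_cutSquare_le L x (box n)]
  linarith

theorem cosh_sub_one_le {s : ℝ} (hs : |s| ≤ 1) : Real.cosh s - 1 ≤ s ^ 2 := by
  have h1 := Real.abs_exp_sub_one_sub_id_le hs
  have h2 := Real.abs_exp_sub_one_sub_id_le (x := -s) (by rwa [abs_neg])
  rw [Real.cosh_eq]
  have h3 := (abs_le.1 h1).2
  have h4 := (abs_le.1 h2).2
  rw [neg_sq] at h4
  linarith

theorem cutSquare_le_one (L N : ℕ) : cutSquare L N ≤ 1 := by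
  unfold cutSquare
  split_ifs with h
  · have : (1 : ℝ) ≤ N := by exact_mod_cast h.1
    rw [div_le_one (by positivity)]
    nlinarith
  · exact zero_le_one

theorem abs_charMean_pairChar_le_exp {β : ℝ} (hβ : 0 ≤ β) (n : ℕ) (x y : ℤ × ℤ) :
    |charMean β (dirEdges n) (pairChar x y)| ≤
      Real.exp (-(cutHarmonic (supDist x y) (supDist x y) / (2 * (64 * β + 2)))) := by
  set L := supDist x y
  -- Small enough that the quadratic cost $32\beta\delta^2$ is at most half the linear gain
  -- $\delta$, and that increments along edges are at most one, as `cosh_sub_one_le` requires.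
  set δ : ℝ := 1 / (64 * β + 2) with hδ
  have hδ0 : 0 < δ := by positivity
  have hδ1 : δ ≤ 1 / 2 := by
    rw [hδ]; exact one_div_le_one_div_of_le two_pos (by linarith)
  have hδ2 : β * (32 * δ) ≤ 1 / 2 := by
    rw [hδ]
    rw [mul_one_div, mul_div_assoc', div_le_div_iff₀ (by positivity) two_pos]
    linarith
  have h := abs_charMean_pairChar_le hβ n x y fun u => δ * cutHarmonic L (supDist x u)
  refine h.trans (Real.exp_le_exp.2 ?_)
  have hx : cutHarmonic L (supDist x x) = 0 := by simp [cutHarmonic, supDist]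
  have hsum : ∑ e : posEdges n, (Real.cosh (δ * cutHarmonic L (supDist x e.1.1) -
      δ * cutHarmonic L (supDist x (tgt e.1))) - 1) ≤ δ ^ 2 * (32 * cutHarmonic L L) := by
    refine le_trans ?_ (mul_le_mul_of_nonneg_left (sum_posEdges_cutSquare_le L n x) (sq_nonneg δ))
    rw [Finset.mul_sum]
    refine Finset.sum_le_sum fun e _ => ?_
    rw [← mul_sub, ← mul_pow]
    refine cosh_sub_one_le ?_
    have h1 : (cutHarmonic L (supDist x e.1.1) - cutHarmonic L (supDist x (tgt e.1))) ^ 2 ≤ 2 := by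
      refine (cutHarmonic_sub_sq_le _ _ _ ?_ ?_).trans (add_le_add (cutSquare_le_one _ _)
        (cutSquare_le_one _ _) |>.trans (by norm_num)) <;>
      obtain ⟨⟨⟨i, j⟩, b⟩, he⟩ := e <;> cases b <;> simp [supDist, tgt] <;> omega
    rw [abs_le_one_iff_mul_self_le_one, mul_mul_mul_comm, ← sq (cutHarmonic L _ - _)]
    have h2 : δ * δ ≤ 1 / 2 * (1 / 2) := mul_le_mul hδ1 hδ1 hδ0.le (by norm_num)
    have h3 := mul_le_mul h2 h1 (sq_nonneg _) (by norm_num)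
    linarith
  have hH : 0 ≤ cutHarmonic L L := Finset.sum_nonneg fun j _ => by positivity
  have h2 := mul_le_mul_of_nonneg_left hsum hβ
  have h3 : β * (δ ^ 2 * (32 * cutHarmonic L L)) ≤ 1 / 2 * (δ * cutHarmonic L L) := by
    calc _ = β * (32 * δ) * (δ * cutHarmonic L L) := by ring
      _ ≤ _ := mul_le_mul_of_nonneg_right hδ2 (mul_nonneg hδ0.le hH)
  have h4 : cutHarmonic L L / (2 * (64 * β + 2)) = 1 / 2 * (δ * cutHarmonic L L) := by
    rw [hδ]; field_simp
  rw [hx, h4]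
  change δ * 0 - δ * cutHarmonic L L + _ ≤ _
  linarith

/-- The finite-volume bound is uniform in the volume, and divergence of the harmonic series sends it
to zero. -/
theorem tendsto_omega_pairChar {β : ℝ} (hβ : 0 ≤ β) {x y : ℕ → ℤ × ℤ}
    (h : Tendsto (fun l => supDist (x l) (y l)) atTop atTop) :
    Tendsto (fun l => omega β fun σ => (pairChar (x l) (y l) σ : ℂ)) atTop (𝓝 0) := by
  have h1 : ∀ l, ‖omega β fun σ => (pairChar (x l) (y l) σ : ℂ)‖ ≤
      Real.exp (-(cutHarmonic (supDist (x l) (y l)) (supDist (x l) (y l)) /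
        (2 * (64 * β + 2)))) := by
    intro l
    refine le_of_tendsto (tendsto_omega hβ (continuous_char _)).norm
      (Eventually.of_forall fun n => ?_)
    rw [gibbs_char, Complex.norm_real, Real.norm_eq_abs]
    exact abs_charMean_pairChar_le_exp hβ n _ _
  refine squeeze_zero_norm h1 ?_
  have h2 : Tendsto (fun L : ℕ => cutHarmonic L L) atTop atTop := by
    simp only [cutHarmonic, min_self]
    exact Real.tendsto_sum_range_one_div_nat_succ_atTop
  exact Real.tendsto_exp_neg_atTop_nhds_zero.comp
    ((h2.comp h).atTop_div_const (by positivity))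

end XYHeight

/-! ### Slab observables approximating a bridge of spins -/

namespace XYHeight

/-! ### Edges around a set of faces -/

/-- The edges around a face. -/
def faceEdges (f : ℤ × ℤ) : Finset ((ℤ × ℤ) × Bool) :=
  {((f.1 + 1, f.2), true), (f, true), ((f.1, f.2 + 1), false), (f, false)}

/-- The edges around the faces in `P`. -/
def borderEdges (P : Finset (ℤ × ℤ)) : Finset ((ℤ × ℤ) × Bool) := P.biUnion faceEdges

theorem mem_borderEdges {P : Finset (ℤ × ℤ)} {e : (ℤ × ℤ) × Bool} :
    e ∈ borderEdges P ↔ ∃ f ∈ P, e = ((f.1 + 1, f.2), true) ∨ e = (f, true) ∨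
      e = ((f.1, f.2 + 1), false) ∨ e = (f, false) := by
  simp [borderEdges, faceEdges]

theorem faces_mem_hull {P : Finset (ℤ × ℤ)} {e : (ℤ × ℤ) × Bool} (he : e ∈ borderEdges P) :
    e.1 ∈ hull P ∧ otherFace e ∈ hull P := by
  obtain ⟨f, hf, h⟩ := mem_borderEdges.1 he
  have h0 : f ∈ hull P := Finset.mem_union_left _ hf
  have h1 : ∀ q, q ∈ nbrs f → q ∈ hull P := fun q hq => nbrs_subset_hull hf hq
  simp only [mem_nbrs] at h1
  rcases h with rfl | rfl | rfl | rfl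
  · exact ⟨h1 _ (Or.inl rfl), by simpa [otherFace] using h0⟩
  · exact ⟨h0, by simpa [otherFace] using h1 _ (Or.inr (Or.inl rfl))⟩
  · exact ⟨h1 _ (Or.inr (Or.inr (Or.inl rfl))), by simpa [otherFace] using h0⟩
  · exact ⟨h0, by simpa [otherFace] using h1 _ (Or.inr (Or.inr (Or.inr rfl)))⟩

theorem exists_borderEdge {P : Finset (ℤ × ℤ)} {p q : ℤ × ℤ} (h : Step P p q) :
    ∃ e ∈ borderEdges P, ∀ k : ℤ × ℤ → ℤ, |k q - k p| = |gradH k e| := by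
  obtain ⟨hp, hq⟩ := h
  rcases mem_nbrs.1 hq with rfl | rfl | rfl | rfl
  · exact ⟨((p.1 + 1, p.2), true), mem_borderEdges.2 ⟨p, hp, Or.inl rfl⟩, fun k => by
      simp [gradH, otherFace]⟩
  · exact ⟨(p, true), mem_borderEdges.2 ⟨p, hp, Or.inr (Or.inl rfl)⟩, fun k => by
      simp [gradH, otherFace, abs_sub_comm]⟩
  · exact ⟨((p.1, p.2 + 1), false), mem_borderEdges.2 ⟨p, hp, Or.inr (Or.inr (Or.inl rfl))⟩,
      fun k => by simp [gradH, otherFace, abs_sub_comm]⟩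
  · exact ⟨(p, false), mem_borderEdges.2 ⟨p, hp, Or.inr (Or.inr (Or.inr rfl))⟩, fun k => by
      simp [gradH, otherFace]⟩

theorem shift_borderEdges_subset {P : Finset (ℤ × ℤ)} {n : ℕ} {v : ℤ × ℤ}
    (h : ∀ p ∈ P, p + v ∈ faceBox n) : (borderEdges P).map (shiftEdge v) ⊆ posEdges n := by
  intro e he
  obtain ⟨e, he', rfl⟩ := Finset.mem_map.1 he
  obtain ⟨f, hf, h1⟩ := mem_borderEdges.1 he'
  have h2 := mem_faceBox.1 (h f hf)
  rw [mem_posEdges, tgt_shiftEdge, shiftEdge_apply, mem_box, mem_box]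
  simp only [Prod.fst_add, Prod.snd_add] at *
  rcases h1 with rfl | rfl | rfl | rfl <;>
    simp only [tgt, if_true, Bool.false_eq_true, if_false] <;> omega

theorem abs_relCoeff_le {β : ℝ} (Λ : ℕ) (c : ℤ → ℝ) (d : ℤ) :
    |relCoeff β Λ c d| ≤ ∑ j ∈ Finset.Icc (-(Λ : ℤ)) Λ, |c j / besselI β j| := by
  unfold relCoeff
  split_ifs with h
  · exact Finset.single_le_sum (f := fun j => |c j / besselI β j|) (fun _ _ => abs_nonneg _)
      (Finset.mem_Icc.2 (abs_le.1 h))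
  · rw [abs_zero]
    exact Finset.sum_nonneg fun _ _ => abs_nonneg _

theorem exists_abs_edgeFun_le (β : ℝ) (Λ : ℕ) (E : Finset ((ℤ × ℤ) × Bool))
    (a : (ℤ × ℤ) × Bool → ℤ → ℝ) : ∃ B, 0 ≤ B ∧ ∀ h, |edgeFun β Λ E a h| ≤ B := by
  refine ⟨∏ e ∈ E, ∑ j ∈ Finset.Icc (-(Λ : ℤ)) Λ, |a e j / besselI β j|,
    Finset.prod_nonneg fun _ _ => Finset.sum_nonneg fun _ _ => abs_nonneg _, fun h => ?_⟩
  rw [edgeFun, Finset.abs_prod]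
  exact Finset.prod_le_prod (fun _ _ => abs_nonneg _) fun e _ => abs_relCoeff_le Λ (a e) _

/-- The product contains a truncated factor for every edge bordering `P`, including those on which
nothing is inserted; one gradient above `Λ` therefore annihilates it. -/
theorem isGradLocal_edgeFun {β : ℝ} {Λ : ℕ} {P : Finset (ℤ × ℤ)} {a : (ℤ × ℤ) × Bool → ℤ → ℝ}
    {B : ℝ} (hB : ∀ h, |edgeFun β Λ (borderEdges P) a h| ≤ B) :
    IsGradLocal P Λ B (edgeFun β Λ (borderEdges P) a) where
  bound := hB
  loc h h' hh := Finset.prod_congr rfl fun e he => by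
    congr 1
    have := faces_mem_hull he
    rw [gradH, gradH, hh _ this.1, hh _ this.2]
  supp h hne p q hpq := by
    obtain ⟨e, he, hk⟩ := exists_borderEdge hpq
    rw [hk]
    by_contra hlt
    exact hne (Finset.prod_eq_zero he (if_neg hlt))

/-! ### Slabs of faces -/

/-- Two rows of faces. -/
noncomputable def slab (l : ℕ) : Finset (ℤ × ℤ) := Finset.Ico (-(l : ℤ)) l ×ˢ Finset.Ico 0 2

theorem mem_slab {l : ℕ} {f : ℤ × ℤ} :
    f ∈ slab l ↔ (-(l : ℤ) ≤ f.1 ∧ f.1 < l) ∧ 0 ≤ f.2 ∧ f.2 < 2 := by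
  simp [slab]

theorem slab_path_right {l : ℕ} {i j : ℤ} (h : (i, j) ∈ slab l) (m : ℕ) (hm : i + m < l) :
    Relation.ReflTransGen (Step (slab l)) (i, j) (i + m, j) := by
  induction m with
  | zero => simpa using Relation.ReflTransGen.refl
  | succ m ih =>
    rw [mem_slab] at h
    push_cast at hm ⊢
    refine (ih (by omega)).tail ⟨mem_slab.2 (by dsimp only at *; omega), mem_nbrs.2 (Or.inl ?_)⟩
    dsimp only
    rw [add_assoc]

theorem slab_path_left {l : ℕ} {i j : ℤ} (h : (i, j) ∈ slab l) (m : ℕ) (hm : -(l : ℤ) ≤ i - m) :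
    Relation.ReflTransGen (Step (slab l)) (i, j) (i - m, j) := by
  induction m with
  | zero => simpa using Relation.ReflTransGen.refl
  | succ m ih =>
    rw [mem_slab] at h
    push_cast at hm ⊢
    refine (ih (by omega)).tail
      ⟨mem_slab.2 (by dsimp only at *; omega), mem_nbrs.2 (Or.inr (Or.inl ?_))⟩
    dsimp only
    rw [sub_sub]

theorem isCluster_slab {l : ℕ} {a : ℤ × ℤ} (ha : a ∈ slab l) : IsCluster a (slab l) := by
  refine ⟨ha, fun p hp => ?_⟩
  obtain ⟨i, j⟩ := a
  obtain ⟨i', j'⟩ := p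
  have ha' := mem_slab.1 ha
  have hp' := mem_slab.1 hp
  dsimp only at ha' hp'
  have h1 : Relation.ReflTransGen (Step (slab l)) (i, j) (i', j) := by
    rcases le_total i i' with h | h
    · obtain ⟨m, rfl⟩ := Int.le.dest h
      exact slab_path_right ha m (by omega)
    · obtain ⟨m, hm⟩ := Int.le.dest h
      obtain rfl : i' = i - m := by omega
      exact slab_path_left ha m (by omega)
  have h2 : (i', j) ∈ slab l := mem_slab.2 (by dsimp only; omega)
  rcases (by omega : j' = j ∨ j' = j + 1 ∨ j' = j - 1) with rfl | rfl | rfl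
  · exact h1
  · exact h1.tail ⟨h2, mem_nbrs.2 (Or.inr (Or.inr (Or.inl rfl)))⟩
  · exact h1.tail ⟨h2, mem_nbrs.2 (Or.inr (Or.inr (Or.inr rfl)))⟩

theorem mem_borderEdges_slab {l : ℕ} {i j : ℤ} {b : Bool} :
    ((i, j), b) ∈ borderEdges (slab l) ↔ -(l : ℤ) ≤ i ∧ 0 ≤ j ∧
      ((b = true ∧ i ≤ l ∧ j < 2 ∧ 0 < l) ∨ (b = false ∧ i < l ∧ j ≤ 2)) := by
  rw [mem_borderEdges]
  constructor
  · rintro ⟨⟨p, q⟩, hf, h⟩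
    rw [mem_slab] at hf
    simp only [Prod.mk.injEq] at h hf
    rcases h with ⟨⟨rfl, rfl⟩, rfl⟩ | ⟨⟨rfl, rfl⟩, rfl⟩ | ⟨⟨rfl, rfl⟩, rfl⟩ | ⟨⟨rfl, rfl⟩, rfl⟩ <;>
      simp <;> omega
  · rintro ⟨h1, h2, ⟨rfl, h3, h4, h5⟩ | ⟨rfl, h3, h4⟩⟩
    · rcases h3.lt_or_eq with h | h
      · exact ⟨(i, j), mem_slab.2 (by dsimp only; omega), Or.inr (Or.inl rfl)⟩
      · exact ⟨(i - 1, j), mem_slab.2 (by dsimp only; omega), Or.inl (by simp)⟩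
    · rcases h4.lt_or_eq with h | h
      · exact ⟨(i, j), mem_slab.2 (by dsimp only; omega), Or.inr (Or.inr (Or.inr rfl))⟩
      · exact ⟨(i, j - 1), mem_slab.2 (by dsimp only; omega), Or.inr (Or.inr (Or.inl (by simp)))⟩

/-- The coefficients of the weights, where the flow through the middle row is shifted by one. -/
noncomputable def slabCoeff (β : ℝ) (e : (ℤ × ℤ) × Bool) (d : ℤ) : ℝ :=
  besselI β (if e.2 = false ∧ e.1.2 = 1 then d + 1 else d)

/-- The truncated local observable of a slab. -/
noncomputable def slabObs (β : ℝ) (Λ l : ℕ) : Spins → ℂ :=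
  edgeObs β Λ (borderEdges (slab l)) (slabCoeff β)

theorem continuous_slabObs (β : ℝ) (Λ l : ℕ) : Continuous (slabObs β Λ l) :=
  continuous_edgeObs β Λ _ _

/-- The upward translation by `k`. -/
def up (k : ℤ) : Equiv.Perm (ℤ × ℤ) := Equiv.addRight ((0, k) : ℤ × ℤ)

theorem up_apply (k : ℤ) (x : ℤ × ℤ) : up k x = (x.1, x.2 + k) := by
  simp [up, Prod.ext_iff]

-- All edges bordering the slab lie at nonnegative height, so a nonnegative shift keeps the
-- observable in the upper half-plane used for reflection.
theorem dependsOn_slabObs (β : ℝ) (Λ l : ℕ) {k : ℤ} (hk : 0 ≤ k) :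
    DependsOn (fun σ : Spins => slabObs β Λ l (σ ∘ up k)) {x | 0 ≤ x.2} := by
  intro σ τ h
  have h' : ∀ x : ℤ × ℤ, 0 ≤ x.2 → σ x = τ x := fun x hx => h x hx
  refine Finset.prod_congr rfl fun e he => ?_
  have h0 : 0 ≤ e.1.2 := (mem_borderEdges_slab.1 he).2.1
  have h1 : 0 ≤ (tgt e).2 := by
    unfold tgt
    split_ifs <;> dsimp only <;> omega
  congr 1
  change σ (up k e.1) / σ (up k (tgt e)) = τ (up k e.1) / τ (up k (tgt e))
  rw [up_apply, up_apply, h' _ (by dsimp only; omega), h' _ (by dsimp only; omega)]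

theorem relTrunc_inv {β : ℝ} (Λ : ℕ) {c : ℤ → ℝ} (hc : ∀ d, c (-d) = c d) (z : Circle) :
    relTrunc β Λ c z⁻¹ = relTrunc β Λ c z := by
  rw [relTrunc, relTrunc, Circle.coe_inv_eq_conj, Complex.conj_re]
  congr 1
  refine Finset.sum_nbij' (fun d => -d) (fun d => -d) ?_ ?_ (by simp) (by simp) ?_
  · intro d hd; rw [Finset.mem_Icc] at *; omega
  · intro d hd; rw [Finset.mem_Icc] at *; omega
  · intro d _
    rw [hc, ← Circle.coe_inv_eq_conj, Circle.coe_inv, inv_zpow, zpow_neg]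

/-- Reflection of an edge in the middle row of the slab. -/
def flipEdge (e : (ℤ × ℤ) × Bool) : (ℤ × ℤ) × Bool :=
  ((e.1.1, if e.2 then 1 - e.1.2 else 2 - e.1.2), e.2)

theorem flipEdge_flipEdge (e : (ℤ × ℤ) × Bool) : flipEdge (flipEdge e) = e := by
  obtain ⟨⟨i, j⟩, b⟩ := e
  cases b <;> simp [flipEdge]

theorem flipEdge_mem {l : ℕ} {e : (ℤ × ℤ) × Bool} (he : e ∈ borderEdges (slab l)) :
    flipEdge e ∈ borderEdges (slab l) := by
  obtain ⟨⟨i, j⟩, b⟩ := e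
  rw [mem_borderEdges_slab] at he
  cases b <;> simp only [flipEdge, mem_borderEdges_slab, if_true, Bool.false_eq_true, if_false,
    true_and, false_and, or_false, false_or, Bool.true_eq_false] at * <;> omega

/-- The observable of a slab is symmetric. -/
theorem slabObs_flip (β : ℝ) (Λ l : ℕ) (σ : Spins) :
    slabObs β Λ l (fun x => σ (x.1, 2 - x.2)) = slabObs β Λ l σ := by
  refine Finset.prod_nbij' flipEdge flipEdge (fun e he => flipEdge_mem he)
    (fun e he => flipEdge_mem he) (fun e _ => flipEdge_flipEdge e) (fun e _ => flipEdge_flipEdge e)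
    fun e _ => ?_
  obtain ⟨⟨i, j⟩, b⟩ := e
  cases b
  · have h1 : slabCoeff β (flipEdge ((i, j), false)) = slabCoeff β ((i, j), false) := by
      funext d
      have : (2 - j = 1) ↔ j = 1 := by omega
      simp [slabCoeff, flipEdge, this]
    rw [h1]
    rfl
  · have h1 : slabCoeff β (flipEdge ((i, j), true)) = slabCoeff β ((i, j), true) := rfl
    have h2 : ∀ d, slabCoeff β ((i, j), true) (-d) = slabCoeff β ((i, j), true) d := fun d =>
      besselI_neg β d
    have h3 : pairChar (flipEdge ((i, j), true)).1 (tgt (flipEdge ((i, j), true))) σ =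
        (pairChar (i, j) (i, j + 1) fun x => σ (x.1, 2 - x.2))⁻¹ := by
      change σ (i, 1 - j) / σ (i, 1 - j + 1) = (σ (i, 2 - j) / σ (i, 2 - (j + 1)))⁻¹
      rw [inv_div, show (2 : ℤ) - (j + 1) = 1 - j by ring, show (1 : ℤ) - j + 1 = 2 - j by ring]
    rw [h1, h3, relTrunc_inv Λ h2]
    rfl

/-! ### Removing the truncation -/

theorem tendsto_Icc_neg : Tendsto (fun Λ : ℕ => Finset.Icc (-(Λ : ℤ)) Λ) atTop atTop := by
  refine tendsto_atTop_finset_of_monotone (fun m n h => Finset.Icc_subset_Icc (by omega) (by omega))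
    fun d => ⟨d.natAbs, ?_⟩
  rw [Finset.mem_Icc]
  omega

/-- Powers as continuous functions on the circle. -/
noncomputable def circlePow (d : ℤ) : C(Circle, ℂ) :=
  ⟨fun z => (z : ℂ) ^ d, Continuous.zpow₀ (by fun_prop) d fun z => Or.inl (Circle.coe_ne_zero z)⟩

theorem hasSum_circlePow {β : ℝ} (hβ : 0 ≤ β) (s : ℤ) :
    ∃ f : C(Circle, ℂ), HasSum (fun d : ℤ => (besselI β (d + s) : ℂ) • circlePow d) f ∧
      ∀ z : Circle, f z = (z : ℂ) ^ (-s) * (Real.exp (β * (z : ℂ).re) : ℂ) := by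
  have hs : Summable fun d : ℤ => (besselI β (d + s) : ℂ) • circlePow d := by
    refine Summable.of_norm_bounded
      ((besselI_summable_int hβ).comp_injective (add_left_injective s)) fun d => ?_
    rw [norm_smul, Complex.norm_real, Real.norm_of_nonneg (besselI_nonneg hβ _)]
    refine mul_le_of_le_one_right (besselI_nonneg hβ _) ?_
    rw [ContinuousMap.norm_le _ zero_le_one]
    intro z
    change ‖(z : ℂ) ^ d‖ ≤ 1
    rw [norm_zpow, Circle.norm_coe, one_zpow]
  refine ⟨_, hs.hasSum, fun z => ?_⟩
  have h1 : HasSum (fun d : ℤ => (besselI β (d + s) : ℂ) * (z : ℂ) ^ d)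
      ((∑' d : ℤ, (besselI β (d + s) : ℂ) • circlePow d) z) :=
    hs.hasSum.map (ContinuousMap.evalAlgHom ℂ ℂ z) (continuous_eval_const z)
  have h2 := (besselI_hasSum_circle β z).mul_left ((z : ℂ) ^ (-s))
  rw [← (Equiv.addRight s).hasSum_iff] at h2
  refine h1.unique (h2.congr_fun ?_)
  intro d
  have hz := Circle.coe_ne_zero z
  simp only [Function.comp_apply, Equiv.coe_addRight]
  rw [mul_left_comm, ← zpow_add₀ hz]
  congr 2
  ring

/-- Shifting the Bessel coefficients by $s$ multiplies the edge weight by $z^{-s}$, uniformly on the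
circle; division by the weight leaves the pure power. Convergence is in sup norm so that products
and `omega` are continuous along it. -/
theorem tendsto_relTrunc {β : ℝ} (hβ : 0 ≤ β) (s : ℤ) :
    Tendsto (fun Λ : ℕ => (⟨_, continuous_relTrunc β Λ fun d => besselI β (d + s)⟩ : C(Circle, ℂ)))
      atTop (𝓝 (circlePow (-s))) := by
  obtain ⟨f, hf, hfz⟩ := hasSum_circlePow hβ s
  have hg0 : ∀ z : Circle, (Real.exp (β * (z : ℂ).re) : ℂ) ≠ 0 := fun z => by
    exact_mod_cast (Real.exp_pos _).ne'
  let g : C(Circle, ℂ) := ⟨fun z => (Real.exp (β * (z : ℂ).re) : ℂ)⁻¹,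
    Continuous.inv₀ (by fun_prop) hg0⟩
  have h1 := (hf.comp tendsto_Icc_neg).mul_const g
  have e1 : f * g = circlePow (-s) := by
    ext z
    change f z * (Real.exp (β * (z : ℂ).re) : ℂ)⁻¹ = (z : ℂ) ^ (-s)
    rw [hfz, mul_inv_cancel_right₀ (hg0 z)]
  rw [e1] at h1
  refine h1.congr fun Λ => ?_
  ext z
  change (∑ d ∈ Finset.Icc (-(Λ : ℤ)) Λ, (besselI β (d + s) : ℂ) • circlePow d : C(Circle, ℂ)) z *
    (Real.exp (β * (z : ℂ).re) : ℂ)⁻¹ = relTrunc β Λ (fun d => besselI β (d + s)) z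
  rw [ContinuousMap.sum_apply, relTrunc, div_eq_mul_inv]
  rfl

theorem prod_pairChar_row (l : ℕ) (j : ℤ) (σ : Spins) (m : ℕ) :
    ∏ i ∈ Finset.Ico (-(l : ℤ)) (-(l : ℤ) + m), pairChar (i + 1, j) (i, j) σ =
      pairChar (-(l : ℤ) + m, j) (-(l : ℤ), j) σ := by
  induction m with
  | zero =>
    simp only [Nat.cast_zero, add_zero, Finset.Ico_self, Finset.prod_empty]
    exact (div_self' _).symm
  | succ m ih =>
    have h1 : Finset.Ico (-(l : ℤ)) (-(l : ℤ) + (m + 1 : ℕ)) =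
        insert (-(l : ℤ) + m) (Finset.Ico (-(l : ℤ)) (-(l : ℤ) + m)) := by
      ext i
      rw [Finset.mem_insert, Finset.mem_Ico, Finset.mem_Ico]
      push_cast
      omega
    rw [h1, Finset.prod_insert (by simp), ih]
    change σ _ / σ _ * (σ _ / σ _) = σ _ / σ _
    rw [div_mul_div_cancel]
    push_cast
    rw [add_assoc]

/-- The edges of the middle row, at height one, telescope to their two endpoints. -/
theorem prod_bridge (l : ℕ) (σ : Spins) :
    ∏ e ∈ borderEdges (slab l),
        (if e.2 = false ∧ e.1.2 = 1 then (pairChar e.1 (tgt e) σ)⁻¹ else 1) =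
      pairChar ((l : ℤ), 1) (-(l : ℤ), 1) σ := by
  rw [← Finset.prod_filter]
  have h1 := prod_pairChar_row l 1 σ (2 * l)
  rw [show -(l : ℤ) + (2 * l : ℕ) = l by push_cast; ring] at h1
  rw [← h1]
  refine Finset.prod_nbij' (fun e => e.1.1) (fun i => ((i, 1), false)) ?_ ?_ ?_ ?_ ?_
  · rintro ⟨⟨i, j⟩, b⟩ he
    rw [Finset.mem_filter, mem_borderEdges_slab] at he
    rw [Finset.mem_Ico]
    dsimp only at *
    obtain ⟨he, rfl, rfl⟩ := he
    simp at he
    omega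
  · intro i hi
    rw [Finset.mem_Ico] at hi
    rw [Finset.mem_filter, mem_borderEdges_slab]
    simp
    omega
  · rintro ⟨⟨i, j⟩, b⟩ he
    rw [Finset.mem_filter] at he
    obtain ⟨_, rfl, rfl⟩ := he
    rfl
  · intro i _
    rfl
  · rintro ⟨⟨i, j⟩, b⟩ he
    rw [Finset.mem_filter] at he
    obtain ⟨_, rfl, rfl⟩ := he
    exact inv_div _ _

/-- The limit of the observable of a slab. -/
theorem tendsto_slabObs {β : ℝ} (hβ : 0 ≤ β) (l : ℕ) :
    Tendsto (fun Λ : ℕ => (⟨_, continuous_slabObs β Λ l⟩ : C(Spins, ℂ))) atTop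
      (𝓝 ⟨_, continuous_char (pairChar ((l : ℤ), 1) (-(l : ℤ), 1))⟩) := by
  let s : (ℤ × ℤ) × Bool → ℤ := fun e => if e.2 = false ∧ e.1.2 = 1 then 1 else 0
  let D : (ℤ × ℤ) × Bool → C(Spins, Circle) := fun e =>
    ⟨_, (pairChar e.1 (tgt e)).continuous_toFun⟩
  have h1 := tendsto_finsetProd (borderEdges (slab l)) fun e _ =>
    ((ContinuousMap.continuous_precomp (D e)).tendsto _).comp (tendsto_relTrunc hβ (s e))
  convert h1 using 1
  · funext Λ
    ext σ
    rw [ContinuousMap.prod_apply]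
    change ∏ e ∈ borderEdges (slab l), relTrunc β Λ (slabCoeff β e) (pairChar e.1 (tgt e) σ) = _
    refine Finset.prod_congr rfl fun e _ => ?_
    have : slabCoeff β e = fun d => besselI β (d + s e) := by
      funext d
      simp only [slabCoeff, s]
      split_ifs <;> simp
    rw [this]
    rfl
  · congr 1
    ext σ
    rw [ContinuousMap.prod_apply]
    change ((pairChar ((l : ℤ), 1) (-(l : ℤ), 1) σ : Circle) : ℂ) = _
    rw [← prod_bridge]
    refine (map_prod Circle.coeHom _ _).trans (Finset.prod_congr rfl fun e _ => ?_)
    change ((if e.2 = false ∧ e.1.2 = 1 then (pairChar e.1 (tgt e) σ)⁻¹ else 1 : Circle) : ℂ) =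
      (pairChar e.1 (tgt e) σ : ℂ) ^ (-s e)
    simp only [s]
    split_ifs
    · rw [Circle.coe_inv, zpow_neg, zpow_one]
    · rw [Circle.coe_one, neg_zero, zpow_zero]

end XYHeight

/-! ### Transfer of decay from the heights to the two-point function -/

namespace XYHeight

/-! ### Log-convex sequences -/

/-- A nonnegative log-convex sequence which infinitely often is below a multiple of a geometric
sequence stays below the geometric sequence that starts at its first term. -/
theorem le_geometric_of_logConvex {a : ℕ → ℝ} (h0 : ∀ r, 0 ≤ a r)
    (hc : ∀ r, a (r + 1) ^ 2 ≤ a r * a (r + 2)) {q C : ℝ} (hq : 0 < q)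
    (hf : ∃ᶠ r in atTop, a r ≤ C * q ^ r) (r : ℕ) : a r ≤ a 0 * q ^ r := by
  set b : ℕ → ℝ := fun r => a r / q ^ r with hb
  have b0 : ∀ r, 0 ≤ b r := fun r => div_nonneg (h0 r) (pow_pos hq r).le
  have bc : ∀ r, b (r + 1) ≤ (b r + b (r + 2)) / 2 := by
    intro r
    have h1 : b (r + 1) ^ 2 ≤ b r * b (r + 2) := by
      simp only [hb]
      rw [div_pow, div_mul_div_comm, ← pow_mul, ← pow_add, show (r + 1) * 2 = r + (r + 2) by ring]
      gcongr
      exact hc r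
    refine abs_le_of_sq_le_sq' ?_ (by linarith [b0 r, b0 (r + 2)]) |>.2
    nlinarith [sq_nonneg (b r - b (r + 2))]
  have bf : ∃ᶠ r in atTop, b r ≤ C := hf.mono fun r hr => (div_le_iff₀ (pow_pos hq r)).2 hr
  have hanti : ∀ s, b (s + 1) ≤ b s := by
    intro s
    by_contra! hlt
    have hinc : ∀ t, b (s + 1) - b s ≤ b (s + t + 1) - b (s + t) := by
      intro t
      induction t with
      | zero => exact le_rfl
      | succ t ih =>
        have := bc (s + t)
        rw [← add_assoc]
        linarith
    have hlin : ∀ t : ℕ, b s + t * (b (s + 1) - b s) ≤ b (s + t) := by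
      intro t
      induction t with
      | zero => simp
      | succ t ih =>
        have := hinc t
        rw [← add_assoc]
        push_cast
        linarith
    have hlim : Tendsto (fun t : ℕ => b s + t * (b (s + 1) - b s)) atTop atTop :=
      tendsto_atTop_add_const_left _ _
        (tendsto_natCast_atTop_atTop.atTop_mul_const (sub_pos.2 hlt))
    have h2 : Tendsto (fun t : ℕ => b (t + s)) atTop atTop :=
      tendsto_atTop_mono (fun t => by rw [add_comm t]; exact hlin t) hlim
    obtain ⟨r, hr, hr'⟩ := (bf.and_eventually
      (((tendsto_add_atTop_iff_nat s).1 h2).eventually_gt_atTop C)).exists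
    linarith
  have h1 : b r ≤ b 0 := antitone_nat_of_succ_le hanti (Nat.zero_le r)
  simp only [hb, pow_zero, div_one] at h1
  rwa [div_le_iff₀ (pow_pos hq r)] at h1

/-! ### Truncated correlations -/

/-- The truncated correlation of `F` translated upward by `k` and the conjugate of `F`. -/
noncomputable def corr (β : ℝ) (F : Spins → ℂ) (k : ℤ) : ℂ :=
  omega β fun σ => (F (σ ∘ up k) - omega β F) * (starRingEnd ℂ) (F σ - omega β F)

theorem continuous_comp_up {F : Spins → ℂ} (hF : Continuous F) (k : ℤ) :
    Continuous fun σ : Spins => F (σ ∘ up k) := hF.comp (pullHom (up k)).continuous_toFun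

theorem corr_eq {β : ℝ} (hβ : 0 ≤ β) {F : Spins → ℂ} (hF : Continuous F) (k : ℤ) :
    corr β F k = omega β (fun σ => F (σ ∘ up k) * (starRingEnd ℂ) (F σ)) -
      omega β F * omega β fun σ => (starRingEnd ℂ) (F σ) := by
  set m := omega β F with hm
  have c1 := continuous_comp_up hF k
  have c2 : Continuous fun σ => (starRingEnd ℂ) (F σ) := Complex.continuous_conj.comp hF
  have e1 : omega β (fun σ : Spins => F (σ ∘ up k)) = m := omega_translate hβ (0, k) hF
  have e2 : (fun σ : Spins => (F (σ ∘ up k) - m) * (starRingEnd ℂ) (F σ - m)) = fun σ =>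
      (F (σ ∘ up k) * (starRingEnd ℂ) (F σ) + (-m) * (starRingEnd ℂ) (F σ)) +
        ((-(starRingEnd ℂ) m) * F (σ ∘ up k) + m * (starRingEnd ℂ) m) := by
    funext σ
    rw [map_sub]
    ring
  have c3 : Continuous fun σ : Spins => F (σ ∘ up k) * (starRingEnd ℂ) (F σ) := c1.mul c2
  have c4 : Continuous fun σ : Spins => (-m) * (starRingEnd ℂ) (F σ) := continuous_const.mul c2
  have c5 : Continuous fun σ : Spins => (-(starRingEnd ℂ) m) * F (σ ∘ up k) :=
    continuous_const.mul c1
  have c6 : Continuous fun _ : Spins => m * (starRingEnd ℂ) m := continuous_const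
  rw [corr, ← hm, e2]
  refine (omega_add hβ (c3.add c4) (c5.add c6)).trans ?_
  refine (congrArg₂ (· + ·) (omega_add hβ c3 c4) (omega_add hβ c5 c6)).trans ?_
  rw [omega_const_mul hβ c2, omega_const_mul hβ c1, omega_const, e1]
  ring

theorem continuous_omega {β : ℝ} (hβ : 0 ≤ β) : Continuous fun f : C(Spins, ℂ) => omega β f := by
  have : LipschitzWith 1 fun f : C(Spins, ℂ) => omega β f := by
    refine LipschitzWith.of_dist_le_mul fun f g => ?_
    rw [NNReal.coe_one, one_mul, dist_eq_norm, dist_eq_norm]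
    exact omega_sub_le hβ f.continuous g.continuous fun σ => (f - g).norm_coe_le_norm σ
  exact this.continuous

theorem continuous_corr {β : ℝ} (hβ : 0 ≤ β) (k : ℤ) :
    Continuous fun f : C(Spins, ℂ) => corr β f k := by
  have h1 : Continuous fun f : C(Spins, ℂ) =>
      f.comp ⟨fun σ : Spins => σ ∘ up k, (pullHom (up k)).continuous_toFun⟩ :=
    ContinuousMap.continuous_precomp _
  have h2 := ((continuous_omega hβ).comp (h1.mul (continuous_star (R := C(Spins, ℂ))))).sub
    ((continuous_omega hβ).mul ((continuous_omega hβ).comp (continuous_star (R := C(Spins, ℂ)))))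
  refine h2.congr fun f => ?_
  rw [corr_eq hβ f.continuous]
  rfl

theorem slabObs_comp_reflVert (β : ℝ) (Λ l : ℕ) (q : ℤ) (σ : Spins) :
    slabObs β Λ l ((σ ∘ reflVert) ∘ up q) = slabObs β Λ l (σ ∘ up (-q - 2)) := by
  rw [← slabObs_flip]
  congr 1
  funext x
  simp only [Function.comp_apply, up_apply, reflVert_apply]
  congr 2
  ring

/-- The slab occupies vertex heights $0$ to $2$ and is symmetric about $1$, so reflecting its
translate by $q$ gives the translate by $-q-2$; the relative displacement is $p+q+2$. -/
theorem reflForm_slabObs {β : ℝ} (hβ : 0 ≤ β) (Λ l : ℕ) (p q : ℤ) :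
    reflForm β reflVert (fun σ => slabObs β Λ l (σ ∘ up p) - omega β (slabObs β Λ l))
      (fun σ => slabObs β Λ l (σ ∘ up q) - omega β (slabObs β Λ l)) =
      corr β (slabObs β Λ l) (p + q + 2) := by
  have hF := continuous_slabObs β Λ l
  set m := omega β (slabObs β Λ l) with hm
  have hG : Continuous fun σ : Spins => (slabObs β Λ l (σ ∘ up (p + q + 2)) - m) *
      (starRingEnd ℂ) (slabObs β Λ l σ - m) :=
    ((continuous_comp_up hF _).sub continuous_const).mul
      (Complex.continuous_conj.comp (hF.sub continuous_const))
  rw [corr, ← hm, ← omega_translate hβ (0, -q - 2) hG, reflForm]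
  congr 1
  funext σ
  rw [slabObs_comp_reflVert]
  have : (σ ∘ (Equiv.addRight ((0, -q - 2) : ℤ × ℤ) : Equiv.Perm (ℤ × ℤ))) ∘ up (p + q + 2) =
      σ ∘ up p := by
    funext x
    change σ (up (-q - 2) (up (p + q + 2) x)) = σ (up p x)
    rw [up_apply, up_apply, up_apply]
    congr 2
    ring
  rw [this]
  rfl

theorem corr_slabObs_nonneg {β : ℝ} (hβ : 0 ≤ β) (Λ l : ℕ) (r : ℕ) :
    0 ≤ (corr β (slabObs β Λ l) (r + r + 2)).re := by
  rw [← reflForm_slabObs hβ]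
  refine (isReflection_reflVert.reflForm_self hβ ?_ ?_).1
  · exact (continuous_comp_up (continuous_slabObs β Λ l) _).sub continuous_const
  · intro σ τ h
    simp only [dependsOn_slabObs β Λ l (Int.natCast_nonneg r) h]

theorem norm_corr_slabObs_sq_le {β : ℝ} (hβ : 0 ≤ β) (Λ l : ℕ) (p q : ℕ) :
    ‖corr β (slabObs β Λ l) (p + q + 2)‖ ^ 2 ≤
      (corr β (slabObs β Λ l) (p + p + 2)).re * (corr β (slabObs β Λ l) (q + q + 2)).re := by
  simp only [← reflForm_slabObs hβ]
  refine isReflection_reflVert.cauchy_schwarz hβ ?_ ?_ ?_ ?_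
  · exact (continuous_comp_up (continuous_slabObs β Λ l) _).sub continuous_const
  · exact (continuous_comp_up (continuous_slabObs β Λ l) _).sub continuous_const
  · intro σ τ h
    simp only [dependsOn_slabObs β Λ l (Int.natCast_nonneg p) h]
  · intro σ τ h
    simp only [dependsOn_slabObs β Λ l (Int.natCast_nonneg q) h]

/-! ### Comparison with the covariance of the heights -/

theorem shift_mem_faceBox_of_le (l : ℕ) (k : ℕ) {n : ℕ} (hn : l + k + 2 ≤ n) (p : ℤ × ℤ)
    (hp : p ∈ slab l) : p + (0, (k : ℤ)) ∈ faceBox n := by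
  rw [mem_slab] at hp
  rw [mem_faceBox]
  simp only [Prod.fst_add, Prod.snd_add]
  omega

theorem mem_hull_slab {l : ℕ} {q : ℤ × ℤ} (h : q ∈ hull (slab l)) : q.2 ≤ 2 := by
  rcases Finset.mem_union.1 h with h | h
  · rw [mem_slab] at h
    omega
  · obtain ⟨p, hp, hpq⟩ := Finset.mem_biUnion.1 h
    rw [mem_slab] at hp
    rcases mem_nbrs.1 hpq with rfl | rfl | rfl | rfl <;> dsimp only <;> omega

theorem disjoint_shift_borderEdges_slab (l : ℕ) {k : ℤ} (hk : 3 ≤ k) :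
    Disjoint ((borderEdges (slab l)).map (shiftEdge (0, k))) (borderEdges (slab l)) := by
  rw [Finset.disjoint_left]
  intro e he he'
  obtain ⟨⟨⟨i, j⟩, b⟩, h1, rfl⟩ := Finset.mem_map.1 he
  have h1 := mem_borderEdges_slab.1 h1
  have h2 : ((i + 0, j + k), b) ∈ borderEdges (slab l) := he'
  have h2 := mem_borderEdges_slab.1 h2
  omega

/-- Duality followed by `IsCluster.cov_le`, with a constant independent of `k`. The base face may be
taken in either row of the upper slab; the choice `j` later handles both parities of the distance.
From $k\ge3$ on the two slabs share no edge. -/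
theorem exists_corr_slabObs_le {β : ℝ} (hβ : 0 < β) (Λ l : ℕ) (j : ℕ) (hj : j < 2) (hl : 0 < l) :
    ∃ C, 0 ≤ C ∧ ∀ k : ℕ, 3 ≤ k → ∀ c : ℝ,
      heightCovInf β (0, 0) (0, ((k + j : ℕ) : ℤ)) < (c : EReal) →
      (corr β (slabObs β Λ l) k).re ≤ C * c := by
  set E := borderEdges (slab l) with hE
  set a' : (ℤ × ℤ) × Bool → ℤ → ℝ := fun e d => slabCoeff β e (-d) with ha'
  obtain ⟨B, hB0, hB⟩ := exists_abs_edgeFun_le β Λ E (slabCoeff β)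
  obtain ⟨B', hB'0, hB'⟩ := exists_abs_edgeFun_le β Λ E a'
  have ha : ((0, (j : ℤ)) : ℤ × ℤ) ∈ slab l := by rw [mem_slab]; dsimp only; omega
  have hb : ((0, 0) : ℤ × ℤ) ∈ slab l := by rw [mem_slab]; dsimp only; omega
  obtain ⟨C, hC0, hC⟩ := IsCluster.cov_le hβ (isCluster_slab ha) (isCluster_slab hb) (Λ : ℤ)
    (B := max B B') (le_max_of_le_left hB0)
  refine ⟨C, hC0, fun k hk c hc => ?_⟩
  have key : ∀ n : ℕ, l + k + 2 ≤ n →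
      (gibbs β (dirEdges n) (fun σ => slabObs β Λ l (σ ∘ up k) *
          (starRingEnd ℂ) (slabObs β Λ l σ)) -
        gibbs β (dirEdges n) (fun σ => slabObs β Λ l (σ ∘ up k)) *
        gibbs β (dirEdges n) fun σ => (starRingEnd ℂ) (slabObs β Λ l σ)).re ≤
      C * heightCov n β (0, 0) (0, ((k + j : ℕ) : ℤ)) := by
    intro n hn
    have hv : ∀ p ∈ slab l, p + (0, (k : ℤ)) ∈ faceBox n := shift_mem_faceBox_of_le l k hn
    have hv' : ∀ p ∈ slab l, p + (0, 0) ∈ faceBox n :=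
      shift_mem_faceBox_of_le l 0 (n := n) (by omega)
    have hE1 := shift_borderEdges_subset hv
    have hE0 : E ⊆ posEdges n := by
      have h1 := shift_borderEdges_subset hv'
      have h2 : shiftEdge (0, 0) = Function.Embedding.refl _ := by
        ext1 e
        exact Prod.ext (add_zero e.1) rfl
      rwa [h2, Finset.map_refl] at h1
    have h1 := hC (edgeFun β Λ E (slabCoeff β)) (edgeFun β Λ E a')
      (isGradLocal_edgeFun fun h => (hB h).trans (le_max_left _ _))
      (isGradLocal_edgeFun fun h => (hB' h).trans (le_max_right _ _)) n (0, k) (0, 0) hv hv'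
      fun p hp q hq hpq => by
        have h2 := mem_hull_slab hq
        rw [mem_slab] at hp
        have := congrArg Prod.snd hpq
        simp only [Prod.snd_add] at this
        omega
    have ht : ∀ h : ℤ × ℤ → ℤ, translate (0, 0) h = h := fun h => funext fun g => by
      change h (g + (0, 0)) = h g
      exact congrArg h (add_zero g)
    simp only [ht] at h1
    have g1 := gibbs_edgeObs_mul hβ Λ hE0 hE1 (disjoint_shift_borderEdges_slab l (by omega))
      (slabCoeff β) a'
    have g2 := gibbs_edgeObs_translate hβ Λ hE1 (slabCoeff β)
    have g3 := gibbs_edgeObs hβ Λ hE0 a'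
    have e3 : (fun σ => (starRingEnd ℂ) (slabObs β Λ l σ)) = edgeObs β Λ E a' :=
      funext fun σ => edgeObs_conj β Λ E (slabCoeff β) σ
    have e1 : (fun σ : Spins => slabObs β Λ l (σ ∘ up k) * (starRingEnd ℂ) (slabObs β Λ l σ)) =
        fun σ => edgeObs β Λ E (slabCoeff β)
          (σ ∘ (Equiv.addRight ((0, (k : ℤ)) : ℤ × ℤ) : Equiv.Perm (ℤ × ℤ))) *
            edgeObs β Λ E a' σ := by
      funext σ
      rw [← e3]
      rfl
    have e2 : (fun σ : Spins => slabObs β Λ l (σ ∘ up k)) = fun σ => edgeObs β Λ E (slabCoeff β)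
        (σ ∘ (Equiv.addRight ((0, (k : ℤ)) : ℤ × ℤ) : Equiv.Perm (ℤ × ℤ))) := rfl
    rw [e1, e2, e3, g1, g2, g3, ← Complex.ofReal_mul, ← Complex.ofReal_sub, Complex.ofReal_re,
      heightCov_eq hβ.le]
    have hS := hSum_one_pos hβ n
    set S := hSum β n fun _ => 1 with hSdef
    have e4 : (hSum β n fun h => (h (0, 0) : ℝ) * h (0, ((k + j : ℕ) : ℤ))) =
        hSum β n fun h => (h ((0, (j : ℤ)) + (0, (k : ℤ))) : ℝ) * h ((0, 0) + (0, 0)) := by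
      congr 1
      funext h
      have : ((0, (j : ℤ)) + (0, (k : ℤ)) : ℤ × ℤ) = (0, ((k + j : ℕ) : ℤ)) := by
        ext <;> simp [add_comm]
      rw [this, mul_comm]
      rfl
    rw [e4]
    have h5 : ∀ X Y Z W : ℝ, S * X - Y * Z ≤ C * (S * W) →
        X / S - Y / S * (Z / S) ≤ C * (W / S) := by
      intro X Y Z W h
      have : X / S - Y / S * (Z / S) = (S * X - Y * Z) / S ^ 2 := by field_simp
      rw [this, div_le_iff₀ (by positivity)]
      have : C * (W / S) * S ^ 2 = C * (S * W) := by field_simp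
      rw [this]
      exact h
    exact h5 _ _ _ _ h1
  have hF := continuous_slabObs β Λ l
  have c1 := continuous_comp_up hF k
  have c2 : Continuous fun σ => (starRingEnd ℂ) (slabObs β Λ l σ) := Complex.continuous_conj.comp hF
  have c3 : Continuous fun σ : Spins => slabObs β Λ l (σ ∘ up k) *
      (starRingEnd ℂ) (slabObs β Λ l σ) := c1.mul c2
  have hlim := (Complex.continuous_re.tendsto _).comp ((tendsto_omega hβ.le c3).sub
    ((tendsto_omega hβ.le c1).mul (tendsto_omega hβ.le c2)))
  have hm : omega β (fun σ : Spins => slabObs β Λ l (σ ∘ up k)) = omega β (slabObs β Λ l) :=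
    omega_translate hβ.le (0, (k : ℤ)) hF
  rw [hm, ← corr_eq hβ.le hF] at hlim
  -- The infinite-volume covariance is a lower limit, so the bound holds in infinitely many volumes,
  -- which suffices because the left side converges.
  have hfreq := frequently_lt_of_liminf_lt (by isBoundedDefault) hc
  refine le_of_tendsto_of_frequently hlim ?_
  refine (hfreq.and_eventually (eventually_ge_atTop (l + k + 2))).mono fun n hn => ?_
  exact (key n hn.2).trans (mul_le_mul_of_nonneg_left (EReal.coe_lt_coe_iff.1 hn.1).le hC0)

/-- Log-convexity trades the uncontrolled constants `C`, `C'` for the correlation at distance $2$.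
Cauchy–Schwarz between distances $2$ and $2k+2$ then gives every distance $k+2$. -/
theorem norm_corr_slabObs_le {β : ℝ} (hβ : 0 < β) {M : ℝ} (hM : 0 ≤ M)
    (hf : ∃ᶠ k : ℕ in atTop, heightCovInf β (0, 0) (0, (k : ℤ)) < (Real.exp (-(M * k)) : EReal))
    (Λ l : ℕ) (hl : 0 < l) (k : ℕ) :
    ‖corr β (slabObs β Λ l) (k + 2)‖ ≤ ‖corr β (slabObs β Λ l) 2‖ * Real.exp (-(M * k)) := by
  obtain ⟨C, hC0, hC⟩ := exists_corr_slabObs_le hβ Λ l 0 (by norm_num) hl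
  obtain ⟨C', hC'0, hC'⟩ := exists_corr_slabObs_le hβ Λ l 1 (by norm_num) hl
  set a : ℕ → ℝ := fun r => (corr β (slabObs β Λ l) (r + r + 2)).re with ha
  have hq : ∀ r : ℕ, Real.exp (-(2 * M)) ^ r = Real.exp (-(M * (2 * r : ℕ))) := fun r => by
    rw [← Real.exp_nat_mul]
    push_cast
    ring_nf
  have hexp : ∀ k k' : ℕ, k ≤ k' → Real.exp (-(M * k')) ≤ Real.exp (-(M * k)) := fun k k' h =>
    Real.exp_le_exp.2 (neg_le_neg (mul_le_mul_of_nonneg_left (by exact_mod_cast h) hM))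
  have hgeo := le_geometric_of_logConvex (a := a) (q := Real.exp (-(2 * M))) (C := C + C')
    (corr_slabObs_nonneg hβ.le Λ l) ?_ (Real.exp_pos _) ?_
  · have h1 := norm_corr_slabObs_sq_le hβ.le Λ l 0 k
    have h2 := (hgeo k)
    have h0 := corr_slabObs_nonneg hβ.le Λ l 0
    have h3 : a 0 ≤ ‖corr β (slabObs β Λ l) 2‖ := (Complex.re_le_norm _).trans (by simp)
    rw [hq] at h2
    have h4 : Real.exp (-(M * (2 * k : ℕ))) = Real.exp (-(M * k)) ^ 2 := by
      rw [← Real.exp_nat_mul]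
      push_cast
      ring_nf
    rw [h4] at h2
    have h5 : ‖corr β (slabObs β Λ l) (k + 2)‖ ≤ a 0 * Real.exp (-(M * k)) := by
      refine abs_le_of_sq_le_sq' ?_ (mul_nonneg h0 (Real.exp_pos _).le) |>.2
      rw [Nat.cast_zero, zero_add] at h1
      refine h1.trans ?_
      have : (corr β (slabObs β Λ l) (0 + 0 + 2)).re = a 0 := by simp [ha]
      calc _ = a 0 * a k := by rw [← this]
        _ ≤ a 0 * (a 0 * Real.exp (-(M * k)) ^ 2) := mul_le_mul_of_nonneg_left h2 h0
        _ = _ := by ring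
    exact h5.trans (mul_le_mul_of_nonneg_right h3 (Real.exp_pos _).le)
  · intro r
    refine le_trans ?_ (norm_corr_slabObs_sq_le hβ.le Λ l r (r + 2))
    have h1 := Complex.abs_re_le_norm (corr β (slabObs β Λ l) (r + (r + 2 : ℕ) + 2))
    have h2 : (((r + 1 : ℕ) : ℤ) + (r + 1 : ℕ) + 2) = r + (r + 2 : ℕ) + 2 := by push_cast; ring
    simp only [ha]
    rw [h2, ← sq_abs]
    gcongr
  · have ht : Tendsto (fun k : ℕ => (k - 2) / 2) atTop atTop := by
      exact (Nat.tendsto_div_const_atTop two_ne_zero).comp (tendsto_sub_atTop_nat 2)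
    refine ht.frequently ((hf.and_eventually (eventually_ge_atTop 5)).mono fun k hk => ?_)
    obtain ⟨hk, hk5⟩ := hk
    have he := Real.exp_pos (-(M * (k : ℝ)))
    -- An odd height distance is used through slabs at distance $k-1$ with the base face in the
    -- second row; thus either parity bounds an even correlation.
    obtain ⟨r, hr | hr⟩ : ∃ r, k = 2 * r + 2 ∨ k = 2 * r + 3 := ⟨(k - 2) / 2, by omega⟩
    · have h1 : (k - 2) / 2 = r := by omega
      have h2 := hC k (by omega) _ hk
      rw [h1, hq]
      have h3 : a r = (corr β (slabObs β Λ l) k).re := by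
        simp only [ha]
        congr 2
        omega
      rw [h3]
      have h4 := hexp (2 * r) k (by omega)
      nlinarith
    · have h1 : (k - 2) / 2 = r := by omega
      have h2 := hC' (k - 1) (by omega) _ (by rwa [Nat.sub_add_cancel (by omega)])
      rw [h1, hq]
      have h3 : a r = (corr β (slabObs β Λ l) ((k - 1 : ℕ) : ℤ)).re := by
        simp only [ha]
        congr 2
        omega
      rw [h3]
      have h4 := hexp (2 * r) k (by omega)
      nlinarith

/-- The bound for slab observables passes to $\Lambda\to\infty$, where the observable has modulus
one; its correlation at distance $2$ is then at most $2$, whatever the width. -/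
theorem norm_omega_bridge_le {β : ℝ} (hβ : 0 < β) {M : ℝ} (hM : 0 ≤ M)
    (hf : ∃ᶠ k : ℕ in atTop, heightCovInf β (0, 0) (0, (k : ℤ)) < (Real.exp (-(M * k)) : EReal))
    (l : ℕ) (hl : 0 < l) (k : ℕ) :
    ‖omega β fun σ => (pairChar ((l : ℤ), 1) (-(l : ℤ), 1) (σ ∘ up (k + 2)) : ℂ) *
      (starRingEnd ℂ) (pairChar ((l : ℤ), 1) (-(l : ℤ), 1) σ : ℂ)‖ ≤
      2 * Real.exp (-(M * k)) + ‖omega β fun σ => (pairChar ((l : ℤ), 1) (-(l : ℤ), 1) σ : ℂ)‖ := by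
  set F : C(Spins, ℂ) := ⟨_, continuous_char (pairChar ((l : ℤ), 1) (-(l : ℤ), 1))⟩ with hF
  have hlim := tendsto_slabObs hβ.le l
  have hF1 : ∀ σ, ‖F σ‖ ≤ 1 := fun _ => (Circle.norm_coe _).le
  have hconj : Continuous fun σ => (starRingEnd ℂ) (F σ) :=
    Complex.continuous_conj.comp F.continuous
  have hm : ‖omega β F‖ ≤ 1 := norm_omega_le hβ.le F.continuous hF1
  have hm' : ‖omega β fun σ => (starRingEnd ℂ) (F σ)‖ ≤ 1 := norm_omega_le hβ.le hconj fun σ => by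
    rw [RCLike.norm_conj]; exact hF1 σ
  have hX : ∀ j : ℤ, ‖omega β fun σ : Spins => F (σ ∘ up j) * (starRingEnd ℂ) (F σ)‖ ≤ 1 := fun j =>
    norm_omega_le hβ.le ((continuous_comp_up F.continuous j).mul hconj) fun σ => by
      change ‖F (σ ∘ up j) * (starRingEnd ℂ) (F σ)‖ ≤ 1
      rw [norm_mul, RCLike.norm_conj]
      exact mul_le_one₀ (hF1 _) (norm_nonneg _) (hF1 _)
  have h1 : ‖corr β F (k + 2)‖ ≤ ‖corr β F 2‖ * Real.exp (-(M * k)) :=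
    le_of_tendsto_of_tendsto' (((continuous_corr hβ.le _).tendsto _).comp hlim).norm
      ((((continuous_corr hβ.le _).tendsto _).comp hlim).norm.mul_const _)
      fun Λ => norm_corr_slabObs_le hβ hM hf Λ l hl k
  have h2 : ‖corr β F 2‖ ≤ 2 := by
    rw [corr_eq hβ.le F.continuous]
    refine (norm_sub_le _ _).trans ?_
    rw [norm_mul]
    have := mul_le_one₀ hm (norm_nonneg _) hm'
    linarith [hX 2]
  have h3 := corr_eq hβ.le F.continuous (k + 2)
  have h4 := eq_add_of_sub_eq h3.symm
  change ‖omega β fun σ : Spins => F (σ ∘ up (k + 2)) * (starRingEnd ℂ) (F σ)‖ ≤ _ + ‖omega β F‖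
  rw [h4]
  refine (norm_add_le _ _).trans (add_le_add (h1.trans ?_) ?_)
  · exact mul_le_mul_of_nonneg_right h2 (Real.exp_pos _).le
  · rw [norm_mul]
    exact mul_le_of_le_one_right (norm_nonneg _) hm'

theorem omega_vertical_eq {β : ℝ} (hβ : 0 ≤ β) (l k : ℕ) :
    omega β (fun σ => (pairChar (-(l : ℤ), 1) (-(l : ℤ), 1 + k) σ : ℂ)) =
      omega β fun σ => (pairChar (0, 0) ((k : ℤ), 0) σ : ℂ) := by
  rw [← omega_swap hβ (continuous_char (pairChar (0, 0) ((k : ℤ), 0)))]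
  refine Eq.trans ?_
    (omega_translate hβ (-(l : ℤ), 1) (continuous_char (pairChar (0, 0) (0, (k : ℤ)))))
  congr 1
  funext σ
  have h1 : ((0, 0) + (-(l : ℤ), 1) : ℤ × ℤ) = (-(l : ℤ), 1) := by simp
  have h2 : ((0, (k : ℤ)) + (-(l : ℤ), 1) : ℤ × ℤ) = (-(l : ℤ), 1 + (k : ℤ)) := by
    simp [add_comm]
  exact (congrArg₂ (fun x y => (pairChar x y σ : ℂ)) h1 h2).symm

/-- Two readings of the same four spins at the corners of a rectangle: paired along its vertical
sides or along its horizontal ones. -/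
theorem coe_bridge_eq (l k : ℕ) (σ : Spins) :
    (pairChar (-(l : ℤ), 1) (-(l : ℤ), 1 + k) σ : ℂ) *
      (starRingEnd ℂ) (pairChar (-(l : ℤ), 1) (-(l : ℤ), 1 + k) (σ ∘ reflHoriz) : ℂ) =
    (pairChar ((l : ℤ), 1) (-(l : ℤ), 1) (σ ∘ up k) : ℂ) *
      (starRingEnd ℂ) (pairChar ((l : ℤ), 1) (-(l : ℤ), 1) σ : ℂ) := by
  have h1 : ∀ x y, pairChar x y σ = σ x / σ y := fun _ _ => rfl
  have h2 : ∀ x y, pairChar x y (σ ∘ reflHoriz) = σ (reflHoriz x) / σ (reflHoriz y) :=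
    fun _ _ => rfl
  have h3 : ∀ x y, pairChar x y (σ ∘ up k) = σ (up k x) / σ (up k y) := fun _ _ => rfl
  simp only [h1, h2, h3, up_apply, reflHoriz_apply, neg_neg, ← Circle.coe_inv_eq_conj,
    ← Circle.coe_mul, inv_div, div_mul_div_comm]
  congr 2; exact mul_comm _ _

/-- Cauchy–Schwarz for the reflection in the vertical axis, between the left side of the rectangle
and the constant $1$. The square here is the source of the factor two between the masses. -/
theorem norm_omega_vertical_sq_le {β : ℝ} (hβ : 0 ≤ β) (l k : ℕ) :
    ‖omega β fun σ => (pairChar (0, 0) ((k : ℤ), 0) σ : ℂ)‖ ^ 2 ≤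
      ‖omega β fun σ => (pairChar ((l : ℤ), 1) (-(l : ℤ), 1) (σ ∘ up k) : ℂ) *
        (starRingEnd ℂ) (pairChar ((l : ℤ), 1) (-(l : ℤ), 1) σ : ℂ)‖ := by
  set G : Spins → ℂ := fun σ => (pairChar (-(l : ℤ), 1) (-(l : ℤ), 1 + k) σ : ℂ) with hG
  have cG : Continuous G := continuous_char _
  have hS : DependsOn G {x | x.1 ≤ 0} := by
    intro σ τ h
    have h' : ∀ x : ℤ × ℤ, x.1 ≤ 0 → σ x = τ x := fun x hx => h x hx
    have h1 : ∀ (x y : ℤ × ℤ) (σ : Spins), pairChar x y σ = σ x / σ y := fun _ _ _ => rfl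
    simp only [hG, h1]
    rw [h' _ (by simp), h' _ (by simp)]
  have h1 := isReflection_reflHoriz.cauchy_schwarz hβ (B := fun _ => 1) cG continuous_const hS
    ((dependsOn_const _).mono (Set.empty_subset _))
  have e1 : reflForm β reflHoriz G (fun _ => 1) = omega β G := by simp [reflForm]
  have e2 : (reflForm β reflHoriz (fun _ => 1) fun _ => 1).re = 1 := by
    simp [reflForm, omega_const]
  rw [e1, e2, mul_one, omega_vertical_eq hβ, reflForm] at h1
  simp only [hG, coe_bridge_eq] at h1
  exact h1.trans (Complex.re_le_norm _)

/-- If the covariance of the heights is exponentially small infinitely often, then the two-point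
function decays exponentially. -/
theorem xyTwoPoint_sq_le {β : ℝ} (hβ : 0 < β) {M : ℝ} (hM : 0 ≤ M)
    (hf : ∃ᶠ k : ℕ in atTop, heightCovInf β (0, 0) (0, (k : ℤ)) < (Real.exp (-(M * k)) : EReal))
    (k : ℕ) : xyTwoPoint β (0, 0) (((k + 2 : ℕ) : ℤ), 0) ^ 2 ≤ 2 * Real.exp (-(M * k)) := by
  have h1 : Tendsto (fun l : ℕ => supDist ((l : ℤ), (1 : ℤ)) (-(l : ℤ), 1)) atTop atTop := by
    refine tendsto_atTop_mono (fun l => ?_) tendsto_id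
    simp only [supDist, id]
    omega
  have h2 := (tendsto_const_nhds (x := 2 * Real.exp (-(M * (k : ℝ))))).add
    (tendsto_omega_pairChar hβ.le h1).norm
  rw [norm_zero, add_zero] at h2
  -- The left side does not involve the half-width `l`, and the mean of the bridge vanishes as
  -- $l\to\infty$.
  refine ge_of_tendsto h2 ((eventually_gt_atTop 0).mono fun l hl => ?_)
  refine le_trans ?_ (norm_omega_bridge_le hβ hM hf l hl k)
  have h3 := norm_omega_vertical_sq_le hβ.le l (k + 2)
  rw [xyTwoPoint_eq hβ.le]
  refine le_trans ?_ (h3.trans (le_of_eq ?_))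
  · rw [← sq_abs]
    gcongr
    exact Complex.abs_re_le_norm _
  · push_cast
    rfl

end XYHeight

/-! ### Exponential rates and the comparison of masses -/

namespace XYHeight

/-! ### Exponential rates -/

/-- The rate `-(1/k) log x`. -/
noncomputable def rate (k : ℕ) (x : ENNReal) : EReal :=
  ((-(1 / (k : ℝ)) : ℝ) : EReal) * ENNReal.log x

theorem rate_antitone (k : ℕ) : Antitone (rate k) := fun x y h => by
  have h1 : ((-(1 / (k : ℝ)) : ℝ) : EReal) ≤ 0 := by
    have : -(1 / (k : ℝ)) ≤ 0 := neg_nonpos.2 (by positivity)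
    exact_mod_cast this
  unfold rate
  rw [mul_comm, mul_comm _ (ENNReal.log x)]
  exact EReal.mul_le_mul_of_nonpos_right (ENNReal.log_le_log h) h1

theorem rate_exp {k : ℕ} (hk : 0 < k) (b : ℝ) :
    rate k (ENNReal.ofReal (Real.exp (-(b * k)))) = b := by
  rw [rate, ENNReal.log_ofReal_of_pos (Real.exp_pos _), Real.log_exp, ← EReal.coe_mul]
  congr 1
  field_simp

theorem le_rate {k : ℕ} (hk : 0 < k) {b x : ℝ} (h : x ≤ Real.exp (-(b * k))) :
    (b : EReal) ≤ rate k (ENNReal.ofReal x) := by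
  rw [← rate_exp hk b]
  exact rate_antitone k (ENNReal.ofReal_le_ofReal h)

theorem le_massXY {β b : ℝ}
    (h : ∀ᶠ k : ℕ in atTop, xyTwoPoint β (0, 0) ((k : ℤ), 0) ≤ Real.exp (-(b * k))) :
    (b : EReal) ≤ massXY β := by
  refine le_liminf_of_le (by isBoundedDefault) ?_
  filter_upwards [h, eventually_gt_atTop 0] with k hk hk0
  exact le_rate hk0 hk

theorem massXY_nonneg {β : ℝ} (hβ : 0 ≤ β) : 0 ≤ massXY β := by
  refine le_massXY (b := 0) (Eventually.of_forall fun k => ?_)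
  rw [zero_mul, neg_zero, Real.exp_zero, xyTwoPoint_eq hβ]
  exact (Complex.re_le_norm _).trans (norm_omega_le hβ (continuous_char _) fun _ =>
    (Circle.norm_coe _).le)

/-! ### Infinite temperature -/

theorem xyTwoPoint_zero {x y : ℤ × ℤ} (h : x ≠ y) : xyTwoPoint 0 x y = 0 := by
  have h1 : ∀ n, charMean 0 (dirEdges n) (pairChar x y) = 0 := by
    intro n
    -- At $\beta=0$ the twist costs nothing, so the profile may be raised at `y` without limit.
    have h2 : ∀ t : ℝ, |charMean 0 (dirEdges n) (pairChar x y)| ≤ Real.exp (-t) := by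
      intro t
      have := abs_charMean_pairChar_le le_rfl n x y (Pi.single y t)
      rwa [Pi.single_eq_of_ne h, Pi.single_eq_same, zero_sub, zero_mul, add_zero] at this
    exact abs_nonpos_iff.1 (ge_of_tendsto
      (Real.tendsto_exp_neg_atTop_nhds_zero) (Eventually.of_forall h2))
  have h3 := (omega_char 0 le_rfl (pairChar x y)).1
  simp only [h1] at h3
  rw [xyTwoPoint_eq le_rfl]
  exact (tendsto_nhds_unique h3 tendsto_const_nhds)

theorem massXY_zero : massXY 0 = ⊤ := by
  rw [EReal.eq_top_iff_forall_lt]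
  intro b
  refine (EReal.coe_lt_coe (lt_add_one b)).trans_le (le_massXY ?_)
  filter_upwards [eventually_gt_atTop 0] with k hk
  rw [xyTwoPoint_zero]
  · exact (Real.exp_pos _).le
  · rw [Ne, Prod.mk.injEq]
    omega

theorem besselI_zero {d : ℤ} (h : d ≠ 0) : besselI 0 d = 0 := by
  have : ∀ j : ℕ, 2 * j + d.natAbs ≠ 0 := fun j => by omega
  simp [besselI, zero_pow (this _)]

theorem eq_zero_of_hWeight_zero {n : ℕ} {k : faceBox n → ℤ} (h : hWeight 0 n (extH k) ≠ 0) :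
    ∀ a, extH k a = 0 := by
  have h1 : ∀ e, gradH (extH k) e = 0 := by
    intro e
    by_cases he : e ∈ posEdges n
    · by_contra hne
      exact h (Finset.prod_eq_zero he (besselI_zero hne))
    · exact gradH_of_notMem k he
  rintro ⟨i, j⟩
  rw [height_eq_sum]
  exact Finset.sum_eq_zero fun _ _ => h1 _

theorem heightCov_zero (n : ℕ) (a b : ℤ × ℤ) : heightCov n 0 a b = 0 := by
  rw [heightCov_eq le_rfl]
  have : hSum 0 n (fun h => (h a : ℝ) * h b) = 0 := by
    refine (tsum_congr fun k => ?_).trans tsum_zero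
    by_cases hk : hWeight 0 n (extH k) = 0
    · rw [hk, zero_mul]
    · simp [eq_zero_of_hWeight_zero hk a]
  rw [this, zero_div]

theorem heightCovInf_nonneg {β : ℝ} (hβ : 0 ≤ β) (a b : ℤ × ℤ) : 0 ≤ heightCovInf β a b := by
  refine le_liminf_of_le (by isBoundedDefault) (Eventually.of_forall fun n => ?_)
  rcases hβ.eq_or_lt with rfl | h
  · rw [heightCov_zero]
    rfl
  · exact EReal.coe_nonneg.2 (heightCov_nonneg h n a b)

/-! ### Comparison of the masses -/

/-- The covariance of the heights does not decay faster than twice the mass of the XY model. -/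
theorem eventually_exp_le_heightCovInf {β : ℝ} (hβ : 0 < β) {m M : ℝ} (hm : massXY β = m)
    (hM0 : 0 ≤ M) (hM : 2 * m < M) :
    ∀ᶠ k : ℕ in atTop, (Real.exp (-(M * k)) : EReal) ≤ heightCovInf β (0, 0) (0, (k : ℤ)) := by
  by_contra hcon
  simp only [← not_lt] at hcon
  have hf : ∃ᶠ k : ℕ in atTop, heightCovInf β (0, 0) (0, (k : ℤ)) < (Real.exp (-(M * k)) : EReal) :=
    hcon
  -- The gap between `b` and $M/2$ absorbs the factor $2$ and the offset $k+2$ for large distances.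
  obtain ⟨b, hb1, hb2⟩ := exists_between (show m < M / 2 by linarith)
  have h1 : (b : EReal) ≤ massXY β := by
    refine le_massXY ?_
    have hlim : Tendsto (fun k : ℕ => (M - 2 * b) * (k : ℝ)) atTop atTop :=
      tendsto_natCast_atTop_atTop.const_mul_atTop (by linarith)
    filter_upwards [hlim.eventually_ge_atTop (2 * M + Real.log 2), eventually_ge_atTop 2]
      with k hk hk2
    obtain ⟨j, rfl⟩ := Nat.exists_eq_add_of_le hk2
    have h2 := xyTwoPoint_sq_le hβ hM0 hf j
    rw [add_comm 2 j] at *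
    refine (abs_le_of_sq_le_sq' (h2.trans ?_) (Real.exp_pos _).le).2
    rw [← Real.exp_nat_mul]
    nth_rewrite 1 [← Real.exp_log two_pos]
    rw [← Real.exp_add]
    refine Real.exp_le_exp.2 ?_
    push_cast at *
    linarith
  rw [hm, EReal.coe_le_coe_iff] at h1
  linarith

theorem massHeight_le {β : ℝ} {M : ℝ} (h : ∀ᶠ k : ℕ in atTop,
    (Real.exp (-(M * k)) : EReal) ≤ heightCovInf β (0, 0) (0, (k : ℤ))) (hM : 0 ≤ M) :
    massHeight β ≤ M := by
  refine liminf_le_of_frequently_le (Eventually.frequently ?_) (by isBoundedDefault)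
  filter_upwards [h, eventually_gt_atTop 0] with k hk hk0
  refine le_trans (rate_antitone k (le_min ?_ ?_)) (rate_exp hk0 M).le
  · have := EReal.toENNReal_le_toENNReal hk
    rwa [EReal.toENNReal_of_ne_top (EReal.coe_ne_top _), EReal.toReal_coe] at this
  · rw [ENNReal.ofReal_le_one]
    exact Real.exp_le_one_iff.2 (neg_nonpos.2 (by positivity))

/-- The negative part of $\log c_k+2mk$ serves as error: the hypothesis with $M=2m+\delta$ bounds it
by $\delta k$ eventually. Capping $c_k$ at one makes it real even where the covariance is infinite.
-/
theorem exists_error {c : ℕ → EReal} {m : ℝ}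
    (hm : 0 ≤ m) (h : ∀ M, 2 * m < M → ∀ᶠ k : ℕ in atTop, (Real.exp (-(M * k)) : EReal) ≤ c k) :
    ∃ ε : ℕ → ℝ, ε =o[atTop] (fun n : ℕ => (n : ℝ)) ∧
      ∀ᶠ k : ℕ in atTop, (Real.exp (-(2 * m * k) + ε k) : EReal) ≤ c k := by
  set d : ℕ → ℝ := fun k => (min (c k) 1).toReal with hd
  have hdc : ∀ M, 2 * m < M → ∀ᶠ k : ℕ in atTop, Real.exp (-(M * k)) ≤ d k ∧
      (d k : EReal) ≤ c k := by
    intro M hM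
    filter_upwards [h M hM] with k hk
    have h1 : (Real.exp (-(M * k)) : EReal) ≤ min (c k) 1 := by
      refine le_min hk ?_
      have : Real.exp (-(M * k)) ≤ 1 :=
        Real.exp_le_one_iff.2 (neg_nonpos.2 (mul_nonneg (by linarith) (Nat.cast_nonneg k)))
      exact_mod_cast this
    have h2 : min (c k) 1 ≠ ⊤ := ne_top_of_le_ne_top (EReal.coe_ne_top 1) (min_le_right _ _)
    have h3 : min (c k) 1 ≠ ⊥ := ne_bot_of_le_ne_bot (EReal.coe_ne_bot _) h1
    have h4 : ((d k : ℝ) : EReal) = min (c k) 1 := EReal.coe_toReal h2 h3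
    refine ⟨?_, h4.le.trans (min_le_left _ _)⟩
    rwa [← h4, EReal.coe_le_coe_iff] at h1
  refine ⟨fun k => min 0 (Real.log (d k) + 2 * m * k), ?_, ?_⟩
  · rw [isLittleO_iff]
    intro δ hδ
    filter_upwards [hdc (2 * m + δ) (by linarith)] with k hk
    have h1 := (Real.le_log_iff_exp_le ((Real.exp_pos _).trans_le hk.1)).2 hk.1
    have h2 : 0 ≤ δ * (k : ℝ) := by positivity
    rw [Real.norm_of_nonpos (min_le_left _ _), Real.norm_of_nonneg (Nat.cast_nonneg k), neg_le]
    refine le_min (by linarith) ?_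
    linarith
  · filter_upwards [hdc (2 * m + 1) (by linarith)] with k hk
    refine le_trans (EReal.coe_le_coe ?_) hk.2
    rw [← Real.le_log_iff_exp_le ((Real.exp_pos _).trans_le hk.1)]
    have := min_le_right 0 (Real.log (d k) + 2 * m * k)
    linarith

end XYHeight

theorem mainTheorem2 (β : ℝ) (hβ : 0 ≤ β) :
    (∃ ε : ℕ → ℝ, ε =o[atTop] (fun n : ℕ => (n : ℝ)) ∧
      ∀ᶠ n : ℕ in atTop,
        ((EReal.exp (-(2 * XYHeight.massXY β * (n : EReal)) + ((ε n : ℝ) : EReal)) : ENNReal) :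
            EReal)
          ≤ XYHeight.heightCovInf β (0, 0) (0, (n : ℤ))) ∧
    XYHeight.massHeight β ≤ 2 * XYHeight.massXY β := by
  have h0 := XYHeight.massXY_nonneg hβ
  have hC := XYHeight.heightCovInf_nonneg hβ
  -- Infinite mass, which includes $\beta=0$, makes the lower bound $e^{-\infty}=0$. The remaining
  -- case has $\beta>0$, hence positive Bessel weights.
  by_cases htop : XYHeight.massXY β = ⊤
  · have h2 : (2 : EReal) * ⊤ = ⊤ := EReal.coe_mul_top_of_pos (x := 2) two_pos
    rw [htop, h2]
    refine ⟨⟨fun _ => 0, isLittleO_zero _ _, ?_⟩, le_top⟩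
    filter_upwards [eventually_gt_atTop 0] with n hn
    have h3 : (⊤ : EReal) * (n : EReal) = ⊤ :=
      EReal.top_mul_coe_of_pos (x := (n : ℝ)) (by exact_mod_cast hn)
    rw [h3, EReal.neg_top, EReal.bot_add, EReal.exp_bot, EReal.coe_ennreal_zero]
    exact hC _ _
  · have hβ0 : 0 < β := hβ.lt_of_ne fun h => htop (h ▸ XYHeight.massXY_zero)
    obtain ⟨m, hm⟩ : ∃ m : ℝ, XYHeight.massXY β = m :=
      ⟨_, (EReal.coe_toReal htop (ne_bot_of_le_ne_bot EReal.zero_ne_bot h0)).symm⟩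
    have hm0 : 0 ≤ m := by rwa [hm, EReal.coe_nonneg] at h0
    have key : ∀ M, 2 * m < M → ∀ᶠ k : ℕ in atTop,
        (Real.exp (-(M * k)) : EReal) ≤ XYHeight.heightCovInf β (0, 0) (0, (k : ℤ)) := fun M hM =>
      XYHeight.eventually_exp_le_heightCovInf hβ0 hm (by linarith) hM
    have e2 : (2 : EReal) * (m : EReal) = ((2 * m : ℝ) : EReal) := by
      rw [EReal.coe_mul]; rfl
    rw [hm, e2]
    constructor
    · obtain ⟨ε, hε, h1⟩ := XYHeight.exists_error hm0 key
      refine ⟨ε, hε, h1.mono fun n hn => le_trans (le_of_eq ?_) hn⟩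
      have e3 : -(((2 * m : ℝ) : EReal) * (n : EReal)) + (ε n : EReal) =
          ((-(2 * m * n) + ε n : ℝ) : EReal) := by push_cast; rfl
      rw [e3, EReal.exp_coe, EReal.coe_ennreal_ofReal, max_eq_left (Real.exp_pos _).le]
    · refine EReal.le_of_forall_lt_iff_le.1 fun M hM => ?_
      have hM' := EReal.coe_lt_coe_iff.1 hM
      exact XYHeight.massHeight_le (key M hM') (by linarith)
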